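/- All homology is taken with coefficients in $\mathbb Z/2$. Let $X$ be a finite cell complex (for example a finite graph, possibly with loops and multiple edges, viewed as a 1-dimensional complex) and let $f$ be a filtration function on $X$: a real function on the cells with $f(\tau)\le f(\sigma)$ whenever $\tau$ is a face of $\sigma$. Let $a_1<\dots<a_n$ be the values of $f$ (so the filtration has $n$ steps), and let $X_t$ be the subcomplex of the cells with $f\le a_t$, so $\emptyset=X_0\subset X_1\subset\dots\subset X_n=X$. Let $\mathrm{IC}_t$ be the closure of $X_t\setminus X_{t-1}$. *Forward PH* of $f$ consists of the persistence diagrams, for all $k$, of $H_k(X_1)\to\dots\to H_k(X_n)$. *$(f,f)$-FB persistence* consists of the persistence diagrams, for all $k$, of $H_k$ applied to $$X_1\subset\dots\subset X_n=X\to X/\mathrm{IC}_1\to X/(\mathrm{IC}_1\cup \mathrm{IC}_2)\to\dots\to X/(\mathrm{IC}_1\cup\dots\cup \mathrm{IC}_n)=*,$$ where the union of the intermediate complexes is contracted to a single point and the space $X/(\mathrm{IC}_1\cup\dots\cup\mathrm{IC}_i)$ has time $n+i$ (for $X=\emptyset$ all terms are empty). The persistence diagram of a persistence module is the multiset of pairs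 (birth, death), with birth $<$ death $\le\infty$, of an interval decomposition; for the modules above it exists and is unique. **Proposition.** (a) $(f,f)$-FB persistence has the same expressive power as forward PH for $f$: for filtration functions $f$ on $X$ and $g$ on $Y$, if the $(f,f)$-FB and the $(g,g)$-FB persistence diagrams agree in all dimensions, then so do the forward persistence diagrams of $f$ and $g$; conversely, if $f$ and $g$ have the same number of steps and the same forward persistence diagrams in all dimensions, then they have the same FB persistence diagrams in all dimensions. (b) Let $X=G$ be a finite graph, possibly with loops and multiple edges. Then $(f,f)$-FB persistence is computed as follows. 1. Every class in $H_1(G_i)$, $1\le i\le n$, that is born at time $i$ in the filtration dies exactly at time $n+i$. 2. The 1-dimensional FB diagram consists of the pairs $(i,n+i)$, one for each pair $(i,\infty)$ of the 1-dimensional forward diagram, and of the pairs $(n+i,n+j)$, one for each pair $(i,j)$ with $j<\infty$ of the 0-dimensional forward diagram, that is, one for each component that appears at time $i$ and is merged into a pre-existing component for the first time at $j>i$ in the filtration. 3. The 0-dimensional diagram is found by tracking one vertex representative per component. Fix a vertex born at time $1$, the supernode. In the filtration, spawn the edges one after another in any order compatible with $f$; when an edge joins two components with different representatives, the representative born later dies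 at the time of that edge and the other one represents the merged component (ties are broken arbitrarily, except that the supernode never dies). Then for $i=1,\dots,n$, when $\mathrm{IC}_i$ is contracted at time $n+i$, the representatives of all components that meet $\mathrm{IC}_i$, except the supernode, die at time $n+i$ and are replaced by the supernode. This procedure can always be carried out, and for every way of doing so, the pairs (birth, death) with birth $<$ death after the filtration steps form the 0-dimensional forward diagram (so its finite pairs are the $(i,j)$ of item 2), and after the contraction steps they form the 0-dimensional FB diagram; vertices that never die have death time $\infty$. -/

import Mathlib

universe u v u' v'

set_option maxSynthPendingDepth 3

/-! ## Finite cell complexes (mod 2) -/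

/-- The raw combinatorial data of a finite cell complex: its cells with their dimensions, the
relation `face τ σ` (the cell `τ` lies in the boundary of the closed cell `σ`), and the cellular
boundary with coefficients in `ℤ/2`. -/
structure CellData where
  Cell : Type*
  dim : Cell → ℕ
  face : Cell → Cell → Prop
  bdry : Cell → (Cell →₀ ZMod 2)

/-- The linear map on mod 2 chains induced by a map of cells `φ` that does not raise dimensions:
a cell is sent to its image if the dimension is preserved, and to `0` if the cell is collapsed to
a cell of lower dimension. -/
noncomputable def pushChain {C D : Type*} (dC : C → ℕ) (dD : D → ℕ) (φ : C → D) :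
    (C →₀ ZMod 2) →ₗ[ZMod 2] (D →₀ ZMod 2) :=
  Finsupp.linearCombination (ZMod 2)
    (fun c => if dD (φ c) = dC c then Finsupp.single (φ c) (1 : ZMod 2) else 0)

/-- The sum of the coefficients of a chain. -/
noncomputable def augmentation (C : Type*) : (C →₀ ZMod 2) →ₗ[ZMod 2] ZMod 2 :=
  Finsupp.linearCombination (ZMod 2) (fun _ => (1 : ZMod 2))

/-- The boundary operator on mod 2 chains. -/
noncomputable def CellData.boundary (X : CellData) :
    (X.Cell →₀ ZMod 2) →ₗ[ZMod 2] (X.Cell →₀ ZMod 2) :=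
  Finsupp.linearCombination (ZMod 2) X.bdry

/-- A finite cell complex, given by its cells, its face relation and its cellular boundary mod 2.
Finite multigraphs (with loops), simplicial complexes and regular cell complexes are examples, with
their usual cells, face relation and cellular boundary. -/
structure CellComplex extends CellData where
  finite_cell : Finite Cell
  face_trans : ∀ ρ τ σ, face ρ τ → face τ σ → face ρ σ
  /-- a cell of positive dimension has a vertex -/
  exists_vertex : ∀ σ, dim σ ≠ 0 → ∃ τ, face τ σ ∧ dim τ = 0
  /-- the boundary of a cell involves only faces of codimension one -/
  bdry_face : ∀ σ, ∀ τ ∈ (bdry σ).support, face τ σ ∧ dim σ = dim τ + 1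
  /-- a 1-cell has two ends (counted with multiplicity) -/
  aug_bdry : ∀ σ, dim σ = 1 → augmentation Cell (bdry σ) = 0
  bdry_bdry : ∀ σ, toCellData.boundary (bdry σ) = 0

/-- A cellular map that sends each cell to a cell of the same or of a smaller dimension. -/
structure CellMap (X Y : CellComplex) where
  toFun : X.Cell → Y.Cell
  dim_le : ∀ c, Y.dim (toFun c) ≤ X.dim c
  push_bdry : ∀ c, pushChain X.dim Y.dim toFun (X.bdry c) =
    Y.boundary (pushChain X.dim Y.dim toFun (Finsupp.single c 1))

/-- A subcomplex: a set of cells that contains the faces of its members. -/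
structure Subcomplex (X : CellComplex) where
  carrier : Set X.Cell
  closed : ∀ τ σ, X.face τ σ → σ ∈ carrier → τ ∈ carrier

section ChainLemmas

theorem pushChain_single {C D : Type*} (dC : C → ℕ) (dD : D → ℕ) (φ : C → D) (c : C) :
    pushChain dC dD φ (Finsupp.single c 1) =
      if dD (φ c) = dC c then Finsupp.single (φ c) (1 : ZMod 2) else 0 := by
  simp [pushChain]

theorem CellData.boundary_single (X : CellData) (c : X.Cell) :
    X.boundary (Finsupp.single c 1) = X.bdry c := by
  simp [CellData.boundary]

theorem pushChain_id {C : Type*} (dC : C → ℕ) :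
    pushChain dC dC (fun c => c) = LinearMap.id := by
  refine Finsupp.lhom_ext' fun c => LinearMap.ext_ring ?_
  simp [pushChain_single]

theorem pushChain_comp {C D E : Type*} (dC : C → ℕ) (dD : D → ℕ) (dE : E → ℕ)
    (φ : C → D) (ψ : D → E) (hφ : ∀ c, dD (φ c) ≤ dC c) (hψ : ∀ c, dE (ψ c) ≤ dD c) :
    pushChain dC dE (fun c => ψ (φ c)) = (pushChain dD dE ψ).comp (pushChain dC dD φ) := by
  refine Finsupp.lhom_ext' fun c => LinearMap.ext_ring ?_
  simp only [LinearMap.comp_apply, Finsupp.lsingle_apply, pushChain_single]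
  have h1 := hφ c
  have h2 := hψ (φ c)
  by_cases h : dD (φ c) = dC c
  · rw [if_pos h, pushChain_single, h]
  · rw [if_neg h, if_neg (by omega), map_zero]

theorem CellMap.push_boundary {X Y : CellComplex} (φ : CellMap X Y) (z : X.Cell →₀ ZMod 2) :
    pushChain X.dim Y.dim φ.toFun (X.boundary z) =
      Y.boundary (pushChain X.dim Y.dim φ.toFun z) := by
  have : (pushChain X.dim Y.dim φ.toFun).comp X.boundary =
      Y.boundary.comp (pushChain X.dim Y.dim φ.toFun) := by
    refine Finsupp.lhom_ext' fun c => LinearMap.ext_ring ?_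
    simpa [CellData.boundary_single] using φ.push_bdry c
  exact LinearMap.congr_fun this z

theorem CellComplex.bdry_eq_zero {X : CellComplex} {σ : X.Cell} (h : X.dim σ = 0) :
    X.bdry σ = 0 := by
  rw [← Finsupp.support_eq_empty, Finset.eq_empty_iff_forall_notMem]
  intro τ hτ
  have := (X.bdry_face σ τ hτ).2
  omega

theorem pushChain_eq_sum {C D : Type*} (dC : C → ℕ) (dD : D → ℕ) (φ : C → D)
    (z : C →₀ ZMod 2) :
    pushChain dC dD φ z =
      z.sum (fun c a => a • if dD (φ c) = dC c then Finsupp.single (φ c) (1 : ZMod 2) else 0) :=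
  rfl

theorem mem_support_pushChain {C D : Type*} {dC : C → ℕ} {dD : D → ℕ} {φ : C → D}
    {z : C →₀ ZMod 2} {y : D} (h : y ∈ (pushChain dC dD φ z).support) :
    ∃ c ∈ z.support, φ c = y ∧ dD (φ c) = dC c := by
  by_contra hne
  push Not at hne
  rw [Finsupp.mem_support_iff] at h
  apply h
  rw [pushChain_eq_sum, Finsupp.sum, Finsupp.finsetSum_apply]
  refine Finset.sum_eq_zero fun c hc => ?_
  have := hne c hc
  by_cases hd : dD (φ c) = dC c
  · have hy : φ c ≠ y := fun e => this e hd
    simp [hd, hy]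
  · simp [hd]

theorem augmentation_pushChain {C D : Type*} {dC : C → ℕ} {dD : D → ℕ} {φ : C → D}
    {z : C →₀ ZMod 2} (h : ∀ c ∈ z.support, dD (φ c) = dC c) :
    augmentation D (pushChain dC dD φ z) = augmentation C z := by
  rw [pushChain_eq_sum, augmentation, augmentation, Finsupp.sum, map_sum,
    Finsupp.linearCombination_apply, Finsupp.sum]
  refine Finset.sum_congr rfl fun c hc => ?_
  simp [h c hc]

end ChainLemmas

/-! ## Subcomplexes and quotients -/

theorem push_subtypeDomain {X : CellComplex} (K : Subcomplex X) (σ : X.Cell)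
    (hσ : σ ∈ K.carrier) :
    pushChain (fun c : K.carrier => X.dim c) X.dim (fun c => (c : X.Cell))
      (Finsupp.subtypeDomain (fun c => c ∈ K.carrier) (X.bdry σ)) = X.bdry σ := by
  have hlin : pushChain (fun c : K.carrier => X.dim c) X.dim (fun c => (c : X.Cell)) =
      Finsupp.lmapDomain (ZMod 2) (ZMod 2) (fun c : K.carrier => (c : X.Cell)) := by
    refine Finsupp.lhom_ext' fun c => LinearMap.ext_ring ?_
    simp [pushChain_single]
  rw [hlin]
  ext τ
  by_cases hτ : τ ∈ K.carrier
  · have := Finsupp.mapDomain_apply (f := fun c : K.carrier => (c : X.Cell))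
      Subtype.val_injective
      (Finsupp.subtypeDomain (fun c => c ∈ K.carrier) (X.bdry σ)) ⟨τ, hτ⟩
    simpa using this
  · have h0 : X.bdry σ τ = 0 := by
      by_contra hne
      exact hτ (K.closed _ _ (X.bdry_face σ τ (Finsupp.mem_support_iff.2 hne)).1 hσ)
    rw [h0]
    refine Finsupp.mapDomain_of_notMem_range _ _ ?_
    rintro ⟨c, rfl⟩
    exact hτ c.2

theorem pushChain_val_injective {X : CellComplex} (K : Subcomplex X) :
    Function.Injective
      (pushChain (fun c : K.carrier => X.dim c) X.dim (fun c => (c : X.Cell))) := by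
  have hlin : pushChain (fun c : K.carrier => X.dim c) X.dim (fun c => (c : X.Cell)) =
      Finsupp.lmapDomain (ZMod 2) (ZMod 2) (fun c : K.carrier => (c : X.Cell)) := by
    refine Finsupp.lhom_ext' fun c => LinearMap.ext_ring ?_
    simp [pushChain_single]
  rw [hlin]
  exact Finsupp.mapDomain_injective Subtype.val_injective

/-- The cell data of a subcomplex. -/
noncomputable abbrev CellComplex.subData (X : CellComplex) (K : Subcomplex X) : CellData where
  Cell := K.carrier
  dim c := X.dim c
  face τ σ := X.face τ σ
  bdry σ := Finsupp.subtypeDomain (fun c => c ∈ K.carrier) (X.bdry σ)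

theorem subData_push_boundary {X : CellComplex} (K : Subcomplex X)
    (z : K.carrier →₀ ZMod 2) :
    pushChain (fun c : K.carrier => X.dim c) X.dim (fun c => (c : X.Cell))
      ((X.subData K).boundary z) =
    X.boundary (pushChain (fun c : K.carrier => X.dim c) X.dim (fun c => (c : X.Cell)) z) := by
  have : (pushChain (fun c : K.carrier => X.dim c) X.dim (fun c => (c : X.Cell))).comp
      (X.subData K).boundary = X.boundary.comp
      (pushChain (fun c : K.carrier => X.dim c) X.dim (fun c => (c : X.Cell))) := by
    refine Finsupp.lhom_ext' fun c => LinearMap.ext_ring ?_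
    have h1 : (X.subData K).boundary (Finsupp.single c 1) = _ :=
      CellData.boundary_single (X.subData K) c
    simp only [LinearMap.comp_apply, Finsupp.lsingle_apply, pushChain_single, if_true]
    erw [h1, CellData.boundary_single]
    exact push_subtypeDomain K c c.2
  exact LinearMap.congr_fun this z

/-- A subcomplex, as a cell complex. -/
noncomputable def CellComplex.sub (X : CellComplex) (K : Subcomplex X) : CellComplex where
  toCellData := X.subData K
  finite_cell := by
    have := X.finite_cell
    exact Subtype.finite
  face_trans ρ τ σ h h' := X.face_trans _ _ _ h h'
  exists_vertex σ h := by
    obtain ⟨τ, hτ, h0⟩ := X.exists_vertex σ.1 h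
    exact ⟨⟨τ, K.closed _ _ hτ σ.2⟩, hτ, h0⟩
  bdry_face σ τ hτ := X.bdry_face σ.1 τ.1 (by
    rw [Finsupp.mem_support_iff] at hτ ⊢
    exact hτ)
  aug_bdry σ h := by
    have h1 := X.aug_bdry σ.1 h
    rw [← push_subtypeDomain K σ.1 σ.2, augmentation_pushChain (fun _ _ => rfl)] at h1
    exact h1
  bdry_bdry σ := by
    apply pushChain_val_injective K
    rw [subData_push_boundary, map_zero]
    have h1 := X.bdry_bdry σ.1
    rw [← push_subtypeDomain K σ.1 σ.2] at h1
    exact h1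

/-- The relation that identifies all cells of the subcomplex `A` with each other. -/
def Subcomplex.collapse {X : CellComplex} (A : Subcomplex X) : Setoid X.Cell where
  r c c' := c = c' ∨ (c ∈ A.carrier ∧ c' ∈ A.carrier)
  iseqv :=
    ⟨fun _ => Or.inl rfl, by rintro _ _ (rfl | ⟨h, h'⟩) <;> tauto,
      by rintro _ _ _ (rfl | ⟨h, h'⟩) (rfl | ⟨h'', h'''⟩) <;> tauto⟩

open Classical in
/-- The dimension of a cell of the quotient: all cells of `A` become one vertex. -/
noncomputable def Subcomplex.quotDim {X : CellComplex} (A : Subcomplex X) :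
    Quotient A.collapse → ℕ :=
  Quotient.lift (fun c => if c ∈ A.carrier then 0 else X.dim c) (by
    rintro a b (rfl | ⟨h, h'⟩)
    · rfl
    · simp [h, h'])

open Classical in
/-- The cell data of the quotient `X / A`, in which the (possibly disconnected) subcomplex `A` is
contracted to one vertex: the cells are that vertex (if `A` is nonempty) and the cells outside `A`,
and the boundary of a cell outside `A` is the image of its boundary under the projection.
For empty `A` this is `X` itself. -/
noncomputable abbrev CellComplex.quotData (X : CellComplex) (A : Subcomplex X) : CellData where
  Cell := Quotient A.collapse
  dim := A.quotDim
  face y x := ∃ τ σ, σ ∉ A.carrier ∧ X.face τ σ ∧ Quotient.mk A.collapse τ = y ∧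
    Quotient.mk A.collapse σ = x
  bdry := Quotient.lift
    (fun σ => if σ ∈ A.carrier then 0 else
      pushChain X.dim A.quotDim (Quotient.mk A.collapse) (X.bdry σ))
    (by
      rintro a b (rfl | ⟨h, h'⟩)
      · rfl
      · simp [h, h'])

section QuotLemmas

variable {X : CellComplex} (A : Subcomplex X)

theorem Subcomplex.quotDim_of_mem {σ : X.Cell} (h : σ ∈ A.carrier) :
    A.quotDim (Quotient.mk A.collapse σ) = 0 := if_pos h

theorem Subcomplex.quotDim_of_notMem {σ : X.Cell} (h : σ ∉ A.carrier) :
    A.quotDim (Quotient.mk A.collapse σ) = X.dim σ := if_neg h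

theorem Subcomplex.quotDim_le (σ : X.Cell) :
    A.quotDim (Quotient.mk A.collapse σ) ≤ X.dim σ := by
  by_cases h : σ ∈ A.carrier
  · simp [A.quotDim_of_mem h]
  · exact (A.quotDim_of_notMem h).le

theorem CellComplex.quotData_bdry_of_mem {σ : X.Cell} (h : σ ∈ A.carrier) :
    (X.quotData A).bdry (Quotient.mk A.collapse σ) = 0 := if_pos h

theorem CellComplex.quotData_bdry_of_notMem {σ : X.Cell} (h : σ ∉ A.carrier) :
    (X.quotData A).bdry (Quotient.mk A.collapse σ) =
      pushChain X.dim A.quotDim (Quotient.mk A.collapse) (X.bdry σ) := if_neg h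

theorem Subcomplex.mk_eq_of_notMem {σ τ : X.Cell} (h : σ ∉ A.carrier)
    (e : Quotient.mk A.collapse τ = Quotient.mk A.collapse σ) : τ = σ := by
  rcases Quotient.exact e with h' | h'
  · exact h'
  · exact absurd h'.2 h

/-- The projection commutes with the boundary on cells. -/
theorem quot_push_bdry (σ : X.Cell) :
    pushChain X.dim A.quotDim (Quotient.mk A.collapse) (X.bdry σ) =
      (X.quotData A).boundary
        (pushChain X.dim A.quotDim (Quotient.mk A.collapse) (Finsupp.single σ 1)) := by
  rw [pushChain_single]
  by_cases h : σ ∈ A.carrier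
  · have hR : (X.quotData A).boundary
        (if A.quotDim (Quotient.mk A.collapse σ) = X.dim σ then
          Finsupp.single (Quotient.mk A.collapse σ) (1 : ZMod 2) else 0) = 0 := by
      split_ifs
      · exact (CellData.boundary_single (X.quotData A) (Quotient.mk A.collapse σ)).trans
          (CellComplex.quotData_bdry_of_mem A h)
      · exact map_zero _
    rw [hR]
    have hmem : ∀ τ ∈ (X.bdry σ).support, τ ∈ A.carrier := fun τ hτ =>
      A.closed _ _ (X.bdry_face σ τ hτ).1 h
    by_cases h1 : X.dim σ = 1
    · -- all vertices of the edge go to the same vertex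
      have haug := X.aug_bdry σ h1
      rw [augmentation, Finsupp.linearCombination_apply, Finsupp.sum] at haug
      rw [pushChain_eq_sum, Finsupp.sum]
      have : ∀ τ ∈ (X.bdry σ).support,
          ((X.bdry σ) τ • if A.quotDim (Quotient.mk A.collapse τ) = X.dim τ then
            Finsupp.single (Quotient.mk A.collapse τ) (1 : ZMod 2) else 0) =
          (X.bdry σ τ • (1 : ZMod 2)) • Finsupp.single (Quotient.mk A.collapse σ) (1 : ZMod 2) := by
        intro τ hτ
        have hd := (X.bdry_face σ τ hτ).2
        have e : Quotient.mk A.collapse τ = Quotient.mk A.collapse σ :=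
          Quotient.sound (Or.inr ⟨hmem τ hτ, h⟩)
        rw [A.quotDim_of_mem (hmem τ hτ), if_pos (by omega), e]
        simp
      rw [Finset.sum_congr rfl this, ← Finset.sum_smul, haug, zero_smul]
    · rw [pushChain_eq_sum, Finsupp.sum]
      refine Finset.sum_eq_zero fun τ hτ => ?_
      have hd := (X.bdry_face σ τ hτ).2
      rw [A.quotDim_of_mem (hmem τ hτ), if_neg (by omega), smul_zero]
  · rw [if_pos (A.quotDim_of_notMem h)]
    exact ((CellData.boundary_single (X.quotData A) (Quotient.mk A.collapse σ)).trans
      (CellComplex.quotData_bdry_of_notMem A h)).symm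

theorem quot_push_boundary (z : X.Cell →₀ ZMod 2) :
    pushChain X.dim A.quotDim (Quotient.mk A.collapse) (X.boundary z) =
      (X.quotData A).boundary (pushChain X.dim A.quotDim (Quotient.mk A.collapse) z) := by
  have : (pushChain X.dim A.quotDim (Quotient.mk A.collapse)).comp X.boundary =
      (X.quotData A).boundary.comp (pushChain X.dim A.quotDim (Quotient.mk A.collapse)) := by
    refine Finsupp.lhom_ext' fun c => LinearMap.ext_ring ?_
    have := quot_push_bdry A c
    simpa [CellData.boundary_single] using this
  exact LinearMap.congr_fun this z

end QuotLemmas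

/-- The quotient `X / A` of a cell complex by a subcomplex, as a cell complex. -/
noncomputable def CellComplex.quot (X : CellComplex) (A : Subcomplex X) : CellComplex where
  toCellData := X.quotData A
  finite_cell := by
    have := X.finite_cell
    exact Quotient.finite _
  face_trans := by
    rintro _ _ _ ⟨ρ, τ, hτ, h1, rfl, rfl⟩ ⟨τ', σ, hσ, h2, e, rfl⟩
    obtain rfl := A.mk_eq_of_notMem hτ e
    exact ⟨ρ, σ, hσ, X.face_trans _ _ _ h1 h2, rfl, rfl⟩
  exists_vertex := by
    intro x
    refine Quotient.inductionOn x fun σ hσ => ?_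
    have hA : σ ∉ A.carrier := fun h => hσ (A.quotDim_of_mem h)
    obtain ⟨τ, hτ, h0⟩ := X.exists_vertex σ
      (fun h => hσ ((A.quotDim_of_notMem hA).trans h))
    refine ⟨Quotient.mk A.collapse τ, ⟨τ, σ, hA, hτ, rfl, rfl⟩, ?_⟩
    have := A.quotDim_le τ
    exact Nat.le_zero.1 (this.trans h0.le)
  bdry_face := by
    intro x
    refine Quotient.inductionOn x fun σ y hy => ?_
    by_cases hA : σ ∈ A.carrier
    · exact absurd hy (by
        intro hy
        have h0 := X.quotData_bdry_of_mem A hA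
        erw [h0] at hy
        simp at hy)
    · have h0 := X.quotData_bdry_of_notMem A hA
      erw [h0] at hy
      obtain ⟨τ, hτ, rfl, hd⟩ := mem_support_pushChain hy
      obtain ⟨hf, hd'⟩ := X.bdry_face σ τ hτ
      refine ⟨⟨τ, σ, hA, hf, rfl, rfl⟩, ?_⟩
      have e := A.quotDim_of_notMem hA
      change A.quotDim (Quotient.mk _ σ) = A.quotDim (Quotient.mk _ τ) + 1
      omega
  aug_bdry := by
    intro x
    refine Quotient.inductionOn x fun σ hσ => ?_
    have hA : σ ∉ A.carrier := fun h => by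
      have : A.quotDim (Quotient.mk _ σ) = 1 := hσ
      rw [A.quotDim_of_mem h] at this
      omega
    have h1 : X.dim σ = 1 := (A.quotDim_of_notMem hA).symm.trans hσ
    have h0 := X.quotData_bdry_of_notMem A hA
    refine (congrArg _ h0).trans ?_
    refine (augmentation_pushChain fun τ hτ => ?_).trans (X.aug_bdry σ h1)
    have := (X.bdry_face σ τ hτ).2
    have := A.quotDim_le τ
    omega
  bdry_bdry := by
    intro x
    refine Quotient.inductionOn x fun σ => ?_
    by_cases hA : σ ∈ A.carrier
    · exact (congrArg _ (X.quotData_bdry_of_mem A hA)).trans (map_zero _)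
    · refine (congrArg _ (X.quotData_bdry_of_notMem A hA)).trans ?_
      rw [← quot_push_boundary, X.bdry_bdry, map_zero]

/-- The inclusion of a subcomplex into a larger one. -/
noncomputable def subInclusion {X : CellComplex} {K L : Subcomplex X}
    (h : K.carrier ⊆ L.carrier) : CellMap (X.sub K) (X.sub L) where
  toFun c := ⟨c.1, h c.2⟩
  dim_le _ := le_rfl
  push_bdry c := by
    apply pushChain_val_injective L
    have hc : ∀ z : K.carrier →₀ ZMod 2,
        pushChain (fun c : L.carrier => X.dim c) X.dim (fun c => (c : X.Cell))
          (pushChain (X.sub K).dim (X.sub L).dim (fun c => ⟨c.1, h c.2⟩) z) =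
        pushChain (fun c : K.carrier => X.dim c) X.dim (fun c => (c : X.Cell)) z := fun z =>
      (LinearMap.congr_fun (pushChain_comp (fun c : K.carrier => X.dim c)
        (fun c : L.carrier => X.dim c) X.dim (fun c => ⟨c.1, h c.2⟩) (fun c => (c : X.Cell))
        (fun _ => le_rfl) (fun _ => le_rfl)) z).symm
    refine (hc _).trans ?_
    refine Eq.trans ?_ (subData_push_boundary L _).symm
    refine Eq.trans ?_ (congrArg X.boundary (hc _)).symm
    refine Eq.trans ?_ (subData_push_boundary K _)
    exact congrArg _ (CellData.boundary_single (X.subData K) c).symm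

/-- The map of quotients `X / A → Y / B` induced by a cellular map that sends `A` into `B`. -/
noncomputable def quotMap {X Y : CellComplex} (φ : CellMap X Y) {A : Subcomplex X}
    {B : Subcomplex Y} (h : ∀ c ∈ A.carrier, φ.toFun c ∈ B.carrier) :
    CellMap (X.quot A) (Y.quot B) where
  toFun := Quotient.map φ.toFun (by
    rintro a b (rfl | ⟨ha, hb⟩)
    · exact Or.inl rfl
    · exact Or.inr ⟨h _ ha, h _ hb⟩)
  dim_le := by
    intro x
    refine Quotient.inductionOn x fun σ => ?_
    change B.quotDim (Quotient.mk _ (φ.toFun σ)) ≤ A.quotDim (Quotient.mk _ σ)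
    by_cases hA : σ ∈ A.carrier
    · rw [B.quotDim_of_mem (h _ hA)]
      exact Nat.zero_le _
    · rw [A.quotDim_of_notMem hA]
      exact (B.quotDim_le _).trans (φ.dim_le _)
  push_bdry := by
    intro x
    refine Quotient.inductionOn x fun σ => ?_
    set ψ : Quotient A.collapse → Quotient B.collapse := Quotient.map φ.toFun (by
      rintro a b (rfl | ⟨ha, hb⟩)
      · exact Or.inl rfl
      · exact Or.inr ⟨h _ ha, h _ hb⟩) with hψ
    have hle : ∀ y, B.quotDim (ψ y) ≤ A.quotDim y := by
      intro y
      refine Quotient.inductionOn y fun σ => ?_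
      change B.quotDim (Quotient.mk _ (φ.toFun σ)) ≤ A.quotDim (Quotient.mk _ σ)
      by_cases hA : σ ∈ A.carrier
      · rw [B.quotDim_of_mem (h _ hA)]
        exact Nat.zero_le _
      · rw [A.quotDim_of_notMem hA]
        exact (B.quotDim_le _).trans (φ.dim_le _)
    have hsq : ∀ z, pushChain A.quotDim B.quotDim ψ
          (pushChain X.dim A.quotDim (Quotient.mk A.collapse) z) =
        pushChain Y.dim B.quotDim (Quotient.mk B.collapse)
          (pushChain X.dim Y.dim φ.toFun z) := fun z =>
      (LinearMap.congr_fun (pushChain_comp X.dim A.quotDim B.quotDim (Quotient.mk A.collapse) ψ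
        A.quotDim_le hle) z).symm.trans
      (LinearMap.congr_fun (pushChain_comp X.dim Y.dim B.quotDim φ.toFun (Quotient.mk B.collapse)
        φ.dim_le B.quotDim_le) z)
    change pushChain A.quotDim B.quotDim ψ ((X.quotData A).bdry (Quotient.mk _ σ)) =
      (Y.quotData B).boundary
        (pushChain A.quotDim B.quotDim ψ (Finsupp.single (Quotient.mk _ σ) 1))
    by_cases hA : σ ∈ A.carrier
    · have hB := h _ hA
      rw [X.quotData_bdry_of_mem A hA, map_zero, pushChain_single]
      split_ifs
      · refine (Eq.trans (CellData.boundary_single (Y.quotData B) _) ?_).symm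
        exact Y.quotData_bdry_of_mem B hB
      · exact (map_zero _).symm
    · have e : (Finsupp.single (Quotient.mk A.collapse σ) (1 : ZMod 2)) =
          pushChain X.dim A.quotDim (Quotient.mk A.collapse) (Finsupp.single σ 1) := by
        rw [pushChain_single, if_pos (A.quotDim_of_notMem hA)]
      rw [X.quotData_bdry_of_notMem A hA, e, hsq, hsq, ← quot_push_boundary]
      congr 1
      exact φ.push_bdry σ

/-! ## Homology -/

/-- The `k`-chains. -/
noncomputable def CellComplex.chains (X : CellComplex) (k : ℕ) :
    Submodule (ZMod 2) (X.Cell →₀ ZMod 2) :=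
  Finsupp.supported (ZMod 2) (ZMod 2) {c | X.dim c = k}

/-- The `k`-cycles. -/
noncomputable def CellComplex.cycles (X : CellComplex) (k : ℕ) :
    Submodule (ZMod 2) (X.Cell →₀ ZMod 2) :=
  X.chains k ⊓ LinearMap.ker X.boundary

/-- The `k`-boundaries. -/
noncomputable def CellComplex.boundaries (X : CellComplex) (k : ℕ) :
    Submodule (ZMod 2) (X.Cell →₀ ZMod 2) :=
  (X.chains (k + 1)).map X.boundary

/-- Homology with coefficients in `ℤ/2`. -/
abbrev CellComplex.homology (X : CellComplex) (k : ℕ) :=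
  X.cycles k ⧸ (X.boundaries k).submoduleOf (X.cycles k)

theorem CellMap.push_mem_chains {X Y : CellComplex} (φ : CellMap X Y) {k : ℕ}
    {z : X.Cell →₀ ZMod 2} (h : z ∈ X.chains k) :
    pushChain X.dim Y.dim φ.toFun z ∈ Y.chains k := by
  intro y hy
  obtain ⟨c, hc, rfl, hd⟩ := mem_support_pushChain hy
  exact hd.trans (h hc)

theorem CellMap.push_mem_cycles {X Y : CellComplex} (φ : CellMap X Y) (k : ℕ) :
    ∀ z ∈ X.cycles k, pushChain X.dim Y.dim φ.toFun z ∈ Y.cycles k := by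
  intro z hz
  refine ⟨φ.push_mem_chains hz.1, ?_⟩
  have : X.boundary z = 0 := hz.2
  change Y.boundary _ = 0
  rw [← φ.push_boundary, this, map_zero]

/-- The linear map induced by a cellular map on homology. -/
noncomputable def CellMap.homologyMap {X Y : CellComplex} (φ : CellMap X Y) (k : ℕ) :
    X.homology k →ₗ[ZMod 2] Y.homology k :=
  Submodule.mapQ _ _ ((pushChain X.dim Y.dim φ.toFun).restrict (φ.push_mem_cycles k)) (by
    rintro ⟨z, hz⟩ ⟨w, hw, e⟩
    exact ⟨pushChain X.dim Y.dim φ.toFun w, φ.push_mem_chains hw, by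
      rw [← φ.push_boundary, e]
      rfl⟩)

theorem homologyMap_eq_id {X : CellComplex} (φ : CellMap X X) (h : ∀ c, φ.toFun c = c) (k : ℕ) :
    φ.homologyMap k = LinearMap.id := by
  refine Submodule.linearMap_qext _ (LinearMap.ext fun z => ?_)
  simp only [CellMap.homologyMap, LinearMap.comp_apply, Submodule.mkQ_apply, Submodule.mapQ_apply,
    LinearMap.id_apply]
  congr 1
  apply Subtype.ext
  have e : φ.toFun = fun c => c := funext h
  rw [LinearMap.coe_restrict_apply, e, pushChain_id]
  rfl

theorem homologyMap_eq_comp {X Y Z : CellComplex} (φ : CellMap X Y) (ψ : CellMap Y Z)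
    (χ : CellMap X Z) (h : ∀ c, χ.toFun c = ψ.toFun (φ.toFun c)) (k : ℕ) :
    χ.homologyMap k = (ψ.homologyMap k).comp (φ.homologyMap k) := by
  refine Submodule.linearMap_qext _ (LinearMap.ext fun z => ?_)
  simp only [CellMap.homologyMap, LinearMap.comp_apply, Submodule.mkQ_apply, Submodule.mapQ_apply]
  congr 1
  apply Subtype.ext
  have e : χ.toFun = fun c => ψ.toFun (φ.toFun c) := funext h
  rw [LinearMap.coe_restrict_apply, e,
    pushChain_comp X.dim Y.dim Z.dim φ.toFun ψ.toFun φ.dim_le ψ.dim_le]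
  rfl

/-! ## Persistence modules and persistence diagrams -/

/-- A persistence module over `ℤ/2`: a sequence of vector spaces `V 0 → V 1 → V 2 → ⋯`, given
together with the composites of its maps. A finite sequence is continued by isomorphisms. -/
structure PersistenceModule where
  V : ℕ → Type*
  [addCommGroup : ∀ t, AddCommGroup (V t)]
  [module : ∀ t, Module (ZMod 2) (V t)]
  map : ∀ {s t : ℕ}, s ≤ t → (V s →ₗ[ZMod 2] V t)
  map_refl : ∀ t, map (le_refl t) = LinearMap.id
  map_trans : ∀ {r s t : ℕ} (h : r ≤ s) (h' : s ≤ t), map (h.trans h') = (map h').comp (map h)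

attribute [instance] PersistenceModule.addCommGroup PersistenceModule.module

namespace PersistenceModule

/-- A class at time `t` is born at `t` if it is not in the image of the preceding map. -/
def BornAt (M : PersistenceModule) (t : ℕ) (z : M.V t) : Prop :=
  ∀ s (h : s ≤ t), s + 1 = t → z ∉ LinearMap.range (M.map h)

/-- A class at time `t` dies at `d` if `d ≥ t` is the first time at which its image is zero. -/
def DiesAt (M : PersistenceModule) (t : ℕ) (z : M.V t) (d : ℕ) : Prop :=
  ∃ h : t ≤ d, M.map h z = 0 ∧ ∀ s (h' : t ≤ s), s < d → M.map h' z ≠ 0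

/-- `D` is the multiset of (birth, death) pairs of an interval decomposition of `M`: there are
finitely many classes `e i`, born at `b i`, whose images become zero at `d i > b i`
(never, if `d i = ∞`), such that at each time `t` the images of the classes with `b i ≤ t < d i`
form a basis of `M.V t`. -/
def IsDiagram (M : PersistenceModule) (D : Multiset (ℕ × ℕ∞)) : Prop :=
  ∃ (m : ℕ) (b : Fin m → ℕ) (d : Fin m → ℕ∞) (e : ∀ i, M.V (b i)),
    (∀ i, (b i : ℕ∞) < d i) ∧
    (∀ i t (h : b i ≤ t), d i ≤ (t : ℕ∞) → M.map h (e i) = 0) ∧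
    (∀ t, LinearIndependent (ZMod 2)
        (fun i : {i : Fin m // b i ≤ t ∧ (t : ℕ∞) < d i} => M.map i.2.1 (e i.1)) ∧
      Submodule.span (ZMod 2) (Set.range
        (fun i : {i : Fin m // b i ≤ t ∧ (t : ℕ∞) < d i} => M.map i.2.1 (e i.1))) = ⊤) ∧
    D = (Finset.univ : Finset (Fin m)).val.map (fun i => (b i, d i))

/-- The persistence diagram of a persistence module (meaningful when there is exactly one `D` with
`M.IsDiagram D`). -/
noncomputable def diagram (M : PersistenceModule) : Multiset (ℕ × ℕ∞) :=
  Classical.epsilon M.IsDiagram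

end PersistenceModule

/-! ## Filtrations -/

/-- A filtration function: a real function on the cells that is at most `f σ` on the faces
of `σ`. -/
structure Filtration (X : CellComplex) where
  val : X.Cell → ℝ
  mono : ∀ τ σ, X.face τ σ → val τ ≤ val σ

namespace Filtration

variable {X : CellComplex}

/-- The number of steps of the filtration, that is, of distinct values of `f`. -/
noncomputable def steps (f : Filtration X) : ℕ := (Set.range f.val).ncard

/-- The step at which a cell enters: if `a₁ < ⋯ < aₙ` are the values of `f`, it is the `i` with
`f c = aᵢ`. -/
noncomputable def step (f : Filtration X) (c : X.Cell) : ℕ :=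
  {a ∈ Set.range f.val | a ≤ f.val c}.ncard

theorem step_mono (f : Filtration X) {τ σ : X.Cell} (h : X.face τ σ) : f.step τ ≤ f.step σ := by
  have := X.finite_cell
  refine Set.ncard_le_ncard (fun a ha => ⟨ha.1, ha.2.trans (f.mono _ _ h)⟩) ?_
  exact (Set.finite_range f.val).subset (fun a ha => ha.1)

/-- The subcomplex `X_t` of the cells that enter at step `t` or before; `X_0 = ∅`, and `X_t = X`
for `t ≥ n`. -/
def level (f : Filtration X) (t : ℕ) : Subcomplex X where
  carrier := {c | f.step c ≤ t}
  closed _ _ h hσ := (f.step_mono h).trans hσ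

/-- The intermediate complex `IC_t`: the closure of `X_t \ X_{t-1}`, for `t ≥ 1`. -/
def IC (f : Filtration X) (t : ℕ) : Set X.Cell :=
  {τ | ∃ σ, f.step σ = t ∧ (τ = σ ∨ X.face τ σ)}

/-- The subcomplex `IC_1 ∪ ⋯ ∪ IC_i` that is contracted to a point after the first `i`
contraction steps. -/
def contracted (f : Filtration X) (i : ℕ) : Subcomplex X where
  carrier := {c | ∃ j, 1 ≤ j ∧ j ≤ i ∧ c ∈ f.IC j}
  closed := by
    rintro τ σ h ⟨j, h1, hj, ρ, hρ, rfl | h'⟩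
    · exact ⟨j, h1, hj, σ, hρ, Or.inr h⟩
    · exact ⟨j, h1, hj, ρ, hρ, Or.inr (X.face_trans _ _ _ h h')⟩

/-- The persistence module `H_k(X_0) → H_k(X_1) → ⋯ → H_k(X_n)` of the forward persistent
homology of `f`. -/
noncomputable def forward (f : Filtration X) (k : ℕ) : PersistenceModule where
  V t := (X.sub (f.level t)).homology k
  map {s t} h := (subInclusion (K := f.level s) (L := f.level t)
    (fun _ hc => le_trans hc h)).homologyMap k
  map_refl _ := homologyMap_eq_id _ (fun _ => rfl) k
  map_trans _ _ := homologyMap_eq_comp _ _ _ (fun _ => rfl) k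

/-- The part of the level `X_t` of `f` that is contracted at time `t` in `(f,g)`-FB persistence;
it is empty for `t ≤ n`, where `n` is the number of steps of `f`. -/
noncomputable def fbContracted (f g : Filtration X) (t : ℕ) :
    Subcomplex (X.sub (f.level t)) where
  carrier := {c | c.1 ∈ (g.contracted (t - f.steps)).carrier}
  closed τ σ h hσ := (g.contracted (t - f.steps)).closed τ.1 σ.1 h hσ

/-- The complex at time `t` in `(f,g)`-FB persistence. With `n` the number of steps of `f`, it is
the level `X_t` of `f` for `t ≤ n`, and it is `X / (IC_1 ∪ ⋯ ∪ IC_i)` for `t = n + i`,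
where the `IC_j` are those of `g`. -/
noncomputable def fbStage (f g : Filtration X) (t : ℕ) : CellComplex :=
  (X.sub (f.level t)).quot (fbContracted f g t)

/-- The maps between the complexes of `(f,g)`-FB persistence: inclusions followed by
contractions. -/
noncomputable def fbMap (f g : Filtration X) {s t : ℕ} (h : s ≤ t) :
    CellMap (fbStage f g s) (fbStage f g t) :=
  quotMap (subInclusion (K := f.level s) (L := f.level t) (fun _ hc => le_trans hc h))
    (by
      rintro c ⟨j, h1, hj, hc⟩
      exact ⟨j, h1, hj.trans (Nat.sub_le_sub_right h _), hc⟩)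

/-- The persistence module of `k`-th `(f,g)`-FB persistence. -/
noncomputable def fb (f g : Filtration X) (k : ℕ) : PersistenceModule where
  V t := (fbStage f g t).homology k
  map {_ _} h := (fbMap f g h).homologyMap k
  map_refl _ := homologyMap_eq_id _ (fun c => by
    refine Quotient.inductionOn c fun _ => rfl) k
  map_trans _ _ := homologyMap_eq_comp _ _ _ (fun c => by
    refine Quotient.inductionOn c fun _ => rfl) k

end Filtration

/-! ## Graphs and vertex representatives -/

namespace Graph

variable {α : Type u} {β : Type v}

/-- The cell data of a multigraph (loops and parallel edges allowed): vertices and edges are the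
cells of dimension 0 and 1, and the boundary of an edge is the sum of its two ends. -/
noncomputable abbrev cellData (G : Graph α β) : CellData where
  Cell := G.vertexSet ⊕ G.edgeSet
  dim := Sum.elim (fun _ => 0) (fun _ => 1)
  face τ σ := ∃ (x : G.vertexSet) (e : G.edgeSet), G.Inc e x ∧ τ = Sum.inl x ∧ σ = Sum.inr e
  bdry := Sum.elim (fun _ => 0) (fun e =>
    let h := G.exists_isLink_of_mem_edgeSet e.2
    Finsupp.single (Sum.inl ⟨h.choose, h.choose_spec.choose_spec.left_mem⟩) 1 +
      Finsupp.single (Sum.inl ⟨h.choose_spec.choose, h.choose_spec.choose_spec.right_mem⟩) 1)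

/-- A finite multigraph, as a cell complex. -/
noncomputable abbrev toCellComplex (G : Graph α β) [Finite G.vertexSet] [Finite G.edgeSet] :
    CellComplex where
  toCellData := G.cellData
  finite_cell := inferInstanceAs (Finite (G.vertexSet ⊕ G.edgeSet))
  face_trans := by
    rintro _ _ _ ⟨x, e, h, rfl, rfl⟩ ⟨x', e', h', h1, rfl⟩
    cases h1
  exists_vertex := by
    rintro (x | e) h
    · exact absurd rfl h
    · obtain ⟨x, y, hxy⟩ := G.exists_isLink_of_mem_edgeSet e.2
      exact ⟨Sum.inl ⟨x, hxy.left_mem⟩, ⟨_, e, hxy.inc_left, rfl, rfl⟩, rfl⟩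
  bdry_face := by
    rintro (x | e) τ hτ
    · exact absurd hτ (by simp [cellData])
    · have hs := G.exists_isLink_of_mem_edgeSet e.2
      classical
      have hτ' := Finsupp.support_add hτ
      rcases Finset.mem_union.1 hτ' with h | h
      · obtain rfl := Finset.mem_singleton.1 (Finsupp.support_single_subset h)
        exact ⟨⟨_, e, hs.choose_spec.choose_spec.inc_left, rfl, rfl⟩, rfl⟩
      · obtain rfl := Finset.mem_singleton.1 (Finsupp.support_single_subset h)
        exact ⟨⟨_, e, hs.choose_spec.choose_spec.inc_right, rfl, rfl⟩, rfl⟩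
  aug_bdry := by
    rintro (x | e) h
    · cases h
    · simp only [cellData, Sum.elim_inr, map_add, augmentation, Finsupp.linearCombination_single]
      decide
  bdry_bdry := by
    rintro (x | e)
    · simp [cellData, CellData.boundary]
    · simp [cellData, CellData.boundary]

variable (G : Graph α β) [Finite G.vertexSet] [Finite G.edgeSet]

/-- The state of the bookkeeping with one vertex representative per component: the current
representative of the component of each vertex, and the death time of each vertex
(`⊤` as long as it is alive). -/
structure RepState where
  rep : G.vertexSet → G.vertexSet
  death : G.vertexSet → ℕ∞

variable {G}

/-- The step at which a vertex is born. -/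
noncomputable def birth (f : Filtration G.toCellComplex) (x : G.vertexSet) : ℕ :=
  f.step (Sum.inl x)

/-- The step at which an edge is spawned. -/
noncomputable def spawnTime (f : Filtration G.toCellComplex) (e : G.edgeSet) : ℕ :=
  f.step (Sum.inr e)

open Classical in
/-- The representative `a` dies at time `t`, and `b` becomes the representative of its
component. -/
noncomputable def RepState.kill (s : RepState G) (a b : G.vertexSet) (t : ℕ) : RepState G where
  rep x := if s.rep x = a then b else s.rep x
  death x := if x = a then (t : ℕ∞) else s.death x

/-- The bookkeeping when the edge `e` is spawned. If its ends have the same representative, nothing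
happens. Otherwise the representative that was born later dies; in case of a tie any of the two may
die, but never the supernode `star`. -/
inductive SpawnEdge (f : Filtration G.toCellComplex) (star : G.vertexSet) (e : G.edgeSet) :
    RepState G → RepState G → Prop
  | cycle (s : RepState G) (u w : G.vertexSet) (he : G.IsLink e u w) (h : s.rep u = s.rep w) :
      SpawnEdge f star e s s
  | merge (s : RepState G) (u w : G.vertexSet) (he : G.IsLink e u w) (h : s.rep u ≠ s.rep w)
      (hbirth : birth f (s.rep w) ≤ birth f (s.rep u)) (hstar : s.rep u ≠ star) :
      SpawnEdge f star e s (s.kill (s.rep u) (s.rep w) (spawnTime f e))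

/-- The bookkeeping when a list of edges is spawned one after another. -/
inductive SpawnEdges (f : Filtration G.toCellComplex) (star : G.vertexSet) :
    List G.edgeSet → RepState G → RepState G → Prop
  | nil (s : RepState G) : SpawnEdges f star [] s s
  | cons (e : G.edgeSet) (l : List G.edgeSet) (s s' s'' : RepState G)
      (h : SpawnEdge f star e s s') (h' : SpawnEdges f star l s' s'') :
      SpawnEdges f star (e :: l) s s''

/-- `s` is a possible result of the bookkeeping during the filtration steps: every vertex starts
as its own representative, and all edges are spawned one after another in an order that is
compatible with `f`. -/
def FiltrationRun (f : Filtration G.toCellComplex) (star : G.vertexSet) (s : RepState G) : Prop :=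
  ∃ l : List G.edgeSet, l.Nodup ∧ (∀ e, e ∈ l) ∧
    l.Pairwise (fun e e' => spawnTime f e ≤ spawnTime f e') ∧
    SpawnEdges f star l ⟨id, fun _ => ⊤⟩ s

open Classical in
/-- The bookkeeping in the contraction step that contracts `IC_i` into the point, at time `n + i`:
the representatives of the components that meet `IC_i`, except for the supernode, die and are
replaced by the supernode. -/
noncomputable def contractStep (f : Filtration G.toCellComplex) (star : G.vertexSet) (i : ℕ)
    (s : RepState G) : RepState G where
  rep x := if ∃ y : G.vertexSet, Sum.inl y ∈ f.IC i ∧ s.rep y = s.rep x then star else s.rep x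
  death v :=
    if s.death v = ⊤ ∧ v ≠ star ∧ ∃ y : G.vertexSet, Sum.inl y ∈ f.IC i ∧ s.rep y = v then
      ((f.steps + i : ℕ) : ℕ∞) else s.death v

/-- The bookkeeping during the first `i` contraction steps. -/
noncomputable def contractSteps (f : Filtration G.toCellComplex) (star : G.vertexSet)
    (s : RepState G) : ℕ → RepState G
  | 0 => s
  | i + 1 => contractStep f star (i + 1) (contractSteps f star s i)

open Classical in
/-- The pairs (birth, death) of the vertices, without the trivial ones. -/
noncomputable def RepState.pairs (f : Filtration G.toCellComplex) (s : RepState G) :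
    Multiset (ℕ × ℕ∞) :=
  haveI := Fintype.ofFinite G.vertexSet
  ((Finset.univ : Finset G.vertexSet).filter (fun x => (birth f x : ℕ∞) < s.death x)).val.map
    (fun x => (birth f x, s.death x))

end Graph

/-- The pairs of a diagram with a finite death time. -/
noncomputable def finitePairs (D : Multiset (ℕ × ℕ∞)) : Multiset (ℕ × ℕ∞) :=
  open Classical in D.filter (fun p => p.2 ≠ ⊤)

/-! ### Diagrams: ranks, uniqueness, lifetimes of classes -/

namespace PersistenceModule

variable {M : PersistenceModule.{u}}

/-! Matrix reduction (`exists_isReducedBasis`) gives a basis of the mod 2 chains of `X`, indexed by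
the cells: `a σ` has the dimension of `σ`, involves only cells that enter no later than `σ`, and has
boundary `0` or `a (p σ)`, where `p` is a partial injection. So the filtered chain complex splits
into pieces with one or two generators, and the forward diagram can be read off: an unpaired `σ`
contributes `(step σ, ∞)`, and a pair `τ = p σ` contributes `(step τ, step σ)` in the dimension of
`τ`.

The point is that the same basis also serves the contraction. The union `IC_1 ∪ ... ∪ IC_i` is just
`X_i` (`contracted_carrier`), so the second half of FB persistence consists of the quotients `X /
X_i`. In positive dimensions, contracting `X_i` kills exactly the `a σ` with step at most `i`. In
dimension zero a chain in `X_i` becomes its augmentation times the new vertex. One therefore fixes a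
root `r` born at step 1 with `a r` odd and makes all other 0-dimensional basis chains even
(`exists_root`). Then, with `n` the number of steps, `a σ` is nonzero exactly from time `step σ`
until time `n + step σ`, while `a r` lives forever.

The general computation `isDiagram_of_basis` now yields the FB diagram: `(1, ∞)` from the root, `(e,
n + e)` for every other forward class `(e, ∞)`, each finite forward interval `(i, j)` unchanged, and
once more as `(n + i, n + j)` one dimension higher, because `a σ` becomes a cycle when `a (p σ)` is
contracted and remains one until it is contracted itself. `exists_isBarcode` records this.

Part (a) is then a statement about multisets. For given `n` the intervals of the three types are
separated by the position of their ends relative to `n`. Two FB barcodes with different numbers of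
steps agree only if they have no finite intervals: by induction on the dimension, a finite forward
interval of one barcode would force others with ever larger birth (`fbBars_eq_zero_of_lt`).

For graphs there are no 2-cells, so no 1-dimensional class dies in the filtration, and item 1 and
item 2 follow. The bookkeeping with vertex representatives is the same matrix reduction with
particular pivots (`IsRunBasis.insert`), so its pairs form the forward diagram. The contraction
steps change the death of each surviving representative other than the supernode from `∞` to `n`
plus its birth (`contractSteps_death`), which is exactly how the FB diagram in dimension zero
differs from the forward one. -/

theorem map_map (M : PersistenceModule) {r s t : ℕ} (h : r ≤ s) (h' : s ≤ t) (z : M.V r) :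
    M.map h' (M.map h z) = M.map (h.trans h') z := by
  rw [M.map_trans h h', LinearMap.comp_apply]

/-- A diagram may be indexed by any finite type. -/
theorem isDiagram_of_fintype {J : Type*} [Fintype J] (b : J → ℕ) (d : J → ℕ∞)
    (e : ∀ j, M.V (b j)) (hbd : ∀ j, (b j : ℕ∞) < d j)
    (h0 : ∀ j t (h : b j ≤ t), d j ≤ (t : ℕ∞) → M.map h (e j) = 0)
    (hli : ∀ t, LinearIndependent (ZMod 2)
      (fun i : {i : J // b i ≤ t ∧ (t : ℕ∞) < d i} => M.map i.2.1 (e i.1)))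
    (hsp : ∀ t, Submodule.span (ZMod 2) (Set.range
      (fun i : {i : J // b i ≤ t ∧ (t : ℕ∞) < d i} => M.map i.2.1 (e i.1))) = ⊤) :
    M.IsDiagram ((Finset.univ : Finset J).val.map (fun j => (b j, d j))) := by
  let σ := (Fintype.equivFin J).symm
  refine ⟨Fintype.card J, fun i => b (σ i), fun i => d (σ i), fun i => e (σ i),
    fun i => hbd _, fun i t h hd => h0 _ t h hd, fun t => ?_, ?_⟩
  · let τ : {i : Fin (Fintype.card J) // b (σ i) ≤ t ∧ (t : ℕ∞) < d (σ i)} ≃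
        {i : J // b i ≤ t ∧ (t : ℕ∞) < d i} := σ.subtypeEquiv (fun i => Iff.rfl)
    refine ⟨(hli t).comp τ τ.injective, ?_⟩
    rw [← hsp t]
    congr 1
    exact τ.surjective.range_comp
      (fun i : {i : J // b i ≤ t ∧ (t : ℕ∞) < d i} => M.map i.2.1 (e i.1))
  · rw [← Finset.map_univ_equiv σ, Finset.map_val, Multiset.map_map]
    rfl

theorem IsDiagram.lt {D : Multiset (ℕ × ℕ∞)} (hD : M.IsDiagram D) :
    ∀ p ∈ D, (p.1 : ℕ∞) < p.2 := by
  obtain ⟨m, b, d, e, hbd, -, -, rfl⟩ := hD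
  intro p hp
  obtain ⟨i, -, rfl⟩ := Multiset.mem_map.1 hp
  exact hbd i

/-- The generators alive at `s` span the source; at `t` each has become zero or is a member of the
basis there. So the rank counts the intervals that contain both `s` and `t`, and such counts
determine the diagram. -/
theorem IsDiagram.finrank_range {D : Multiset (ℕ × ℕ∞)} (hD : M.IsDiagram D) {s t : ℕ}
    (h : s ≤ t) : Module.finrank (ZMod 2) (LinearMap.range (M.map h)) =
      D.countP (fun p => p.1 ≤ s ∧ (t : ℕ∞) < p.2) := by
  classical
  obtain ⟨m, b, d, e, hbd, h0, hb, rfl⟩ := hD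
  let w : {i : Fin m // b i ≤ s ∧ (t : ℕ∞) < d i} → M.V t :=
    fun i => M.map (i.2.1.trans h) (e i.1)
  have hw : LinearIndependent (ZMod 2) w := by
    refine (hb t).1.comp (fun i : {i : Fin m // b i ≤ s ∧ (t : ℕ∞) < d i} =>
      ⟨i.1, i.2.1.trans h, i.2.2⟩) ?_
    intro i j hij
    exact Subtype.ext (congrArg (fun k => k.1) hij)
  have hr : LinearMap.range (M.map h) = Submodule.span (ZMod 2) (Set.range w) := by
    rw [LinearMap.range_eq_map, ← (hb s).2, Submodule.map_span]
    apply le_antisymm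
    · rw [Submodule.span_le]
      rintro _ ⟨_, ⟨i, rfl⟩, rfl⟩
      by_cases hi : (t : ℕ∞) < d i.1
      · exact Submodule.subset_span ⟨⟨i.1, i.2.1, hi⟩, (M.map_map _ _ _).symm⟩
      · have := h0 i.1 t (i.2.1.trans h) (not_lt.1 hi)
        simp only [SetLike.mem_coe, M.map_map, this, Submodule.zero_mem]
    · refine Submodule.span_mono ?_
      rintro _ ⟨i, rfl⟩
      have hs : (s : ℕ∞) ≤ t := by exact_mod_cast h
      exact ⟨_, ⟨⟨i.1, i.2.1, hs.trans_lt i.2.2⟩, rfl⟩, M.map_map _ _ _⟩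
  rw [hr, finrank_span_eq_card hw, Multiset.countP_map, Fintype.card_subtype]
  rfl

end PersistenceModule

/-- A finite multiset of intervals is determined by the number of intervals that contain
`[s, t]`, for all `s ≤ t`. -/
theorem intervals_eq_of_countP {D D' : Multiset (ℕ × ℕ∞)} (hD : ∀ p ∈ D, (p.1 : ℕ∞) < p.2)
    (hD' : ∀ p ∈ D', (p.1 : ℕ∞) < p.2)
    (h : ∀ s t : ℕ, s ≤ t → D.countP (fun p => p.1 ≤ s ∧ (t : ℕ∞) < p.2) =
      D'.countP (fun p => p.1 ≤ s ∧ (t : ℕ∞) < p.2)) : D = D' := by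
  classical
  -- intervals that start at `s` or before and end at `t + 1`
  have h1 : ∀ E : Multiset (ℕ × ℕ∞), ∀ s t : ℕ, E.countP (fun p => p.1 ≤ s ∧ (t : ℕ∞) < p.2) =
      E.countP (fun p => p.1 ≤ s ∧ p.2 = ((t + 1 : ℕ) : ℕ∞)) +
      E.countP (fun p => p.1 ≤ s ∧ ((t + 1 : ℕ) : ℕ∞) < p.2) := by
    intro E s t
    induction E using Multiset.induction with
    | empty => simp
    | cons p E ih =>
      obtain ⟨b, d⟩ := p
      simp only [Multiset.countP_cons, ih]
      induction d using ENat.recTopCoe with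
      | top =>
        simp only [ENat.natCast_lt_top, ENat.top_ne_natCast, and_true, and_false, if_false]
        omega
      | coe d =>
        simp only [Nat.cast_lt, Nat.cast_inj]
        split_ifs <;> omega
  -- Differences in the birth coordinate isolate a single multiplicity; birth `0` is the base case.
  have h2 : ∀ E : Multiset (ℕ × ℕ∞), ∀ s : ℕ, ∀ x : ℕ∞,
      E.countP (fun p => p.1 ≤ s + 1 ∧ p.2 = x) =
      E.count (s + 1, x) + E.countP (fun p => p.1 ≤ s ∧ p.2 = x) := by
    intro E s x
    induction E using Multiset.induction with
    | empty => simp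
    | cons p E ih =>
      obtain ⟨b, d⟩ := p
      simp only [Multiset.countP_cons, Multiset.count_cons, ih, Prod.mk.injEq]
      by_cases hd : d = x
      · subst hd; simp only [and_true]; split_ifs <;> omega
      · simp [hd, Ne.symm hd]
  have h2' : ∀ E : Multiset (ℕ × ℕ∞), ∀ x : ℕ∞,
      E.countP (fun p => p.1 ≤ 0 ∧ p.2 = x) = E.count (0, x) := by
    intro E x
    induction E using Multiset.induction with
    | empty => simp
    | cons p E ih =>
      obtain ⟨b, d⟩ := p
      rw [Multiset.countP_cons, Multiset.count_cons, ih]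
      simp only [Prod.mk.injEq, nonpos_iff_eq_zero]
      simp only [eq_comm]
  have h3 : ∀ s t : ℕ, s ≤ t → D.countP (fun p => p.1 ≤ s ∧ p.2 = ((t + 1 : ℕ) : ℕ∞)) =
      D'.countP (fun p => p.1 ≤ s ∧ p.2 = ((t + 1 : ℕ) : ℕ∞)) := by
    intro s t hst
    have := h s t hst
    rw [h1 D, h1 D', h s (t + 1) (by omega)] at this
    omega
  -- Infinite intervals are those that outlive a bound `T` for all finite deaths in both multisets.
  -- The maximum with `s` keeps the test interval nonempty.
  have h4 : ∀ s, D.countP (fun p => p.1 ≤ s ∧ p.2 = ⊤) =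
      D'.countP (fun p => p.1 ≤ s ∧ p.2 = ⊤) := by
    intro s
    obtain ⟨T, hT⟩ : ∃ T : ℕ, ∀ p ∈ D + D', p.2 ≠ ⊤ → p.2 ≤ T := by
      generalize D + D' = E
      induction E using Multiset.induction with
      | empty => exact ⟨0, by simp⟩
      | cons p E ih =>
        obtain ⟨T, hT⟩ := ih
        refine ⟨max T p.2.toNat, fun q hq hq' => ?_⟩
        rcases Multiset.mem_cons.1 hq with rfl | hq
        · rw [← ENat.natCast_toNat hq']
          exact_mod_cast le_max_right _ _
        · exact (hT q hq hq').trans (by exact_mod_cast le_max_left _ _)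
    have key : ∀ E : Multiset (ℕ × ℕ∞), E ≤ D + D' → E.countP (fun p => p.1 ≤ s ∧ p.2 = ⊤) =
        E.countP (fun p => p.1 ≤ s ∧ ((max s T : ℕ) : ℕ∞) < p.2) := by
      intro E hE
      refine Multiset.countP_congr rfl fun p hp => ?_
      have := hT p (Multiset.mem_of_le hE hp)
      refine propext (and_congr_right fun _ => ⟨fun e => by rw [e]; exact ENat.natCast_lt_top _, ?_⟩)
      intro hlt
      by_contra hne
      have h5 : (T : ℕ∞) ≤ ((max s T : ℕ) : ℕ∞) := by exact_mod_cast le_max_right _ _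
      exact absurd ((this hne).trans h5) (not_le.2 hlt)
    rw [key D (Multiset.le_add_right _ _), key D' (Multiset.le_add_left _ _),
      h _ _ (le_max_left _ _)]
  have h5 : ∀ (s : ℕ) (x : ℕ∞), (s : ℕ∞) < x → D.countP (fun p => p.1 ≤ s ∧ p.2 = x) =
      D'.countP (fun p => p.1 ≤ s ∧ p.2 = x) := by
    intro s x hx
    induction x using ENat.recTopCoe with
    | top => exact h4 s
    | coe x =>
      have hx' : s < x := by exact_mod_cast hx
      obtain ⟨t, rfl⟩ : ∃ t, x = t + 1 := ⟨x - 1, by omega⟩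
      exact h3 s t (by omega)
  refine Multiset.ext.2 fun ⟨b, d⟩ => ?_
  by_cases hbd : (b : ℕ∞) < d
  · cases b with
    | zero => rw [← h2', ← h2', h5 0 d hbd]
    | succ b =>
      have e1 := h5 (b + 1) d hbd
      have hb : (b : ℕ∞) < d := lt_of_le_of_lt (by exact_mod_cast Nat.le_succ b) hbd
      rw [h2, h2, h5 b d hb] at e1
      omega
  · rw [Multiset.count_eq_zero_of_notMem (fun hm => hbd (hD _ hm)),
      Multiset.count_eq_zero_of_notMem (fun hm => hbd (hD' _ hm))]

namespace PersistenceModule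

variable {M : PersistenceModule.{u}}

theorem IsDiagram.unique {D D' : Multiset (ℕ × ℕ∞)} (hD : M.IsDiagram D)
    (hD' : M.IsDiagram D') : D = D' :=
  intervals_eq_of_countP hD.lt hD'.lt fun _ _ h => by
    rw [← hD.finrank_range h, ← hD'.finrank_range h]

theorem IsDiagram.diagram_eq {D : Multiset (ℕ × ℕ∞)} (hD : M.IsDiagram D) : M.diagram = D :=
  (Classical.epsilon_spec (p := M.IsDiagram) ⟨D, hD⟩).unique hD

/-- If all intervals that contain `i` have length `n`, then the classes born at `i` live
for exactly `n` steps. -/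
theorem IsDiagram.diesAt {D : Multiset (ℕ × ℕ∞)} (hD : M.IsDiagram D) {i n : ℕ}
    (h : ∀ p ∈ D, p.1 ≤ i → (i : ℕ∞) < p.2 → p.2 = ((n + p.1 : ℕ) : ℕ∞)) (hi : 1 ≤ i)
    {z : M.V i} (hz : M.BornAt i z) : M.DiesAt i z (n + i) := by
  classical
  obtain ⟨m, b, d, e, hbd, h0, hb, rfl⟩ := hD
  have hd : ∀ j : {j : Fin m // b j ≤ i ∧ (i : ℕ∞) < d j}, d j = ((n + b j : ℕ) : ℕ∞) := fun j =>
    h (b j, d j) (Multiset.mem_map.2 ⟨j.1, Finset.mem_univ j.1, rfl⟩) j.2.1 j.2.2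
  have hmem : z ∈ Submodule.span (ZMod 2) (Set.range
      (fun j : {j : Fin m // b j ≤ i ∧ (i : ℕ∞) < d j} => M.map j.2.1 (e j.1))) := by
    rw [(hb i).2]; trivial
  obtain ⟨c, rfl⟩ := (Submodule.mem_span_range_iff_exists_fun (ZMod 2)).1 hmem
  -- If only generators born before `i` occurred in `z`, then `z` would come from time `i - 1`.
  obtain ⟨j₀, hj₀, hc⟩ : ∃ j, b j.1 = i ∧ c j ≠ 0 := by
    by_contra hne
    push Not at hne
    obtain ⟨s, rfl⟩ : ∃ s, i = s + 1 := ⟨i - 1, by omega⟩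
    refine hz s (Nat.le_succ s) rfl (Submodule.sum_mem _ fun j _ => ?_)
    by_cases hj : b j.1 = s + 1
    · rw [hne j hj, zero_smul]
      exact Submodule.zero_mem _
    · have hj' : b j.1 ≤ s := by have := j.2.1; omega
      exact Submodule.smul_mem _ _ ⟨M.map hj' (e j.1), M.map_map _ _ _⟩
  have hle : i ≤ n + i := by omega
  refine ⟨hle, ?_, fun s hs hsn hs0 => ?_⟩
  · rw [map_sum]
    refine Finset.sum_eq_zero fun j _ => ?_
    rw [map_smul, M.map_map, h0 j.1 _ (j.2.1.trans hle), smul_zero]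
    rw [hd j]
    have := j.2.1
    exact_mod_cast (by omega : n + b j.1 ≤ n + i)
  · let J := {j : Fin m // b j ≤ i ∧ (i : ℕ∞) < d j}
    let w : J → M.V s := fun j => M.map (j.2.1.trans hs) (e j.1)
    -- The generators still alive at `s` are part of the basis there. Since `j₀` dies at `n + i >
    -- s`, it is among them, and its coefficient would have to vanish.
    let A : Finset J := Finset.univ.filter (fun j => (s : ℕ∞) < d j.1)
    have hli : LinearIndepOn (ZMod 2) w (A : Set J) := by
      refine (hb s).1.comp (fun j : (A : Set J) =>
        ⟨j.1.1, j.1.2.1.trans hs, (Finset.mem_filter.1 j.2).2⟩) ?_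
      intro j k hjk
      exact Subtype.ext (Subtype.ext (congrArg (fun k => k.1) hjk))
    have hsum : ∑ j ∈ A, c j • w j = 0 := by
      rw [← hs0, map_sum]
      refine (Finset.sum_subset (Finset.subset_univ _) fun j _ hj => ?_).trans
        (Finset.sum_congr rfl fun j _ => by rw [map_smul, M.map_map])
      have : d j.1 ≤ (s : ℕ∞) := by simpa [A] using hj
      rw [show w j = 0 from h0 _ _ _ this, smul_zero]
    refine hc (linearIndepOn_finset_iff.1 hli c hsum j₀ ?_)
    rw [Finset.mem_filter, hd j₀, hj₀]
    exact ⟨Finset.mem_univ _, by exact_mod_cast hsn⟩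

end PersistenceModule

/-! ### Homology from a chain basis adapted to the boundary -/

open Classical in
/-- The homology class of a chain; it is `0` if the chain is not a cycle. -/
noncomputable def CellComplex.homologyClass (Y : CellComplex.{u}) (k : ℕ)
    (z : Y.Cell →₀ ZMod 2) : Y.homology k :=
  if h : z ∈ Y.cycles k then Submodule.Quotient.mk ⟨z, h⟩ else 0

theorem CellComplex.homologyClass_of_mem {Y : CellComplex.{u}} {k : ℕ} {z : Y.Cell →₀ ZMod 2}
    (h : z ∈ Y.cycles k) : Y.homologyClass k z = Submodule.Quotient.mk ⟨z, h⟩ := dif_pos h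

theorem CellComplex.homologyClass_eq_zero {Y : CellComplex.{u}} {k : ℕ} {z : Y.Cell →₀ ZMod 2}
    (h : z ∈ Y.boundaries k) : Y.homologyClass k z = 0 := by
  by_cases hz : z ∈ Y.cycles k
  · rw [Y.homologyClass_of_mem hz, Submodule.Quotient.mk_eq_zero]
    exact h
  · exact dif_neg hz

theorem CellMap.homologyMap_class {Y Z : CellComplex} (φ : CellMap Y Z) {k : ℕ}
    {z : Y.Cell →₀ ZMod 2} (h : z ∈ Y.cycles k) :
    φ.homologyMap k (Y.homologyClass k z) =
      Z.homologyClass k (pushChain Y.dim Z.dim φ.toFun z) := by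
  rw [Y.homologyClass_of_mem h, Z.homologyClass_of_mem (φ.push_mem_cycles k z h)]
  rfl

section HomologyBasis

variable {Y : CellComplex.{u}} {ι : Type v} {α : ι → Y.Cell →₀ ZMod 2} {A : Set ι} {δ : ι → ℕ}
  {p : ι → Option ι} {k : ℕ}

/-- A basis vector whose boundary is zero, and that is not itself a boundary: here `p i` is the
index of the boundary of the `i`-th basis vector, and `A` is the set of indices of the nonzero
vectors. -/
def IsFreeCycle (A : Set ι) (δ : ι → ℕ) (p : ι → Option ι) (k : ℕ) (i : ι) : Prop :=
  i ∈ A ∧ δ i = k ∧ (∀ j, p i = some j → j ∉ A) ∧ ∀ j, p j = some i → j ∉ A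

/-- Each basis vector has as boundary a basis vector or zero, so only indices that are partners of
present ones are needed. -/
theorem boundaries_le_span (hsp : ⊤ ≤ Submodule.span (ZMod 2) (α '' A))
    (hzero : ∀ i ∈ A, ∀ j, p i = some j → j ∉ A → α j = 0)
    (hbd : ∀ i ∈ A, Y.boundary (α i) = (p i).elim 0 α) :
    Y.boundaries k ≤
      Submodule.span (ZMod 2) (α '' {i | i ∈ A ∧ ∃ j ∈ A, p j = some i}) := by
  refine (Submodule.map_mono (le_top.trans hsp)).trans ?_
  rw [Submodule.map_span, Submodule.span_le]
  rintro _ ⟨_, ⟨i, hi, rfl⟩, rfl⟩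
  rw [hbd i hi]
  rcases e : p i with _ | j
  · exact Submodule.zero_mem _
  · by_cases hj : j ∈ A
    · exact Submodule.subset_span ⟨j, ⟨hj, i, hi, e⟩, rfl⟩
    · simp only [Option.elim_some, hzero i hi j e hj]
      exact Submodule.zero_mem _

/-- The basis vectors are homogeneous: the projection to dimension `k` fixes those of degree `k` and
kills the others. -/
theorem chains_le_span (hsp : ⊤ ≤ Submodule.span (ZMod 2) (α '' A))
    (hdim : ∀ i ∈ A, α i ∈ Y.chains (δ i)) :
    Y.chains k ≤ Submodule.span (ZMod 2) (α '' {i | i ∈ A ∧ δ i = k}) := by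
  classical
  intro z hz
  let P : (Y.Cell →₀ ZMod 2) →ₗ[ZMod 2] (Y.Cell →₀ ZMod 2) :=
    (Submodule.subtype _).comp (Finsupp.restrictDom (ZMod 2) (ZMod 2) {c | Y.dim c = k})
  have hP : ∀ w, P w = w.filter (fun c => Y.dim c = k) := fun w => rfl
  have hPz : P z = z := by
    rw [hP, Finsupp.filter_eq_self_iff]
    intro c hc
    exact hz (Finsupp.mem_support_iff.2 hc)
  have hmem : P z ∈ (Submodule.span (ZMod 2) (α '' A)).map P :=
    Submodule.mem_map_of_mem (hsp trivial)
  rw [hPz, Submodule.map_span] at hmem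
  refine (Submodule.span_le.2 ?_) hmem
  rintro _ ⟨_, ⟨i, hi, rfl⟩, rfl⟩
  by_cases hk : δ i = k
  · refine Submodule.subset_span ⟨i, ⟨hi, hk⟩, ?_⟩
    rw [hP, eq_comm, Finsupp.filter_eq_self_iff]
    intro c hc
    exact (hdim i hi (Finsupp.mem_support_iff.2 hc)).trans hk
  · have h0 : P (α i) = 0 := by
      rw [hP, Finsupp.filter_eq_zero_iff]
      intro c hc
      by_contra hne
      exact hk (((hdim i hi (Finsupp.mem_support_iff.2 hne)).symm).trans hc)
    rw [h0]
    exact Submodule.zero_mem _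

theorem IsFreeCycle.mem_cycles (hzero : ∀ i ∈ A, ∀ j, p i = some j → j ∉ A → α j = 0)
    (hdim : ∀ i ∈ A, α i ∈ Y.chains (δ i))
    (hbd : ∀ i ∈ A, Y.boundary (α i) = (p i).elim 0 α) {i : ι} (hi : IsFreeCycle A δ p k i) :
    α i ∈ Y.cycles k := by
  refine ⟨hi.2.1 ▸ hdim i hi.1, ?_⟩
  change Y.boundary (α i) = 0
  rw [hbd i hi.1]
  rcases e : p i with _ | j
  · rfl
  · exact hzero i hi.1 j e (hi.2.2.1 j e)

theorem LinearIndepOn.disjoint_span {R V : Type*} [Ring R] [Nontrivial R] [AddCommGroup V]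
    [Module R V] {v : ι → V} (h : LinearIndepOn R v A) {s t : Set ι} (hs : s ⊆ A) (ht : t ⊆ A)
    (hst : Disjoint s t) :
    Disjoint (Submodule.span R (v '' s)) (Submodule.span R (v '' t)) := by
  have key : ∀ r ⊆ A, (fun i : A => v i) '' (Subtype.val ⁻¹' r) = v '' r := by
    intro r hr
    rw [← Function.comp_def v, Set.image_comp, Subtype.image_preimage_coe,
      Set.inter_eq_right.2 hr]
  have := LinearIndependent.disjoint_span_image h (hst.preimage Subtype.val)
  rwa [key s hs, key t ht] at this

/-- Free cycles and boundaries lie in the spans of disjoint parts of the basis, so no nontrivial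
combination of free cycles bounds. -/
theorem homologyClass_linearIndependent (hli : LinearIndepOn (ZMod 2) α A)
    (hsp : ⊤ ≤ Submodule.span (ZMod 2) (α '' A))
    (hzero : ∀ i ∈ A, ∀ j, p i = some j → j ∉ A → α j = 0)
    (hdim : ∀ i ∈ A, α i ∈ Y.chains (δ i))
    (hbd : ∀ i ∈ A, Y.boundary (α i) = (p i).elim 0 α) :
    LinearIndependent (ZMod 2)
      (fun i : {i // IsFreeCycle A δ p k i} => Y.homologyClass k (α i)) := by
  let w : {i // IsFreeCycle A δ p k i} → Y.cycles k := fun i =>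
    ⟨α i, i.2.mem_cycles hzero hdim hbd⟩
  have hw : LinearIndependent (ZMod 2) w := by
    refine LinearIndependent.of_comp (Submodule.subtype _) ?_
    refine hli.comp (fun i : {i // IsFreeCycle A δ p k i} => (⟨i.1, i.2.1⟩ : A)) ?_
    intro i j hij
    exact Subtype.ext (congrArg (fun k => k.1) hij)
  have hdis : Disjoint (Submodule.span (ZMod 2) (Set.range w))
      (LinearMap.ker ((Y.boundaries k).submoduleOf (Y.cycles k)).mkQ) := by
    rw [Submodule.ker_mkQ, Submodule.disjoint_def]
    intro x hx hx'
    have h1 : (x : Y.Cell →₀ ZMod 2) ∈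
        Submodule.span (ZMod 2) (α '' {i | IsFreeCycle A δ p k i}) := by
      have := Submodule.mem_map_of_mem (f := Submodule.subtype _) hx
      rw [Submodule.map_span, ← Set.range_comp] at this
      refine Submodule.span_mono ?_ this
      rintro _ ⟨i, rfl⟩
      exact ⟨i, i.2, rfl⟩
    have h2 := boundaries_le_span hsp hzero hbd (show (x : Y.Cell →₀ ZMod 2) ∈ _ from hx')
    have hd : Disjoint {i | IsFreeCycle A δ p k i} {i | i ∈ A ∧ ∃ j ∈ A, p j = some i} := by
      rw [Set.disjoint_left]
      rintro i hi ⟨-, j, hj, e⟩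
      exact hi.2.2.2 j e hj
    have := LinearIndepOn.disjoint_span hli
      (fun i (hi : IsFreeCycle A δ p k i) => hi.1) (fun i hi => hi.1) hd
    exact Subtype.ext (Submodule.disjoint_def.1 this _ h1 h2)
  have e : (fun i : {i // IsFreeCycle A δ p k i} => Y.homologyClass k (α i)) =
      ((Y.boundaries k).submoduleOf (Y.cycles k)).mkQ ∘ w :=
    funext fun i => Y.homologyClass_of_mem _
  rw [e]
  exact hw.map hdis

/-- Distinct indices have distinct partners, so the boundaries of the vectors with partner in `A`
are independent and these vectors cannot occur in a cycle. The set `B` is separate from `A` because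
during the reduction the boundary rule is known only for the cells already treated. -/
theorem mem_span_cycles {B : Set ι} (hli : LinearIndepOn (ZMod 2) α A)
    (hzero : ∀ i ∈ B, ∀ j, p i = some j → j ∉ A → α j = 0)
    (hbd : ∀ i ∈ B, Y.boundary (α i) = (p i).elim 0 α)
    (hinj : ∀ i j l, p i = some l → p j = some l → i = j) {z : Y.Cell →₀ ZMod 2}
    (hz : z ∈ Submodule.span (ZMod 2) (α '' B)) (hz0 : Y.boundary z = 0) :
    z ∈ Submodule.span (ZMod 2) (α '' {i | i ∈ B ∧ ∀ j, p i = some j → j ∉ A}) := by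
  let Z : Set ι := {i | i ∈ B ∧ ∀ j, p i = some j → j ∉ A}
  let N : Set ι := {i | i ∈ B ∧ ∃ j, p i = some j ∧ j ∈ A}
  have hU : B = Z ∪ N := by
    ext i
    simp only [Z, N, Set.mem_ofPred_eq, Set.mem_union]
    constructor
    · intro h1
      by_cases h : ∃ j, p i = some j ∧ j ∈ A
      · exact Or.inr ⟨h1, h⟩
      · push Not at h
        exact Or.inl ⟨h1, h⟩
    · rintro (h | h) <;> exact h.1
  rw [hU, Set.image_union, Submodule.span_union, Submodule.mem_sup] at hz
  obtain ⟨z₁, hz₁, z₂, hz₂, rfl⟩ := hz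
  have hz₁0 : Y.boundary z₁ = 0 := by
    have : Submodule.span (ZMod 2) (α '' Z) ≤ LinearMap.ker Y.boundary := by
      rw [Submodule.span_le]
      rintro _ ⟨i, hi, rfl⟩
      change Y.boundary (α i) = 0
      rw [hbd i hi.1]
      rcases e : p i with _ | j
      · rfl
      · exact hzero i hi.1 j e (hi.2 j e)
    exact this hz₁
  have hz₂0 : Y.boundary z₂ = 0 := by
    rwa [map_add, hz₁0, zero_add] at hz0
  have hNli : LinearIndepOn (ZMod 2) (fun i => Y.boundary (α i)) N := by
    have hex : ∀ i : N, ∃ j : A, p i.1 = some j.1 := by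
      rintro ⟨i, -, j, e, hj⟩
      exact ⟨⟨j, hj⟩, e⟩
    choose q hq using hex
    have hqi : Function.Injective q := by
      intro i j hij
      exact Subtype.ext (hinj _ _ _ (hq i) (hij ▸ hq j))
    have e : (fun i : N => Y.boundary (α i)) = (fun i : A => α i) ∘ q := by
      funext i
      simp only [Function.comp_apply]
      rw [hbd i i.2.1, hq i]
      rfl
    change LinearIndependent (ZMod 2) (fun i : N => Y.boundary (α i))
    rw [e]
    exact hli.comp q hqi
  have hz₂' : z₂ = 0 := by
    obtain ⟨l, hl, rfl⟩ := (Finsupp.mem_span_image_iff_linearCombination (ZMod 2)).1 hz₂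
    rw [LinearMap.map_finsupp_linearCombination] at hz₂0
    rw [linearIndepOn_iff.1 hNli l hl hz₂0, map_zero]
  rw [hz₂', add_zero]
  exact hz₁

/-- By `mem_span_cycles` a cycle is a combination of basis cycles, and each of these is a free cycle
or the boundary of another basis vector. -/
theorem homologyClass_span (hli : LinearIndepOn (ZMod 2) α A)
    (hsp : ⊤ ≤ Submodule.span (ZMod 2) (α '' A))
    (hzero : ∀ i ∈ A, ∀ j, p i = some j → j ∉ A → α j = 0)
    (hdim : ∀ i ∈ A, α i ∈ Y.chains (δ i))
    (hbd : ∀ i ∈ A, Y.boundary (α i) = (p i).elim 0 α)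
    (hp : ∀ i j, p i = some j → δ i = δ j + 1)
    (hinj : ∀ i j l, p i = some l → p j = some l → i = j) :
    Submodule.span (ZMod 2) (Set.range
      (fun i : {i // IsFreeCycle A δ p k i} => Y.homologyClass k (α i))) = ⊤ := by
  classical
  rw [eq_top_iff]
  intro x _
  obtain ⟨⟨z, hz⟩, rfl⟩ := Submodule.Quotient.mk_surjective _ x
  have hzZ := mem_span_cycles hli (fun i hi => hzero i hi.1) (fun i hi => hbd i hi.1) hinj
    (chains_le_span hsp hdim hz.1) hz.2
  have hdec : z ∈ Submodule.span (ZMod 2) (α '' {i | IsFreeCycle A δ p k i}) ⊔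
      Y.boundaries k := by
    refine (Submodule.span_le.2 ?_) hzZ
    rintro _ ⟨i, ⟨⟨hi, hk⟩, hpi⟩, rfl⟩
    by_cases h : ∃ j ∈ A, p j = some i
    · obtain ⟨j, hj, e⟩ := h
      refine Submodule.mem_sup_right ⟨α j, ?_, by rw [hbd j hj, e]; rfl⟩
      have := hdim j hj
      rwa [hp j i e, hk] at this
    · push Not at h
      exact Submodule.mem_sup_left (Submodule.subset_span
        ⟨i, ⟨hi, hk, hpi, fun j e hj => h j hj e⟩, rfl⟩)
  obtain ⟨y, hy, w, hw, e⟩ := Submodule.mem_sup.1 hdec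
  have hyc : y ∈ Y.cycles k ∧ Y.homologyClass k y ∈ Submodule.span (ZMod 2) (Set.range
      (fun i : {i // IsFreeCycle A δ p k i} => Y.homologyClass k (α i))) := by
    have : Submodule.span (ZMod 2) (α '' {i | IsFreeCycle A δ p k i}) ≤
        ((Submodule.span (ZMod 2) (Set.range
          (fun i : {i // IsFreeCycle A δ p k i} => Y.homologyClass k (α i)))).comap
          (Submodule.mkQ _)).map (Submodule.subtype (Y.cycles k)) := by
      rw [Submodule.span_le]
      rintro _ ⟨i, hi, rfl⟩
      have hm := IsFreeCycle.mem_cycles hzero hdim hbd hi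
      refine ⟨⟨α i, hm⟩, ?_, rfl⟩
      exact Submodule.subset_span ⟨⟨i, hi⟩, Y.homologyClass_of_mem hm⟩
    obtain ⟨y', hy', rfl⟩ := this hy
    exact ⟨y'.2, by rw [Submodule.subtype_apply, Y.homologyClass_of_mem y'.2]; exact hy'⟩
  have hcl : Submodule.Quotient.mk ⟨z, hz⟩ = Y.homologyClass k y := by
    rw [Y.homologyClass_of_mem hyc.1, Submodule.Quotient.eq]
    change z - y ∈ Y.boundaries k
    rw [← e, add_sub_cancel_left]
    exact hw
  rw [hcl]
  exact hyc.2

end HomologyBasis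

open Classical in
/-- The diagram of the homology of a sequence of complexes with a basis of chains that is
compatible with the boundaries and with the maps: the `i`-th basis chain is present from time `b i`
until time `c i`, and `p i` is the index of its boundary. -/
theorem isDiagram_of_basis {Y : ℕ → CellComplex.{u}}
    (φ : ∀ {s t : ℕ}, s ≤ t → CellMap (Y s) (Y t)) (k : ℕ)
    (hrefl : ∀ t, (φ (le_refl t)).homologyMap k = LinearMap.id)
    (htrans : ∀ {r s t : ℕ} (h : r ≤ s) (h' : s ≤ t),
      (φ (h.trans h')).homologyMap k = ((φ h').homologyMap k).comp ((φ h).homologyMap k))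
    {ι : Type v} [Fintype ι] (δ b : ι → ℕ) (c : ι → ℕ∞) (p : ι → Option ι)
    (α : ∀ t, ι → (Y t).Cell →₀ ZMod 2)
    (hli : ∀ t, LinearIndepOn (ZMod 2) (α t) {i | b i ≤ t ∧ (t : ℕ∞) < c i})
    (hsp : ∀ t, ⊤ ≤ Submodule.span (ZMod 2) (α t '' {i | b i ≤ t ∧ (t : ℕ∞) < c i}))
    (hzero : ∀ t i, b i ≤ t → c i ≤ t → α t i = 0)
    (hdim : ∀ t i, b i ≤ t → α t i ∈ (Y t).chains (δ i))
    (hbd : ∀ t i, b i ≤ t → (Y t).boundary (α t i) = (p i).elim 0 (α t))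
    (hpush : ∀ {s t : ℕ} (h : s ≤ t) (i : ι), b i ≤ s →
      pushChain (Y s).dim (Y t).dim (φ h).toFun (α s i) = α t i)
    (hp : ∀ i j, p i = some j → δ i = δ j + 1 ∧ b j ≤ b i ∧ c j ≤ c i)
    (hinj : ∀ i j l, p i = some l → p j = some l → i = j)
    (lo hi : ι → ℕ∞)
    (hlo : ∀ i (t : ℕ), lo i ≤ t ↔ b i ≤ t ∧ ∀ j, p i = some j → c j ≤ t)
    (hhi : ∀ i (t : ℕ), (t : ℕ∞) < hi i ↔ t < c i ∧ ∀ j, p j = some i → t < b j) :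
    PersistenceModule.IsDiagram
      ⟨fun t => (Y t).homology k, fun h => (φ h).homologyMap k, hrefl, htrans⟩
      ((Finset.univ.filter (fun i => δ i = k ∧ lo i < hi i)).val.map
        (fun i => ((lo i).toNat, hi i))) := by
  set M : PersistenceModule :=
    ⟨fun t => (Y t).homology k, fun h => (φ h).homologyMap k, hrefl, htrans⟩ with hM
  let A : ℕ → Set ι := fun t => {i | b i ≤ t ∧ (t : ℕ∞) < c i}
  let J := {i : ι // δ i = k ∧ lo i < hi i}
  have hcoe : ∀ i : ι, lo i < hi i → ((lo i).toNat : ℕ∞) = lo i := fun i h =>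
    ENat.natCast_toNat (ne_top_of_lt h)
  have hle : ∀ i : ι, lo i < hi i → ∀ t : ℕ, (lo i).toNat ≤ t ↔ lo i ≤ t := by
    intro i h t
    rw [← hcoe i h, Nat.cast_le, ENat.toNat_natCast]
  have hz : ∀ t, ∀ i ∈ A t, ∀ j, p i = some j → j ∉ A t → α t j = 0 := by
    intro t i hi j e hj
    have hbj := (hp i j e).2.1.trans hi.1
    exact hzero t j hbj (not_lt.1 fun h => hj ⟨hbj, h⟩)
  have hd : ∀ t, ∀ i ∈ A t, α t i ∈ (Y t).chains (δ i) := fun t i hi => hdim t i hi.1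
  have hb' : ∀ t, ∀ i ∈ A t, (Y t).boundary (α t i) = (p i).elim 0 (α t) :=
    fun t i hi => hbd t i hi.1
  -- A partner appears no later and disappears no later than the vector it bounds. Hence, while `i`
  -- is present, "the partner is absent" means "already gone", and "what `i` bounds is absent" means
  -- "not yet there"; these are the conditions behind `lo` and `hi`.
  have hfree : ∀ t i, IsFreeCycle (A t) δ p k i ↔
      (δ i = k ∧ lo i < hi i) ∧ (lo i).toNat ≤ t ∧ (t : ℕ∞) < hi i := by
    intro t i
    have h1 : IsFreeCycle (A t) δ p k i ↔ δ i = k ∧ lo i ≤ t ∧ (t : ℕ∞) < hi i := by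
      rw [hlo, hhi]
      constructor
      · rintro ⟨⟨hb, hc⟩, hk, h1, h2⟩
        refine ⟨hk, ⟨hb, fun j e => ?_⟩, hc, fun j e => ?_⟩
        · exact not_lt.1 fun h => h1 j e ⟨(hp i j e).2.1.trans hb, h⟩
        · exact not_le.1 fun h => h2 j e ⟨h, hc.trans_le (hp j i e).2.2⟩
      · rintro ⟨hk, ⟨hb, h1⟩, hc, h2⟩
        exact ⟨⟨hb, hc⟩, hk, fun j e hj => absurd hj.2 (not_lt.2 (h1 j e)),
          fun j e hj => absurd hj.1 (not_le.2 (h2 j e))⟩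
    rw [h1]
    constructor
    · rintro ⟨hk, hl, hh⟩
      have := hl.trans_lt hh
      exact ⟨⟨hk, this⟩, (hle i this t).2 hl, hh⟩
    · rintro ⟨⟨hk, h⟩, hl, hh⟩
      exact ⟨hk, (hle i h t).1 hl, hh⟩
  let e : ∀ j : J, M.V (lo j.1).toNat := fun j => (Y _).homologyClass k (α _ j.1)
  have he : ∀ (j : J) (t : ℕ) (h : (lo j.1).toNat ≤ t),
      M.map h (e j) = (Y t).homologyClass k (α t j.1) := by
    intro j t h
    have hcyc : α (lo j.1).toNat j.1 ∈ (Y (lo j.1).toNat).cycles k := by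
      refine IsFreeCycle.mem_cycles (hz _) (hd _) (hb' _) ((hfree _ _).2 ⟨j.2, le_rfl, ?_⟩)
      rw [hcoe _ j.2.2]
      exact j.2.2
    refine ((φ h).homologyMap_class hcyc).trans ?_
    rw [hpush h j.1]
    exact ((hlo _ _).1 ((hle _ j.2.2 _).1 le_rfl)).1
  let τ : ∀ t, {i : J // (lo i.1).toNat ≤ t ∧ (t : ℕ∞) < hi i.1} ≃
      {i // IsFreeCycle (A t) δ p k i} := fun t =>
    { toFun := fun i => ⟨i.1.1, (hfree t _).2 ⟨i.1.2, i.2⟩⟩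
      invFun := fun i => ⟨⟨i.1, ((hfree t _).1 i.2).1⟩, ((hfree t _).1 i.2).2⟩
      left_inv := fun i => rfl
      right_inv := fun i => rfl }
  have hfun : ∀ t, (fun i : {i : J // (lo i.1).toNat ≤ t ∧ (t : ℕ∞) < hi i.1} =>
      M.map i.2.1 (e i.1)) =
      (fun i : {i // IsFreeCycle (A t) δ p k i} => (Y t).homologyClass k (α t i)) ∘ τ t :=
    fun t => funext fun i => he _ _ _
  have key := PersistenceModule.isDiagram_of_fintype (M := M) (J := J)
    (fun j => (lo j.1).toNat) (fun j => hi j.1) e ?_ ?_ ?_ ?_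
  · have hval : (Finset.univ.filter (fun i => δ i = k ∧ lo i < hi i)).val.map
        (fun i => ((lo i).toNat, hi i)) =
        (Finset.univ : Finset J).val.map (fun j => ((lo j.1).toNat, hi j.1)) := by
      rw [← Finset.subtype_univ, ← Finset.subtype_map, Finset.map_val, Multiset.map_map]
      rfl
    rw [hval]
    exact key
  · intro j
    rw [hcoe _ j.2.2]
    exact j.2.2
  · intro j t h ht
    rw [he j t h]
    have hlt := ((hlo _ _).1 ((hle _ j.2.2 _).1 h)).1
    -- A class dies in one of two ways: its chain has become zero, or an `l` with `p l = j` has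
    -- appeared and the chain is now a boundary.
    by_cases hct : c j.1 ≤ t
    · rw [hzero t j.1 hlt hct]
      exact CellComplex.homologyClass_eq_zero (Submodule.zero_mem _)
    · have := (hhi j.1 t).not.1 (not_lt.2 ht)
      push Not at this
      obtain ⟨l, el, hl⟩ := this (not_le.1 hct)
      refine CellComplex.homologyClass_eq_zero ⟨α t l, ?_, ?_⟩
      · have := hdim t l hl
        rwa [(hp l j.1 el).1, j.2.1] at this
      · rw [hbd t l hl, el]
        rfl
  · intro t
    rw [hfun t]
    exact (homologyClass_linearIndependent (hli t) (hsp t) (hz t) (hd t) (hb' t)).comp _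
      (τ t).injective
  · intro t
    rw [hfun t, (τ t).surjective.range_comp]
    exact homologyClass_span (hli t) (hsp t) (hz t) (hd t) (hb' t) (fun i j e => (hp i j e).1) hinj

/-! ### Matrix reduction: reduced bases of a filtered complex -/

namespace Filtration

variable {X : CellComplex.{u}} (f : Filtration X)

theorem boundary_mem_supported {k t : ℕ} {z : X.Cell →₀ ZMod 2}
    (hz : z ∈ Finsupp.supported (ZMod 2) (ZMod 2) {c | X.dim c = k ∧ f.step c ≤ t}) :
    X.boundary z ∈ Finsupp.supported (ZMod 2) (ZMod 2) {c | X.dim c + 1 = k ∧ f.step c ≤ t} := by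
  rw [CellData.boundary, Finsupp.linearCombination_apply]
  refine Submodule.sum_mem _ fun c hc => Submodule.smul_mem _ _ fun τ hτ => ?_
  obtain ⟨h1, h2⟩ := hz hc
  obtain ⟨h3, h4⟩ := X.bdry_face c τ hτ
  exact ⟨by omega, (f.step_mono h3).trans h2⟩

/-- A basis of the chains, indexed by the cells, that is compatible with dimensions and with the
filtration. -/
structure IsFilteredBasis (a : X.Cell → X.Cell →₀ ZMod 2) : Prop where
  mem_supported : ∀ σ, a σ ∈ Finsupp.supported (ZMod 2) (ZMod 2)
    {c | X.dim c = X.dim σ ∧ f.step c ≤ f.step σ}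
  single_mem_span : ∀ c, Finsupp.single c 1 ∈ Submodule.span (ZMod 2)
    (a '' {σ | X.dim σ = X.dim c ∧ f.step σ ≤ f.step c})

theorem isFilteredBasis_single : f.IsFilteredBasis (fun σ => Finsupp.single σ 1) where
  mem_supported _ := Finsupp.single_mem_supported _ _ ⟨rfl, le_rfl⟩
  single_mem_span c := Submodule.subset_span ⟨c, ⟨rfl, le_rfl⟩, rfl⟩

namespace IsFilteredBasis

variable {f} {a : X.Cell → X.Cell →₀ ZMod 2} (ha : f.IsFilteredBasis a)
include ha

theorem supported_le_span {s : Set X.Cell} (hs : ∀ c ∈ s, ∀ σ, X.dim σ = X.dim c →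
    f.step σ ≤ f.step c → σ ∈ s) :
    Finsupp.supported (ZMod 2) (ZMod 2) s ≤ Submodule.span (ZMod 2) (a '' s) := by
  rw [Finsupp.supported_eq_span_single, Submodule.span_le]
  rintro _ ⟨c, hc, rfl⟩
  refine Submodule.span_mono ?_ (ha.single_mem_span c)
  rintro _ ⟨σ, hσ, rfl⟩
  exact ⟨σ, hs c hc σ hσ.1 hσ.2, rfl⟩

theorem top_le_span : ⊤ ≤ Submodule.span (ZMod 2) (Set.range a) := by
  have := ha.supported_le_span (s := Set.univ) (fun _ _ _ _ _ => trivial)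
  rwa [Finsupp.supported_univ, Set.image_univ] at this

/-- The family spans and has as many members as there are cells. -/
theorem linearIndependent : LinearIndependent (ZMod 2) a := by
  have := X.finite_cell
  have := Fintype.ofFinite X.Cell
  exact linearIndependent_of_top_le_span_of_card_eq_finrank ha.top_le_span
    (Module.finrank_finsupp_self (ZMod 2)).symm

/-- A column addition that respects dimension and filtration; since `z` avoids the index `x`, the
old chain is recovered by subtracting `z`. -/
theorem update [DecidableEq X.Cell] (x : X.Cell) {z : X.Cell →₀ ZMod 2}
    (hz : z ∈ Submodule.span (ZMod 2)
      (a '' {σ | σ ≠ x ∧ X.dim σ = X.dim x ∧ f.step σ ≤ f.step x})) :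
    f.IsFilteredBasis (Function.update a x (a x + z)) where
  mem_supported σ := by
    by_cases h : σ = x
    · subst h
      rw [Function.update_self]
      refine Submodule.add_mem _ (ha.mem_supported σ) ((Submodule.span_le.2 ?_) hz)
      rintro _ ⟨τ, ⟨-, h1, h2⟩, rfl⟩
      refine Finsupp.supported_mono ?_ (ha.mem_supported τ)
      rintro c ⟨h3, h4⟩
      exact ⟨h3.trans h1, h4.trans h2⟩
    · rw [Function.update_of_ne h]
      exact ha.mem_supported σ
  single_mem_span c := by
    have hne : ∀ σ, σ ≠ x → ∀ s : Set X.Cell, σ ∈ s → a σ ∈ Submodule.span (ZMod 2)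
        (Function.update a x (a x + z) '' s) := fun σ h s hs =>
      Submodule.subset_span ⟨σ, hs, Function.update_of_ne h _ _⟩
    refine (Submodule.span_le.2 ?_) (ha.single_mem_span c)
    rintro _ ⟨σ, hσ, rfl⟩
    by_cases h : σ = x
    · subst h
      have h1 : a σ + z ∈ Submodule.span (ZMod 2) (Function.update a σ (a σ + z) ''
          {τ | X.dim τ = X.dim c ∧ f.step τ ≤ f.step c}) :=
        Submodule.subset_span ⟨σ, hσ, Function.update_self _ _ _⟩
      refine (Submodule.add_mem_iff_left _ ((Submodule.span_le.2 ?_) hz)).1 h1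
      rintro _ ⟨τ, ⟨h0, h1, h2⟩, rfl⟩
      exact hne τ h0 _ ⟨h1.trans hσ.1, h2.trans hσ.2⟩
    · exact hne σ h _ hσ

end IsFilteredBasis

/-- A filtered basis that is compatible with the boundaries of the basis chains with indices
in `L`: the boundary of the basis chain of `σ` is zero, or the basis chain of the partner `p σ`
of `σ`. -/
structure IsReducedBasis (L : Set X.Cell) (a : X.Cell → X.Cell →₀ ZMod 2)
    (p : X.Cell → Option X.Cell) : Prop extends f.IsFilteredBasis a where
  boundary_eq : ∀ σ ∈ L, X.boundary (a σ) = (p σ).elim 0 a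
  partner : ∀ σ τ, p σ = some τ →
    σ ∈ L ∧ τ ∈ L ∧ p τ = none ∧ X.dim σ = X.dim τ + 1 ∧ f.step τ ≤ f.step σ
  partner_inj : ∀ σ ρ τ, p σ = some τ → p ρ = some τ → σ = ρ

namespace IsReducedBasis

variable {f} {L : Set X.Cell} {a : X.Cell → X.Cell →₀ ZMod 2} {p : X.Cell → Option X.Cell}

/-- The case in which the boundary of the new column reduces to zero: `σ` creates a class and stays
unpaired. -/
theorem insert_cycle [DecidableEq X.Cell] (h : f.IsReducedBasis L a p) {σ : X.Cell} (hσ : σ ∉ L)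
    {z : X.Cell →₀ ZMod 2}
    (hz : z ∈ Submodule.span (ZMod 2)
      (a '' {ρ | ρ ∈ L ∧ X.dim ρ = X.dim σ ∧ f.step ρ ≤ f.step σ}))
    (hb : X.boundary (a σ + z) = 0) :
    f.IsReducedBasis (insert σ L) (Function.update a σ (a σ + z)) p where
  toIsFilteredBasis := h.toIsFilteredBasis.update σ (Submodule.span_mono (by
    rintro _ ⟨ρ, ⟨h1, h2⟩, rfl⟩
    exact ⟨ρ, ⟨fun e => hσ (e ▸ h1), h2⟩, rfl⟩) hz)
  boundary_eq ρ hρ := by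
    rcases eq_or_ne ρ σ with rfl | hne
    · rcases e : p ρ with _ | τ
      · rw [Function.update_self, hb]
        rfl
      · exact absurd (h.partner _ _ e).1 hσ
    · have hρL : ρ ∈ L := (Set.mem_insert_iff.1 hρ).resolve_left hne
      rw [Function.update_of_ne hne, h.boundary_eq ρ hρL]
      rcases e : p ρ with _ | τ
      · rfl
      · exact (Function.update_of_ne (ne_of_mem_of_not_mem (h.partner _ _ e).2.1 hσ) _ _).symm
  partner ρ τ e := by
    obtain ⟨h1, h2, h3⟩ := h.partner ρ τ e
    exact ⟨Or.inr h1, Or.inr h2, h3⟩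
  partner_inj := h.partner_inj

/-- The case in which `σ` destroys the class with pivot `τ`. Replacing `a τ` by the reduced boundary
`a τ + y` makes the boundary rule exact for `σ`. No other boundary is affected, since `τ` is not yet
a partner and `a τ` and `y` are both cycles. -/
theorem insert_pair [DecidableEq X.Cell] (h : f.IsReducedBasis L a p) {σ τ : X.Cell} (hσ : σ ∉ L)
    {z y : X.Cell →₀ ZMod 2}
    (hz : z ∈ Submodule.span (ZMod 2)
      (a '' {ρ | ρ ∈ L ∧ X.dim ρ = X.dim σ ∧ f.step ρ ≤ f.step σ}))
    (hτ : τ ∈ L) (hpτ : p τ = none) (hτp : ∀ ρ, p ρ ≠ some τ) (hd : X.dim σ = X.dim τ + 1)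
    (hs : f.step τ ≤ f.step σ)
    (hy : y ∈ Submodule.span (ZMod 2)
      (a '' {ρ | ρ ∈ L ∧ p ρ = none ∧ ρ ≠ τ ∧ X.dim ρ = X.dim τ ∧ f.step ρ ≤ f.step τ}))
    (hb : X.boundary (a σ + z) = a τ + y) :
    f.IsReducedBasis (insert σ L) (Function.update (Function.update a σ (a σ + z)) τ (a τ + y))
      (Function.update p σ (some τ)) := by
  have hne : τ ≠ σ := fun e => hσ (e ▸ hτ)
  have hpσ : p σ = none := by
    rcases e : p σ with _ | ρ
    · rfl
    · exact absurd (h.partner _ _ e).1 hσ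
  have hup : ∀ ρ, ρ ≠ σ → Function.update p σ (some τ) ρ = p ρ :=
    fun ρ hρ => Function.update_of_ne hρ _ _
  constructor
  · have h1 := h.toIsFilteredBasis.update σ (z := z) (Submodule.span_mono (by
      rintro _ ⟨ρ, ⟨h1, h2⟩, rfl⟩
      exact ⟨ρ, ⟨fun e => hσ (e ▸ h1), h2⟩, rfl⟩) hz)
    have h2 := h1.update τ (z := y) (Submodule.span_mono (by
      rintro _ ⟨ρ, ⟨h1, -, h2⟩, rfl⟩
      exact ⟨ρ, h2, Function.update_of_ne (ne_of_mem_of_not_mem h1 hσ) _ _⟩) hy)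
    rwa [Function.update_of_ne hne] at h2
  · intro ρ hρ
    rcases eq_or_ne ρ σ with rfl | hρσ
    · rw [Function.update_of_ne hne.symm, Function.update_self, Function.update_self, hb,
        Option.elim_some, Function.update_self]
    · have hρL : ρ ∈ L := (Set.mem_insert_iff.1 hρ).resolve_left hρσ
      rw [hup ρ hρσ]
      rcases eq_or_ne ρ τ with rfl | hρτ
      · rw [Function.update_self, hpτ, map_add, h.boundary_eq ρ hρL, hpτ]
        have : Submodule.span (ZMod 2)
            (a '' {π | π ∈ L ∧ p π = none ∧ π ≠ ρ ∧ X.dim π = X.dim ρ ∧ f.step π ≤ f.step ρ}) ≤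
            LinearMap.ker X.boundary := by
          rw [Submodule.span_le]
          rintro _ ⟨π, ⟨h1, h2, -⟩, rfl⟩
          change X.boundary (a π) = 0
          rw [h.boundary_eq π h1, h2]
          rfl
        rw [show X.boundary y = 0 from this hy]
        exact add_zero _
      · rw [Function.update_of_ne hρτ, Function.update_of_ne hρσ, h.boundary_eq ρ hρL]
        rcases e : p ρ with _ | π
        · rfl
        · rw [Option.elim_some, Option.elim_some, Function.update_of_ne, Function.update_of_ne]
          · exact ne_of_mem_of_not_mem (h.partner _ _ e).2.1 hσ
          · exact fun e' => hτp ρ (e' ▸ e)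
  · intro ρ π e
    rcases eq_or_ne ρ σ with rfl | hρσ
    · rw [Function.update_self, Option.some.injEq] at e
      subst e
      exact ⟨Or.inl rfl, Or.inr hτ, by rw [hup τ hne, hpτ], hd, hs⟩
    · rw [Function.update_of_ne hρσ] at e
      obtain ⟨h1, h2, h3, h4⟩ := h.partner ρ π e
      exact ⟨Or.inr h1, Or.inr h2,
        by rw [hup π (ne_of_mem_of_not_mem h2 hσ), h3], h4⟩
  · intro ρ₁ ρ₂ π e₁ e₂
    have key : ∀ ρ π, ρ ≠ σ → Function.update p σ (some τ) ρ = some π →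
        Function.update p σ (some τ) σ = some π → False := by
      intro ρ π hρ e e'
      rw [hup ρ hρ] at e
      rw [Function.update_self, Option.some.injEq] at e'
      exact hτp ρ (e' ▸ e)
    by_cases h1 : ρ₁ = σ <;> by_cases h2 : ρ₂ = σ
    · rw [h1, h2]
    · exact (key ρ₂ π h2 e₂ (h1 ▸ e₁)).elim
    · exact (key ρ₁ π h1 e₁ (h2 ▸ e₂)).elim
    · rw [hup _ h1] at e₁
      rw [hup _ h2] at e₂
      exact h.partner_inj _ _ _ e₁ e₂

/-- A cell whose proper faces, and whose predecessors of the same dimension, have been treated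
can be added. -/
theorem exists_insert (h : f.IsReducedBasis L a p) {σ : X.Cell} (hσ : σ ∉ L)
    (hlow : ∀ τ, X.dim τ < X.dim σ → τ ∈ L)
    (hsame : ∀ ρ ∈ L, X.dim ρ = X.dim σ → f.step ρ ≤ f.step σ) :
    ∃ a' p', f.IsReducedBasis (insert σ L) a' p' := by
  classical
  let T : Set X.Cell := {τ | X.dim τ + 1 = X.dim σ ∧ f.step τ ≤ f.step σ}
  have hTL : ∀ τ ∈ T, τ ∈ L := fun τ hτ => hlow τ (by have := hτ.1; omega)
  have hw : X.boundary (a σ) ∈ Submodule.span (ZMod 2) (a '' T) := by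
    refine h.toIsFilteredBasis.supported_le_span ?_
      (f.boundary_mem_supported (h.mem_supported σ))
    rintro c ⟨h1, h2⟩ τ h3 h4
    exact ⟨by rw [h3, h1], h4.trans h2⟩
  have hw0 : X.boundary (X.boundary (a σ)) = 0 := by
    have : X.boundary.comp X.boundary = 0 := by
      refine Finsupp.lhom_ext' fun c => LinearMap.ext_ring ?_
      simp only [LinearMap.comp_apply, Finsupp.lsingle_apply, CellData.boundary_single,
        LinearMap.zero_apply]
      exact X.bdry_bdry c
    exact LinearMap.congr_fun this _
  have hwZ := mem_span_cycles (A := Set.univ) (p := p)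
    ((linearIndepOn_univ_iff).2 h.toIsFilteredBasis.linearIndependent)
    (fun _ _ _ _ hn => absurd trivial hn) (fun τ hτ => h.boundary_eq τ (hTL τ hτ))
    h.partner_inj hw hw0
  -- The boundary of `a σ` is a combination of basis cycles: those in `T₁` already bound and can be
  -- cancelled by earlier columns, those in `T₂` are still unpaired.
  let T₁ : Set X.Cell := {τ | τ ∈ T ∧ ∃ ρ, p ρ = some τ}
  let T₂ : Set X.Cell := {τ | τ ∈ T ∧ p τ = none ∧ ∀ ρ, p ρ ≠ some τ}
  have hsub : {τ | τ ∈ T ∧ ∀ j, p τ = some j → j ∉ (Set.univ : Set X.Cell)} ⊆ T₁ ∪ T₂ := by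
    rintro τ ⟨hτ, hj⟩
    by_cases e : ∃ ρ, p ρ = some τ
    · exact Or.inl ⟨hτ, e⟩
    · push Not at e
      refine Or.inr ⟨hτ, ?_, e⟩
      rcases e' : p τ with _ | j
      · rfl
      · exact absurd trivial (hj j e')
  replace hwZ := Submodule.span_mono (Set.image_mono hsub) hwZ
  rw [Set.image_union, Submodule.span_union, Submodule.mem_sup] at hwZ
  obtain ⟨w₁, hw₁, w₂, hw₂, hw12⟩ := hwZ
  obtain ⟨z, hz, hzw⟩ : ∃ z ∈ Submodule.span (ZMod 2)
      (a '' {ρ | ρ ∈ L ∧ X.dim ρ = X.dim σ ∧ f.step ρ ≤ f.step σ}), X.boundary z = w₁ := by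
    have : Submodule.span (ZMod 2) (a '' T₁) ≤ (Submodule.span (ZMod 2)
        (a '' {ρ | ρ ∈ L ∧ X.dim ρ = X.dim σ ∧ f.step ρ ≤ f.step σ})).map X.boundary := by
      rw [Submodule.span_le]
      rintro _ ⟨τ, ⟨hτ, ρ, e⟩, rfl⟩
      obtain ⟨h1, h2, -, h4, -⟩ := h.partner ρ τ e
      have h5 : X.dim ρ = X.dim σ := h4.trans hτ.1
      exact ⟨a ρ, Submodule.subset_span ⟨ρ, ⟨h1, h5, hsame ρ h1 h5⟩, rfl⟩,
        by rw [h.boundary_eq ρ h1, e]; rfl⟩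
    exact this hw₁
  have hb : X.boundary (a σ + -z) = w₂ := by
    rw [map_add, map_neg, hzw, ← hw12]
    abel
  obtain ⟨l, hl, hlw⟩ := (Finsupp.mem_span_image_iff_linearCombination (ZMod 2)).1 hw₂
  rcases l.support.eq_empty_or_nonempty with h0 | hne
  · rw [Finsupp.support_eq_empty] at h0
    rw [← hlw, h0, map_zero] at hb
    exact ⟨_, _, h.insert_cycle hσ (Submodule.neg_mem _ hz) hb⟩
  -- The pivot is an index of latest entry, so that the remaining terms may be added to `a τ`
  -- without leaving the filtration level of `τ`.
  · obtain ⟨τ, hτ, hmax⟩ := l.support.exists_max_image f.step hne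
    obtain ⟨hτT, hpτ, hτp⟩ := hl hτ
    have hl1 : l τ = 1 := by
      have h1 := Finsupp.mem_support_iff.1 hτ
      generalize l τ = x at h1
      revert x
      decide
    refine ⟨_, _, h.insert_pair (y := Finsupp.linearCombination (ZMod 2) a (l.erase τ)) hσ
      (Submodule.neg_mem _ hz) (hTL τ hτT) hpτ hτp hτT.1.symm hτT.2 ?_ ?_⟩
    · refine (Finsupp.mem_span_image_iff_linearCombination (ZMod 2)).2 ⟨l.erase τ, ?_, rfl⟩
      intro ρ hρ
      rw [Finset.mem_coe, Finsupp.support_erase, Finset.mem_erase] at hρ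
      obtain ⟨hρT, hpρ, -⟩ := hl hρ.2
      have := hρT.1
      have := hτT.1
      exact ⟨hTL ρ hρT, hpρ, hρ.1, by omega, hmax ρ hρ.2⟩
    · rw [hb, ← hlw]
      conv_lhs => rw [← Finsupp.single_add_erase τ l, map_add]
      rw [Finsupp.linearCombination_single, hl1, one_smul]

end IsReducedBasis

/-- The cells are treated in lexicographic order of dimension and step, ties being broken
arbitrarily. When `σ` is added, all cells of lower dimension are done, and the treated cells of its
own dimension entered no later, so they may be added to its column. -/
theorem exists_isReducedBasis : ∃ a p, f.IsReducedBasis Set.univ a p := by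
  classical
  have := X.finite_cell
  have := Fintype.ofFinite X.Cell
  let key : X.Cell → ℕ ×ₗ ℕ := fun c => toLex (X.dim c, f.step c)
  have main : ∀ s : Finset X.Cell, (∀ x ∈ s, ∀ y, key y < key x → y ∈ s) →
      ∃ a p, f.IsReducedBasis (s : Set X.Cell) a p := by
    intro s
    refine Finset.induction_on_max_value key s (fun _ => ?_) (fun σ s hσ hmax ih hcl => ?_)
    · exact ⟨_, fun _ => none, f.isFilteredBasis_single, by simp, by simp, by simp⟩
    · obtain ⟨a, p, h⟩ := ih (fun x hx y hy => by
        refine (Finset.mem_insert.1 (hcl x (Finset.mem_insert_of_mem hx) y hy)).resolve_left ?_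
        rintro rfl
        exact absurd (hmax x hx) (not_le.2 hy))
      rw [Finset.coe_insert]
      refine h.exists_insert (by exact_mod_cast hσ) (fun τ hτ => ?_) (fun ρ hρ hd => ?_)
      · have hlt : key τ < key σ := Prod.Lex.toLex_lt_toLex.2 (Or.inl hτ)
        have := hcl σ (Finset.mem_insert_self _ _) τ hlt
        exact (Finset.mem_insert.1 this).resolve_left (fun e => by subst e; exact lt_irrefl _ hτ)
      · rcases Prod.Lex.toLex_le_toLex.1 (hmax ρ hρ) with h1 | h1
        · exact absurd hd h1.ne
        · exact h1.2
  have := main Finset.univ (fun _ _ _ _ => Finset.mem_univ _)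
  rwa [Finset.coe_univ] at this

end Filtration

/-! ### Restriction to the levels, and the forward diagram -/

namespace Filtration

variable {X : CellComplex.{u}} (f : Filtration X)

section Steps

theorem one_le_step (c : X.Cell) : 1 ≤ f.step c := by
  have := X.finite_cell
  rw [Nat.one_le_iff_ne_zero]
  refine Set.ncard_ne_zero_of_mem (a := f.val c) ⟨⟨c, rfl⟩, le_rfl⟩ ?_
  exact (Set.finite_range f.val).subset (fun a ha => ha.1)

theorem step_le_steps (c : X.Cell) : f.step c ≤ f.steps := by
  have := X.finite_cell
  exact Set.ncard_le_ncard (fun a ha => ha.1) (Set.finite_range f.val)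

theorem one_le_steps (c : X.Cell) : 1 ≤ f.steps := (f.one_le_step c).trans (f.step_le_steps c)

/-- The closure of `X_j \ X_{j-1}` stays inside `X_j`, and every cell lies in the intermediate
complex of its own step. So the contraction stages are quotients by the levels themselves. -/
theorem contracted_carrier (i : ℕ) : (f.contracted i).carrier = {c | f.step c ≤ i} := by
  ext c
  constructor
  · rintro ⟨j, -, hj, σ, rfl, rfl | h⟩
    · exact hj
    · exact (f.step_mono h).trans hj
  · intro h
    exact ⟨f.step c, f.one_le_step c, h, c, rfl, Or.inl rfl⟩

/-- A cell of minimal value has step 1, and a vertex of it cannot enter later. -/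
theorem exists_vertex_step_eq_one (c : X.Cell) : ∃ v, X.dim v = 0 ∧ f.step v = 1 := by
  have := X.finite_cell
  have : Nonempty X.Cell := ⟨c⟩
  obtain ⟨m, hm⟩ := Finite.exists_min f.val
  have hm1 : f.step m = 1 := by
    refine Set.ncard_eq_one.2 ⟨f.val m, ?_⟩
    ext x
    constructor
    · rintro ⟨⟨y, rfl⟩, hy⟩
      exact le_antisymm hy (hm y)
    · rintro rfl
      exact ⟨⟨m, rfl⟩, le_rfl⟩
  by_cases h0 : X.dim m = 0
  · exact ⟨m, h0, hm1⟩
  · obtain ⟨v, hv, hv0⟩ := X.exists_vertex m h0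
    exact ⟨v, hv0, le_antisymm ((f.step_mono hv).trans hm1.le) (f.one_le_step v)⟩

end Steps

section Restrict

theorem pushChain_subtypeDomain (K : Subcomplex X) {z : X.Cell →₀ ZMod 2}
    (hz : z ∈ Finsupp.supported (ZMod 2) (ZMod 2) K.carrier) :
    pushChain (fun c : K.carrier => X.dim c) X.dim (fun c => (c : X.Cell))
      (Finsupp.subtypeDomain (fun c => c ∈ K.carrier) z) = z := by
  have hlin : pushChain (fun c : K.carrier => X.dim c) X.dim (fun c => (c : X.Cell)) =
      Finsupp.lmapDomain (ZMod 2) (ZMod 2) (fun c : K.carrier => (c : X.Cell)) := by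
    refine Finsupp.lhom_ext' fun c => LinearMap.ext_ring ?_
    simp [pushChain_single]
  rw [hlin]
  ext τ
  by_cases hτ : τ ∈ K.carrier
  · have := Finsupp.mapDomain_apply (f := fun c : K.carrier => (c : X.Cell))
      Subtype.val_injective (Finsupp.subtypeDomain (fun c => c ∈ K.carrier) z) ⟨τ, hτ⟩
    simpa using this
  · have h0 : z τ = 0 := by
      by_contra hne
      exact hτ (hz (Finsupp.mem_support_iff.2 hne))
    rw [h0]
    refine Finsupp.mapDomain_of_notMem_range _ _ ?_
    rintro ⟨c, rfl⟩
    exact hτ c.2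

theorem pushChain_val_mem_supported (K : Subcomplex X) (z : K.carrier →₀ ZMod 2) :
    pushChain (fun c : K.carrier => X.dim c) X.dim (fun c => (c : X.Cell)) z ∈
      Finsupp.supported (ZMod 2) (ZMod 2) K.carrier := by
  intro c hc
  obtain ⟨c', -, rfl, -⟩ := mem_support_pushChain hc
  exact c'.2

/-- The restriction of the basis chains to a level. -/
noncomputable def restrict (a : X.Cell → X.Cell →₀ ZMod 2) (t : ℕ) (i : X.Cell) :
    (f.level t).carrier →₀ ZMod 2 :=
  Finsupp.subtypeDomain (fun c => c ∈ (f.level t).carrier) (a i)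

variable {f} {a : X.Cell → X.Cell →₀ ZMod 2} {p : X.Cell → Option X.Cell}

theorem IsFilteredBasis.push_restrict (ha : f.IsFilteredBasis a) {t : ℕ} {i : X.Cell}
    (hi : f.step i ≤ t) :
    pushChain (fun c : (f.level t).carrier => X.dim c) X.dim (fun c => (c : X.Cell))
      (f.restrict a t i) = a i :=
  pushChain_subtypeDomain _ (Finsupp.supported_mono (fun _ hc => hc.2.trans hi)
    (ha.mem_supported i))

theorem IsFilteredBasis.restrict_linearIndepOn (ha : f.IsFilteredBasis a) (t : ℕ) :
    LinearIndepOn (ZMod 2) (f.restrict a t) {i | f.step i ≤ t} := by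
  refine LinearIndependent.of_comp
    (pushChain (fun c : (f.level t).carrier => X.dim c) X.dim (fun c => (c : X.Cell))) ?_
  convert ha.linearIndependent.comp (fun i : {i | f.step i ≤ t} => i.1) Subtype.val_injective
    using 1
  funext i
  exact ha.push_restrict i.2

theorem IsFilteredBasis.restrict_span (ha : f.IsFilteredBasis a) (t : ℕ) :
    ⊤ ≤ Submodule.span (ZMod 2) (f.restrict a t '' {i | f.step i ≤ t}) := by
  intro z _
  have h1 := ha.supported_le_span (s := {i | f.step i ≤ t}) (fun c hc σ _ h => h.trans hc)
    (pushChain_val_mem_supported (f.level t) z)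
  have h2 : a '' {i | f.step i ≤ t} =
      pushChain (fun c : (f.level t).carrier => X.dim c) X.dim (fun c => (c : X.Cell)) ''
        (f.restrict a t '' {i | f.step i ≤ t}) := by
    rw [Set.image_image]
    exact Set.image_congr fun i hi => (ha.push_restrict hi).symm
  rw [h2, ← Submodule.map_span] at h1
  obtain ⟨y, hy, e⟩ := h1
  rwa [← pushChain_val_injective _ e]

theorem IsFilteredBasis.restrict_mem_chains (ha : f.IsFilteredBasis a) (t : ℕ) (i : X.Cell) :
    f.restrict a t i ∈ (X.sub (f.level t)).chains (X.dim i) := by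
  change f.restrict a t i ∈ Finsupp.supported (ZMod 2) (ZMod 2)
    {c : (f.level t).carrier | X.dim c = X.dim i}
  intro c hc
  have h0 : f.restrict a t i c ≠ 0 := Finsupp.mem_support_iff.1 hc
  have hc' : (c.1 : X.Cell) ∈ (a i).support := Finsupp.mem_support_iff.2 h0
  exact (ha.mem_supported i hc').1

theorem IsReducedBasis.restrict_boundary (h : f.IsReducedBasis Set.univ a p) {t : ℕ} {i : X.Cell}
    (hi : f.step i ≤ t) : (X.sub (f.level t)).boundary (f.restrict a t i) =
      (p i).elim 0 (f.restrict a t) := by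
  apply pushChain_val_injective (f.level t)
  refine (subData_push_boundary (f.level t) _).trans ?_
  rw [h.push_restrict hi, h.boundary_eq i trivial]
  rcases e : p i with _ | j
  · exact (map_zero _).symm
  · exact (h.push_restrict ((h.partner i j e).2.2.2.2.trans hi)).symm

theorem IsFilteredBasis.push_inclusion_restrict (ha : f.IsFilteredBasis a) {s t : ℕ} (h : s ≤ t)
    {i : X.Cell} (hi : f.step i ≤ s) :
    pushChain (X.sub (f.level s)).dim (X.sub (f.level t)).dim
      (subInclusion (K := f.level s) (L := f.level t) (fun _ hc => le_trans hc h)).toFun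
      (f.restrict a s i) = f.restrict a t i := by
  apply pushChain_val_injective (f.level t)
  rw [ha.push_restrict (hi.trans h), ← ha.push_restrict hi]
  exact (LinearMap.congr_fun (pushChain_comp (fun c : (f.level s).carrier => X.dim c)
    (fun c : (f.level t).carrier => X.dim c) X.dim
    (fun c => (⟨c.1, le_trans c.2 h⟩ : (f.level t).carrier)) (fun c => (c : X.Cell))
    (fun _ => le_rfl) (fun _ => le_rfl)) _).symm

end Restrict

section Forward

variable {f} {a : X.Cell → X.Cell →₀ ZMod 2} {p : X.Cell → Option X.Cell}

open Classical in
/-- The forward diagram, in terms of a reduced basis. -/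
theorem IsReducedBasis.isDiagram_forward [Fintype X.Cell] (h : f.IsReducedBasis Set.univ a p)
    (k : ℕ) (lo hi : X.Cell → ℕ∞)
    (hlo : ∀ i (t : ℕ), lo i ≤ t ↔ f.step i ≤ t ∧ p i = none)
    (hhi : ∀ i (t : ℕ), (t : ℕ∞) < hi i ↔ ∀ j, p j = some i → t < f.step j) :
    (f.forward k).IsDiagram
      ((Finset.univ.filter (fun i => X.dim i = k ∧ lo i < hi i)).val.map
        (fun i => ((lo i).toNat, hi i))) := by
  -- In the filtration no chain ever disappears, so every end time is `⊤`. In particular a cell with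
  -- a partner never becomes a cycle.
  have hact : ∀ t : ℕ, {i | f.step i ≤ t ∧ (t : ℕ∞) < ⊤} = {i | f.step i ≤ t} := by
    intro t
    ext i
    exact and_iff_left (ENat.natCast_lt_top t)
  refine isDiagram_of_basis (Y := fun t => X.sub (f.level t)) (fun h =>
    subInclusion (fun _ hc => le_trans hc h)) k (fun _ => homologyMap_eq_id _ (fun _ => rfl) k)
    (fun _ _ => homologyMap_eq_comp _ _ _ (fun _ => rfl) k) X.dim f.step (fun _ => ⊤) p
    (fun t => f.restrict a t) (fun t => ?_) (fun t => ?_) (fun t i _ hc => ?_)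
    (fun t i _ => h.restrict_mem_chains t i) (fun t i hi => h.restrict_boundary hi)
    (fun hst i hi => h.push_inclusion_restrict hst hi) (fun i j e => ?_) h.partner_inj
    lo hi (fun i t => ?_) (fun i t => ?_)
  · rw [hact]
    exact h.restrict_linearIndepOn t
  · rw [hact]
    exact h.restrict_span t
  · exact absurd hc (not_le.2 (ENat.natCast_lt_top t))
  · obtain ⟨-, -, -, h1, h2⟩ := h.partner i j e
    exact ⟨h1, h2, le_rfl⟩
  · rw [hlo]
    refine and_congr_right fun _ => ⟨fun e j e' => ?_, fun hj => ?_⟩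
    · rw [e] at e'
      cases e'
    · rcases e : p i with _ | j
      · rfl
      · exact absurd (hj j e) (not_le.2 (ENat.natCast_lt_top t))
  · rw [hhi]
    exact (and_iff_right (ENat.natCast_lt_top t)).symm

end Forward

/-! ### The root: parity of the basis chains in dimension zero -/

section Root

/-- A vertex born in the first step, the component of which is never merged into another one,
together with a choice of the other basis chains in dimension zero that have an even number
of vertices. -/
structure IsRoot (a : X.Cell → X.Cell →₀ ZMod 2) (p : X.Cell → Option X.Cell) (r : X.Cell) :
    Prop where
  dim_eq : X.dim r = 0
  step_eq : f.step r = 1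
  not_partner : ∀ σ, p σ ≠ some r
  aug_root : augmentation X.Cell (a r) = 1
  aug_of_ne : ∀ i, X.dim i = 0 → i ≠ r → augmentation X.Cell (a i) = 0

theorem augmentation_boundary {z : X.Cell →₀ ZMod 2} (hz : z ∈ X.chains 1) :
    augmentation X.Cell (X.boundary z) = 0 := by
  rw [CellData.boundary, Finsupp.linearCombination_apply, Finsupp.sum, map_sum]
  refine Finset.sum_eq_zero fun c hc => ?_
  rw [map_smul, X.aug_bdry c (hz hc), smul_zero]

variable {f} {a : X.Cell → X.Cell →₀ ZMod 2} {p : X.Cell → Option X.Cell}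

theorem IsReducedBasis.aug_partner (h : f.IsReducedBasis Set.univ a p) {σ τ : X.Cell}
    (e : p σ = some τ) (hτ : X.dim τ = 0) : augmentation X.Cell (a τ) = 0 := by
  have h1 := h.boundary_eq σ trivial
  rw [e, Option.elim_some] at h1
  rw [← h1]
  refine augmentation_boundary fun c hc => ?_
  have h2 := (h.mem_supported σ hc).1
  have h3 := (h.partner σ τ e).2.2.2.1
  change X.dim c = 1
  omega

theorem IsReducedBasis.partner_eq_none (h : f.IsReducedBasis Set.univ a p) {i : X.Cell}
    (hi : X.dim i = 0) : p i = none := by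
  rcases e : p i with _ | j
  · rfl
  · have := (h.partner i j e).2.2.2.1
    omega

/-- Vertices are odd, so some basis 0-chain of step 1 is odd; its index is the root. Boundaries of
1-chains are even, so the root is nobody's partner. Adding `a r` to the other odd 0-chains makes
them even; chains that are partners are even already and do not change, so the boundary rule
survives. -/
theorem IsReducedBasis.exists_root (h : f.IsReducedBasis Set.univ a p) (c : X.Cell) :
    ∃ a' r, f.IsReducedBasis Set.univ a' p ∧ f.IsRoot a' p r := by
  classical
  obtain ⟨v, hv0, hv1⟩ := f.exists_vertex_step_eq_one c
  obtain ⟨r, hr0, hr1, hra⟩ : ∃ r, X.dim r = 0 ∧ f.step r = 1 ∧ augmentation X.Cell (a r) = 1 := by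
    by_contra hne
    have hker : Submodule.span (ZMod 2) (a '' {σ | X.dim σ = X.dim v ∧ f.step σ ≤ f.step v}) ≤
        LinearMap.ker (augmentation X.Cell) := by
      rw [Submodule.span_le]
      rintro _ ⟨r, ⟨h1, h2⟩, rfl⟩
      change augmentation X.Cell (a r) = 0
      by_contra h3
      refine hne ⟨r, h1.trans hv0, le_antisymm (h2.trans hv1.le) (f.one_le_step r), ?_⟩
      generalize augmentation X.Cell (a r) = x at h3
      revert x
      decide
    have := hker (h.single_mem_span v)
    have h1 : augmentation X.Cell (Finsupp.single v 1) = 0 := this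
    rw [augmentation, Finsupp.linearCombination_single, one_smul] at h1
    exact one_ne_zero h1
  have hrp : ∀ σ, p σ ≠ some r := by
    intro σ e
    rw [h.aug_partner e hr0] at hra
    exact zero_ne_one hra
  let a' : X.Cell → X.Cell →₀ ZMod 2 := fun i =>
    if i ≠ r ∧ X.dim i = 0 then a i + augmentation X.Cell (a i) • a r else a i
  have hr' : a' r = a r := if_neg (fun h => h.1 rfl)
  have h1 : ∀ i, i ≠ r → X.dim i = 0 → a' i = a i + augmentation X.Cell (a i) • a r :=
    fun i hi hd => if_pos ⟨hi, hd⟩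
  have h2 : ∀ i, X.dim i ≠ 0 → a' i = a i := fun i hd => if_neg (fun h => hd h.2)
  have h3 : ∀ σ τ, p σ = some τ → a' τ = a τ := by
    intro σ τ e
    by_cases hd : X.dim τ = 0
    · rw [h1 τ (fun e' => hrp σ (e' ▸ e)) hd, h.aug_partner e hd, zero_smul, add_zero]
    · exact h2 τ hd
  refine ⟨a', r, ⟨⟨fun σ => ?_, fun c => ?_⟩, fun σ _ => ?_, h.partner, h.partner_inj⟩,
    hr0, hr1, hrp, by rw [hr', hra], fun i hd hi => ?_⟩
  · by_cases hσ : σ ≠ r ∧ X.dim σ = 0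
    · rw [h1 σ hσ.1 hσ.2]
      refine Submodule.add_mem _ (h.mem_supported σ) (Submodule.smul_mem _ _ ?_)
      refine Finsupp.supported_mono ?_ (h.mem_supported r)
      rintro c ⟨h4, h5⟩
      exact ⟨by rw [h4, hr0, hσ.2], h5.trans (hr1.le.trans (f.one_le_step σ))⟩
    · rw [show a' σ = a σ from if_neg hσ]
      exact h.mem_supported σ
  · refine (Submodule.span_le.2 ?_) (h.single_mem_span c)
    rintro _ ⟨σ, hσ, rfl⟩
    have hmem : a' σ ∈ Submodule.span (ZMod 2)
        (a' '' {σ | X.dim σ = X.dim c ∧ f.step σ ≤ f.step c}) :=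
      Submodule.subset_span ⟨σ, hσ, rfl⟩
    by_cases hσ' : σ ≠ r ∧ X.dim σ = 0
    · rw [h1 σ hσ'.1 hσ'.2] at hmem
      refine (Submodule.add_mem_iff_left _ (Submodule.smul_mem _ _ ?_)).1 hmem
      refine Submodule.subset_span ⟨r, ⟨?_, hr1.le.trans (f.one_le_step c)⟩, hr'⟩
      rw [hr0, ← hσ.1, hσ'.2]
    · rwa [show a' σ = a σ from if_neg hσ'] at hmem
  · rcases e : p σ with _ | τ
    · have h4 : ∀ i, p i = none → X.boundary (a i) = 0 := by
        intro i hi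
        rw [h.boundary_eq i trivial, hi]
        rfl
      by_cases hσ' : σ ≠ r ∧ X.dim σ = 0
      · rw [h1 σ hσ'.1 hσ'.2, map_add, map_smul, h4 σ e, h4 r (h.partner_eq_none hr0), smul_zero,
          add_zero]
        rfl
      · rw [show a' σ = a σ from if_neg hσ', h4 σ e]
        rfl
    · have hd : X.dim σ ≠ 0 := by
        have := (h.partner σ τ e).2.2.2.1
        omega
      rw [h2 σ hd, h.boundary_eq σ trivial, e, Option.elim_some, Option.elim_some, h3 σ τ e]
  · rw [h1 i hi hd, map_add, map_smul, hra, smul_eq_mul, mul_one]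
    exact CharTwo.add_self_eq_zero _

end Root

end Filtration

/-! ### Contraction of the basis chains, and the FB diagram -/

section Quotients

variable {Y : CellComplex.{u}} (A : Subcomplex Y)

/-- The projection is onto on chains: a nonempty subcomplex contains a vertex, and this vertex maps
to the contracted point. -/
theorem pushChain_mk_span {s : Set (Y.Cell →₀ ZMod 2)} (hs : ⊤ ≤ Submodule.span (ZMod 2) s) :
    ⊤ ≤ Submodule.span (ZMod 2)
      (pushChain Y.dim A.quotDim (Quotient.mk A.collapse) '' s) := by
  rw [← Submodule.map_span, top_le_iff.1 hs, ← Finsupp.supported_univ,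
    Finsupp.supported_eq_span_single, Submodule.span_le]
  rintro _ ⟨x, -, rfl⟩
  obtain ⟨σ, rfl⟩ := Quotient.exists_rep x
  have key : ∀ τ, A.quotDim (Quotient.mk A.collapse τ) = Y.dim τ →
      Quotient.mk A.collapse τ = Quotient.mk A.collapse σ →
      Finsupp.single (Quotient.mk A.collapse σ) (1 : ZMod 2) ∈
        (⊤ : Submodule (ZMod 2) (Y.Cell →₀ ZMod 2)).map
          (pushChain Y.dim A.quotDim (Quotient.mk A.collapse)) := fun τ h e =>
    ⟨Finsupp.single τ 1, trivial, by rw [pushChain_single, if_pos h, e]⟩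
  by_cases hσ : σ ∈ A.carrier
  · by_cases h0 : Y.dim σ = 0
    · exact key σ (by rw [A.quotDim_of_mem hσ, h0]) rfl
    · obtain ⟨τ, hτ, hτ0⟩ := Y.exists_vertex σ h0
      have hτA := A.closed τ σ hτ hσ
      exact key τ (by rw [A.quotDim_of_mem hτA, hτ0]) (Quotient.sound (Or.inr ⟨hτA, hσ⟩))
  · exact key σ (A.quotDim_of_notMem hσ) rfl

theorem pushChain_mk_mem_chains {k : ℕ} {z : Y.Cell →₀ ZMod 2} (hz : z ∈ Y.chains k) :
    pushChain Y.dim A.quotDim (Quotient.mk A.collapse) z ∈ (Y.quot A).chains k := by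
  intro y hy
  obtain ⟨c, hc, rfl, hd⟩ := mem_support_pushChain hy
  exact hd.trans (hz hc)

/-- Cells of `A` of positive dimension are collapsed, while a 0-chain in `A` becomes its
augmentation times the contracted vertex. -/
theorem pushChain_mk_eq_zero {k : ℕ} {z : Y.Cell →₀ ZMod 2} (hz : z ∈ Y.chains k)
    (hA : ∀ c ∈ z.support, c ∈ A.carrier) (h0 : k = 0 → augmentation Y.Cell z = 0) :
    pushChain Y.dim A.quotDim (Quotient.mk A.collapse) z = 0 := by
  rw [pushChain_eq_sum, Finsupp.sum]
  rcases z.support.eq_empty_or_nonempty with he | ⟨σ, hσ⟩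
  · rw [he, Finset.sum_empty]
  by_cases hk : k = 0
  · have h1 : ∀ c ∈ z.support,
        (z c • if A.quotDim (Quotient.mk A.collapse c) = Y.dim c then
          Finsupp.single (Quotient.mk A.collapse c) (1 : ZMod 2) else 0) =
        (z c • (1 : ZMod 2)) • Finsupp.single (Quotient.mk A.collapse σ) (1 : ZMod 2) := by
      intro c hc
      have hc0 : Y.dim c = 0 := (hz hc).trans hk
      have e : Quotient.mk A.collapse c = Quotient.mk A.collapse σ :=
        Quotient.sound (Or.inr ⟨hA c hc, hA σ hσ⟩)
      rw [A.quotDim_of_mem (hA c hc), if_pos hc0.symm, e, smul_assoc, one_smul]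
    rw [Finset.sum_congr rfl h1, ← Finset.sum_smul]
    have h2 := h0 hk
    rw [augmentation, Finsupp.linearCombination_apply, Finsupp.sum] at h2
    rw [h2, zero_smul]
  · refine Finset.sum_eq_zero fun c hc => ?_
    have hck : Y.dim c = k := hz hc
    rw [A.quotDim_of_mem (hA c hc), if_neg (by omega), smul_zero]

end Quotients

theorem linearIndepOn_of_span_of_bijective {ι : Type v} {C : Type u} [Finite C]
    {γ : ι → C →₀ ZMod 2} {S : Set ι} (hsp : ⊤ ≤ Submodule.span (ZMod 2) (γ '' S))
    (g : S → C) (hg : Function.Bijective g) : LinearIndepOn (ZMod 2) γ S := by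
  have := Fintype.ofFinite C
  have : Fintype S := Fintype.ofBijective _ (Equiv.ofBijective g hg).symm.bijective
  refine linearIndependent_of_top_le_span_of_card_eq_finrank ?_ ?_
  · rwa [Set.image_eq_range] at hsp
  · rw [Module.finrank_finsupp_self]
    exact Fintype.card_of_bijective hg

namespace Filtration

variable {X : CellComplex.{u}} (f : Filtration X)

open Classical in
/-- The time at which the basis chain of a cell becomes zero in the contraction steps. -/
noncomputable def contractTime (r i : X.Cell) : ℕ∞ :=
  if i = r then ⊤ else ((f.steps + f.step i : ℕ) : ℕ∞)

theorem contractTime_root (r : X.Cell) : f.contractTime r r = ⊤ := if_pos rfl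

theorem contractTime_of_ne {r i : X.Cell} (h : i ≠ r) :
    f.contractTime r i = ((f.steps + f.step i : ℕ) : ℕ∞) := if_neg h

theorem mem_fbContracted {t : ℕ} {c : (X.sub (f.level t)).Cell} :
    c ∈ (fbContracted f f t).carrier ↔ f.step c.1 ≤ t - f.steps := by
  change c.1 ∈ (f.contracted (t - f.steps)).carrier ↔ _
  rw [contracted_carrier]
  rfl

/-- The images of the basis chains in the complexes of FB persistence. -/
noncomputable def collapsed (a : X.Cell → X.Cell →₀ ZMod 2) (t : ℕ) (i : X.Cell) :
    (fbStage f f t).Cell →₀ ZMod 2 :=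
  pushChain (X.sub (f.level t)).dim (fbContracted f f t).quotDim
    (Quotient.mk (fbContracted f f t).collapse) (f.restrict a t i)

variable {f} {a : X.Cell → X.Cell →₀ ZMod 2} {p : X.Cell → Option X.Cell} {r : X.Cell}

/-- At time `n + step i` the whole support of `a i` is contracted. In dimension zero this kills `a
i` only because every chain but that of the root is even. -/
theorem IsReducedBasis.collapsed_eq_zero (h : f.IsReducedBasis Set.univ a p)
    (hr : f.IsRoot a p r) {t : ℕ} {i : X.Cell} (hi : f.step i ≤ t)
    (hc : f.contractTime r i ≤ t) : f.collapsed a t i = 0 := by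
  have hne : i ≠ r := by
    rintro rfl
    rw [contractTime_root] at hc
    exact absurd hc (not_le.2 (ENat.natCast_lt_top t))
  rw [contractTime_of_ne f hne] at hc
  have hc' : f.steps + f.step i ≤ t := by exact_mod_cast hc
  refine pushChain_mk_eq_zero _ (h.restrict_mem_chains t i) (fun c hcs => ?_) (fun h0 => ?_)
  · have h0 : f.restrict a t i c ≠ 0 := Finsupp.mem_support_iff.1 hcs
    have h1 : (c.1 : X.Cell) ∈ (a i).support := Finsupp.mem_support_iff.2 h0
    have h2 := (h.mem_supported i h1).2
    rw [mem_fbContracted]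
    omega
  · rw [← hr.aug_of_ne i h0 hne, ← h.push_restrict hi]
    exact (augmentation_pushChain (fun _ _ => rfl)).symm

theorem IsFilteredBasis.collapsed_span_level (ha : f.IsFilteredBasis a) (t : ℕ) :
    ⊤ ≤ Submodule.span (ZMod 2) (f.collapsed a t '' {i | f.step i ≤ t}) := by
  have h1 := pushChain_mk_span (fbContracted f f t) (ha.restrict_span t)
  erw [Set.image_image] at h1
  exact h1

theorem IsReducedBasis.collapsed_span (h : f.IsReducedBasis Set.univ a p)
    (hr : f.IsRoot a p r) (t : ℕ) : ⊤ ≤ Submodule.span (ZMod 2)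
      (f.collapsed a t '' {i | f.step i ≤ t ∧ (t : ℕ∞) < f.contractTime r i}) := by
  refine (h.collapsed_span_level t).trans (Submodule.span_le.2 ?_)
  rintro _ ⟨i, hi, rfl⟩
  by_cases hc : f.contractTime r i ≤ t
  · rw [SetLike.mem_coe, h.collapsed_eq_zero hr hi hc]
    exact Submodule.zero_mem _
  · exact Submodule.subset_span ⟨i, ⟨hi, not_le.1 hc⟩, rfl⟩

/-- A dimension count: the remaining chains span, and their indices correspond bijectively to the
cells of the quotient, with the root standing for the contracted vertex. -/
theorem IsReducedBasis.collapsed_linearIndepOn (h : f.IsReducedBasis Set.univ a p)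
    (hr : f.IsRoot a p r) (t : ℕ) : LinearIndepOn (ZMod 2) (f.collapsed a t)
      {i | f.step i ≤ t ∧ (t : ℕ∞) < f.contractTime r i} := by
  have := (fbStage f f t).finite_cell
  -- With truncated subtraction `t - n` is `0` throughout the filtration; as steps start at 1,
  -- nothing is contracted then.
  have key : ∀ i, i ≠ r → (t : ℕ∞) < f.contractTime r i → ¬ f.step i ≤ t - f.steps := by
    intro i hi hlt hle
    rw [contractTime_of_ne f hi] at hlt
    have h1 : t < f.steps + f.step i := by exact_mod_cast hlt
    have h2 := f.one_le_step i
    omega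
  refine linearIndepOn_of_span_of_bijective (h.collapsed_span hr t)
    (fun i => Quotient.mk (fbContracted f f t).collapse ⟨i.1, i.2.1⟩) ⟨fun i j hij => ?_, fun x => ?_⟩
  · rcases Quotient.exact hij with e | ⟨h1, h2⟩
    · exact Subtype.ext (congrArg (fun c => c.1) e)
    · replace h1 := (mem_fbContracted f).1 h1
      replace h2 := (mem_fbContracted f).1 h2
      have hi : i.1 = r := by
        by_contra hne
        exact key i.1 hne i.2.2 h1
      have hj : j.1 = r := by
        by_contra hne
        exact key j.1 hne j.2.2 h2
      exact Subtype.ext (hi.trans hj.symm)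
  · refine Quotient.inductionOn x fun c => ?_
    by_cases hc : f.step c.1 ≤ t - f.steps
    -- The root enters at step 1, so it is contracted as soon as any cell is.
    · have hr1 : f.step r ≤ t - f.steps := hr.step_eq.le.trans ((f.one_le_step c.1).trans hc)
      refine ⟨⟨r, hr1.trans (Nat.sub_le _ _), ?_⟩, Quotient.sound (Or.inr ⟨?_, ?_⟩)⟩
      · rw [contractTime_root]
        exact ENat.natCast_lt_top t
      · exact (mem_fbContracted f).2 hr1
      · exact (mem_fbContracted f).2 hc
    · refine ⟨⟨c.1, c.2, ?_⟩, rfl⟩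
      by_cases hcr : c.1 = r
      · rw [hcr, contractTime_root]
        exact ENat.natCast_lt_top t
      · rw [contractTime_of_ne f hcr]
        exact_mod_cast (by omega : t < f.steps + f.step c.1)

theorem IsReducedBasis.collapsed_boundary (h : f.IsReducedBasis Set.univ a p) {t : ℕ}
    {i : X.Cell} (hi : f.step i ≤ t) :
    (fbStage f f t).boundary (f.collapsed a t i) = (p i).elim 0 (f.collapsed a t) := by
  refine (quot_push_boundary (fbContracted f f t) _).symm.trans ?_
  rw [h.restrict_boundary hi]
  rcases e : p i with _ | j
  · exact map_zero _
  · rfl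

theorem IsFilteredBasis.push_fbMap_collapsed (ha : f.IsFilteredBasis a) {s t : ℕ} (hst : s ≤ t)
    {i : X.Cell} (hi : f.step i ≤ s) :
    pushChain (fbStage f f s).dim (fbStage f f t).dim (fbMap f f hst).toFun
      (f.collapsed a s i) = f.collapsed a t i := by
  refine (LinearMap.congr_fun (pushChain_comp (X.sub (f.level s)).dim (fbStage f f s).dim
    (fbStage f f t).dim (Quotient.mk (fbContracted f f s).collapse) (fbMap f f hst).toFun
    (fbContracted f f s).quotDim_le (fbMap f f hst).dim_le) _).symm.trans ?_
  refine Eq.trans ?_ (congrArg (pushChain (X.sub (f.level t)).dim (fbStage f f t).dim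
    (Quotient.mk (fbContracted f f t).collapse)) (ha.push_inclusion_restrict hst hi))
  exact LinearMap.congr_fun (pushChain_comp (X.sub (f.level s)).dim (X.sub (f.level t)).dim
    (fbStage f f t).dim _ (Quotient.mk (fbContracted f f t).collapse)
    (subInclusion (K := f.level s) (L := f.level t) (fun _ hc => le_trans hc hst)).dim_le
    (fbContracted f f t).quotDim_le) _

open Classical in
/-- The FB diagram, in terms of a reduced basis with a root. -/
theorem IsReducedBasis.isDiagram_fb [Fintype X.Cell] (h : f.IsReducedBasis Set.univ a p)
    (hr : f.IsRoot a p r) (k : ℕ) (lo hi : X.Cell → ℕ∞)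
    (hlo : ∀ i (t : ℕ), lo i ≤ t ↔
      f.step i ≤ t ∧ ∀ j, p i = some j → f.contractTime r j ≤ t)
    (hhi : ∀ i (t : ℕ), (t : ℕ∞) < hi i ↔
      t < f.contractTime r i ∧ ∀ j, p j = some i → t < f.step j) :
    (fb f f k).IsDiagram
      ((Finset.univ.filter (fun i => X.dim i = k ∧ lo i < hi i)).val.map
        (fun i => ((lo i).toNat, hi i))) := by
  refine isDiagram_of_basis (Y := fbStage f f) (fun h => fbMap f f h) k
    (fb f f k).map_refl (fb f f k).map_trans X.dim f.step (f.contractTime r) p (fun t => f.collapsed a t)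
    (h.collapsed_linearIndepOn hr) (h.collapsed_span hr)
    (fun t i hi hc => h.collapsed_eq_zero hr hi hc)
    (fun t i _ => pushChain_mk_mem_chains _ (h.restrict_mem_chains t i))
    (fun t i hi => h.collapsed_boundary hi)
    (fun hst i hi => h.push_fbMap_collapsed hst hi) (fun i j e => ?_) h.partner_inj
    lo hi hlo hhi
  -- A partner must be contracted no later than the chain it bounds. Neither of them is the root,
  -- which is an unpaired vertex.
  obtain ⟨-, -, -, h1, h2⟩ := h.partner i j e
  refine ⟨h1, h2, ?_⟩
  have hi : i ≠ r := by
    rintro rfl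
    have := hr.dim_eq
    omega
  have hj : j ≠ r := by
    rintro rfl
    exact hr.not_partner i e
  rw [contractTime_of_ne f hi, contractTime_of_ne f hj]
  exact_mod_cast (by omega : f.steps + f.step j ≤ f.steps + f.step i)

end Filtration

/-! ### Barcodes: the two diagrams in terms of pairs of cells -/

section Copartner

variable {C : Type u} {p : C → Option C}

open Classical in
/-- The inverse of a partial injection. -/
noncomputable def copartner (p : C → Option C) (i : C) : Option C :=
  if h : ∃ j, p j = some i then some h.choose else none

theorem copartner_eq_some (hinj : ∀ i j l, p i = some l → p j = some l → i = j) {i j : C} :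
    copartner p i = some j ↔ p j = some i := by
  unfold copartner
  split_ifs with h
  · rw [Option.some.injEq]
    exact ⟨fun e => e ▸ h.choose_spec, fun e => hinj _ _ _ h.choose_spec e⟩
  · exact ⟨fun e => (nomatch e), fun e => absurd ⟨j, e⟩ h⟩

theorem Option.elim_eq_sum {N : Type v} [AddCommMonoid N] [DecidableEq C] (o : Option C)
    (F : Finset C) (ho : ∀ c, o = some c → c ∈ F) (g : C → N) :
    o.elim 0 g = ∑ c ∈ F, if o = some c then g c else 0 := by
  rcases o with _ | c
  · simp
  · rw [Finset.sum_eq_single c]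
    · simp
    · intro b _ hb
      rw [if_neg]
      intro e
      exact hb (Option.some.inj e).symm
    · exact fun h => absurd (ho c rfl) h

/-- Both sides sum over the pairs of cells. Intervals born in the contraction are indexed by the
upper cell, finite forward intervals by the lower one, so they must be reindexed to be compared. -/
theorem sum_copartner {N : Type v} [AddCommMonoid N]
    (hinj : ∀ i j l, p i = some l → p j = some l → i = j) {F G : Finset C}
    (hF : ∀ i ∈ F, ∀ j, p i = some j → j ∈ G) (hG : ∀ j ∈ G, ∀ i, p i = some j → i ∈ F)
    (g : C → C → N) :
    ∑ i ∈ F, (p i).elim 0 (fun j => g j i) = ∑ j ∈ G, (copartner p j).elim 0 (g j) := by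
  classical
  have h1 : ∀ i ∈ F, (p i).elim 0 (fun j => g j i) =
      ∑ j ∈ G, if p i = some j then g j i else 0 :=
    fun i hi => Option.elim_eq_sum _ _ (hF i hi) _
  have h2 : ∀ j ∈ G, (copartner p j).elim 0 (g j) =
      ∑ i ∈ F, if p i = some j then g j i else 0 := by
    intro j hj
    rw [Option.elim_eq_sum _ F (fun i e => hG j hj i ((copartner_eq_some hinj).1 e))]
    exact Finset.sum_congr rfl fun i _ => by simp only [copartner_eq_some hinj]
  rw [Finset.sum_congr rfl h1, Finset.sum_congr rfl h2, Finset.sum_comm]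

/-- A diagram written as a sum over cells can be compared cell by cell. -/
theorem map_filter_val_eq_sum {N : Type v} {s : Finset C} {Q R : C → Prop} [DecidablePred Q]
    [DecidablePred R] (g : C → N) :
    (s.filter (fun i => Q i ∧ R i)).val.map g =
      ∑ i ∈ s.filter Q, if R i then {g i} else 0 := by
  rw [← Finset.sum_filter, Finset.filter_filter, Finset.sum]
  have h := Multiset.sum_map_singleton ((s.filter (fun i => Q i ∧ R i)).val.map g)
  rw [Multiset.map_map] at h
  exact h.symm

end Copartner

theorem Multiset.map_finsetSum {A B C : Type*} (g : A → B) (s : Finset C) (m : C → Multiset A) :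
    (∑ i ∈ s, m i).map g = ∑ i ∈ s, (m i).map g :=
  map_sum (Multiset.mapAddMonoidHom g) m s

theorem Multiset.forall_mem_finsetSum {A C : Type*} {Q : A → Prop} {s : Finset C}
    {m : C → Multiset A} (h : ∀ i ∈ s, ∀ x ∈ m i, Q x) : ∀ x ∈ ∑ i ∈ s, m i, Q x := by
  intro x hx
  obtain ⟨i, hi, hxi⟩ := Multiset.mem_sum.1 hx
  exact h i hi x hxi

theorem PersistenceModule.isDiagram_zero {M : PersistenceModule.{u}}
    (h : ∀ t, Subsingleton (M.V t)) : M.IsDiagram 0 := by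
  have := PersistenceModule.isDiagram_of_fintype (M := M) (J := Empty) (fun j => j.elim)
    (fun j => j.elim) (fun j => j.elim) (fun j => j.elim) (fun j => j.elim)
    (fun t => linearIndependent_empty_type) (fun t => Subsingleton.elim _ _)
  exact this

theorem CellComplex.subsingleton_homology (Y : CellComplex.{u}) [IsEmpty Y.Cell] (k : ℕ) :
    Subsingleton (Y.homology k) :=
  (Submodule.Quotient.mk_surjective _).subsingleton

namespace Filtration

variable {X : CellComplex.{u}}

/-- The intervals of FB persistence that are born in the contraction, where `P k` consists of the
finite forward intervals. -/
def shiftBars (n : ℕ) (P : ℕ → Multiset (ℕ × ℕ)) : ℕ → Multiset (ℕ × ℕ)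
  | 0 => 0
  | k + 1 => (P k).map (fun x => (n + x.1, n + x.2))

/-- The finite intervals of FB persistence with `n` forward steps, where `E k` consists of the birth
times of the `k`-classes that live forever in the filtration but die in the contraction, and `P k`
of the finite forward intervals. -/
def fbBars (n : ℕ) (E : ℕ → Multiset ℕ) (P : ℕ → Multiset (ℕ × ℕ)) (k : ℕ) : Multiset (ℕ × ℕ) :=
  (E k).map (fun e => (e, n + e)) + P k + shiftBars n P k

/-- The forward and FB diagrams of `f` are described by the finite forward intervals `P k`, and by
the birth times of the classes that live forever: `root k` for those that survive the contraction,
and `E k` for the other ones. -/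
structure IsBarcode (f : Filtration X) (root E : ℕ → Multiset ℕ) (P : ℕ → Multiset (ℕ × ℕ)) :
    Prop where
  mem_E : ∀ k, ∀ e ∈ E k, 1 ≤ e ∧ e ≤ f.steps
  mem_P : ∀ k, ∀ x ∈ P k, 1 ≤ x.1 ∧ x.1 < x.2 ∧ x.2 ≤ f.steps
  P_eq_zero : ∀ k, (∀ c, X.dim c ≠ k + 1) → P k = 0
  root_zero : ∀ _ : X.Cell, root 0 = {1}
  root_of_isEmpty : IsEmpty X.Cell → root 0 = 0
  root_succ : ∀ k, root (k + 1) = 0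
  forward : ∀ k, (f.forward k).IsDiagram
    ((root k + E k).map (fun e => (e, (⊤ : ℕ∞))) + (P k).map (fun x => (x.1, (x.2 : ℕ∞))))
  fb : ∀ k, (fb f f k).IsDiagram
    ((root k).map (fun e => (e, (⊤ : ℕ∞))) +
      (fbBars f.steps E P k).map (fun x => (x.1, (x.2 : ℕ∞))))

theorem IsReducedBasis.copartner_partner {f : Filtration X} {p : X.Cell → Option X.Cell}
    {a : X.Cell → X.Cell →₀ ZMod 2} (h : f.IsReducedBasis Set.univ a p) {i j : X.Cell}
    (e : p i = some j) : copartner p i = none := by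
  rcases e' : copartner p i with _ | l
  · rfl
  · have := (h.partner l i ((copartner_eq_some h.partner_inj).1 e')).2.2.1
    rw [e] at this
    cases this

section OfBasis

variable [Fintype X.Cell] (f : Filtration X) (p : X.Cell → Option X.Cell)

open Classical in
/-- The birth times of the classes that live forever. -/
noncomputable def essentialBirths (S : Set X.Cell) (k : ℕ) : Multiset ℕ :=
  ∑ i ∈ Finset.univ.filter (fun i => X.dim i = k),
    if i ∈ S ∧ p i = none ∧ copartner p i = none then {f.step i} else 0

open Classical in
/-- The finite intervals. -/
noncomputable def finiteBars (k : ℕ) : Multiset (ℕ × ℕ) :=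
  ∑ i ∈ Finset.univ.filter (fun i => X.dim i = k),
    (copartner p i).elim 0
      (fun j => if f.step i < f.step j then {(f.step i, f.step j)} else 0)

variable {f p} {a : X.Cell → X.Cell →₀ ZMod 2} {r : X.Cell}

/-- A cell with a partner gets birth `⊤`, hence an empty interval; pairs inside a single step drop
out as well. -/
theorem IsReducedBasis.isDiagram_forward_eq (h : f.IsReducedBasis Set.univ a p) (k : ℕ) :
    (f.forward k).IsDiagram
      ((f.essentialBirths p Set.univ k).map (fun e => (e, (⊤ : ℕ∞))) +
        (f.finiteBars p k).map (fun x => (x.1, (x.2 : ℕ∞)))) := by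
  classical
  have hD := h.isDiagram_forward k (fun i => if p i = none then (f.step i : ℕ∞) else ⊤)
    (fun i => (copartner p i).elim ⊤ (fun j => (f.step j : ℕ∞))) ?_ ?_
  · convert hD using 1
    rw [map_filter_val_eq_sum, essentialBirths, finiteBars, Multiset.map_finsetSum,
      Multiset.map_finsetSum, ← Finset.sum_add_distrib]
    refine Finset.sum_congr rfl fun i _ => ?_
    rcases e : p i with _ | j
    · rcases e' : copartner p i with _ | j
      · simp
      · by_cases hlt : f.step i < f.step j <;> simp [hlt]
    · simp [h.copartner_partner e]
  · intro i t
    rcases e : p i with _ | j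
    · simp
    · simp
  · intro i t
    simp only [← copartner_eq_some h.partner_inj]
    rcases copartner p i with _ | j <;> simp

/-- The summands come from the kinds of cells. The root survives, any other unpaired cell lives
until its contraction, and the lower cell of a pair is already bounded in the filtration. The upper
cell is a cycle between the contraction of its partner and its own. -/
theorem IsReducedBasis.isDiagram_fb_eq (h : f.IsReducedBasis Set.univ a p) (hr : f.IsRoot a p r)
    (k : ℕ) : (fb f f k).IsDiagram
      ((f.essentialBirths p {r} k).map (fun e => (e, (⊤ : ℕ∞))) +
        (f.essentialBirths p {r}ᶜ k).map (fun e => (e, ((f.steps + e : ℕ) : ℕ∞))) +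
        (f.finiteBars p k).map (fun x => (x.1, (x.2 : ℕ∞))) +
        ∑ i ∈ Finset.univ.filter (fun i => X.dim i = k), (p i).elim 0 (fun j =>
          if f.step j < f.step i then
            {(f.steps + f.step j, ((f.steps + f.step i : ℕ) : ℕ∞))} else 0)) := by
  classical
  have hD := h.isDiagram_fb hr k
    (fun i => (p i).elim (f.step i : ℕ∞) (fun j => ((f.steps + f.step j : ℕ) : ℕ∞)))
    (fun i => (copartner p i).elim (f.contractTime r i) (fun j => (f.step j : ℕ∞))) ?_ ?_
  · convert hD using 1
    rw [map_filter_val_eq_sum, essentialBirths, essentialBirths, finiteBars,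
      Multiset.map_finsetSum, Multiset.map_finsetSum, Multiset.map_finsetSum,
      ← Finset.sum_add_distrib, ← Finset.sum_add_distrib, ← Finset.sum_add_distrib]
    refine Finset.sum_congr rfl fun i _ => ?_
    rcases e : p i with _ | j
    · rcases e' : copartner p i with _ | j
      · by_cases hir : i = r
        · subst hir
          simp [contractTime_root]
        · have h1 : f.step i < f.steps + f.step i := by
            have := f.one_le_step i
            have := f.step_le_steps i
            omega
          have h2 : ((f.step i : ℕ) : ℕ∞) < f.steps + f.step i := by exact_mod_cast h1
          simp [contractTime_of_ne f hir, hir, h2]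
      · by_cases hlt : f.step i < f.step j <;> simp [hlt]
    · have hir : i ≠ r := by
        rintro rfl
        rw [h.partner_eq_none hr.dim_eq] at e
        cases e
      have h2 : ((f.steps + f.step j : ℕ) : ℕ∞) < ((f.steps + f.step i : ℕ) : ℕ∞) ↔
          f.step j < f.step i := by
        rw [Nat.cast_lt]
        omega
      simp only [h.copartner_partner e, contractTime_of_ne f hir, Option.elim_some,
        Option.elim_none, h2, ENat.toNat_natCast]
      by_cases hlt : f.step j < f.step i <;> simp [hlt]
  · intro i t
    rcases e : p i with _ | j
    · simp
    · have hj : j ≠ r := fun e' => hr.not_partner i (e.trans (congrArg some e'))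
      have h1 := (h.partner i j e).2.2.2.2
      have h2 := f.step_le_steps i
      simp only [Option.elim_some, Option.some.injEq, forall_eq', contractTime_of_ne f hj]
      rw [Nat.cast_le]
      omega
  · intro i t
    simp only [← copartner_eq_some h.partner_inj]
    rcases e : copartner p i with _ | j
    · simp
    · simp only [Option.elim_some, Option.some.injEq, forall_eq', Nat.cast_lt]
      -- A cell that bounds enters by time `n`, before any basis chain is contracted, so contraction
      -- times play no role here.
      refine (and_iff_right_of_imp fun hlt => ?_).symm
      by_cases hir : i = r
      · rw [hir, contractTime_root]
        exact ENat.natCast_lt_top t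
      · rw [contractTime_of_ne f hir]
        have := f.step_le_steps j
        exact_mod_cast (by omega : t < f.steps + f.step i)

theorem IsReducedBasis.isBarcode (h : f.IsReducedBasis Set.univ a p) (hr : f.IsRoot a p r) :
    f.IsBarcode (f.essentialBirths p {r}) (f.essentialBirths p {r}ᶜ) (f.finiteBars p) := by
  classical
  have hsing : ∀ k, f.essentialBirths p {r} k = if k = 0 then {1} else 0 := by
    intro k
    have hcr : copartner p r = none := by
      rcases e' : copartner p r with _ | l
      · rfl
      · exact absurd ((copartner_eq_some h.partner_inj).1 e') (hr.not_partner l)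
    by_cases hk : k = 0
    · rw [essentialBirths, Finset.sum_eq_single r, if_pos, hr.step_eq, if_pos hk]
      · exact ⟨rfl, h.partner_eq_none hr.dim_eq, hcr⟩
      · intro i _ hi
        exact if_neg fun h => hi h.1
      · intro hn
        refine absurd (Finset.mem_filter.2 ⟨Finset.mem_univ r, ?_⟩) hn
        exact hr.dim_eq.trans hk.symm
    · rw [if_neg hk, essentialBirths]
      refine Finset.sum_eq_zero fun i hi => if_neg ?_
      rintro ⟨rfl, -⟩
      exact hk ((Finset.mem_filter.1 hi).2.symm.trans hr.dim_eq)
  have hcompl : ∀ k, f.essentialBirths p Set.univ k =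
      f.essentialBirths p {r} k + f.essentialBirths p {r}ᶜ k := by
    intro k
    rw [essentialBirths, essentialBirths, essentialBirths, ← Finset.sum_add_distrib]
    refine Finset.sum_congr rfl fun i _ => ?_
    by_cases hi : i = r <;> simp [hi]
  constructor
  · intro k
    refine Multiset.forall_mem_finsetSum fun i _ e he => ?_
    split_ifs at he
    · rw [Multiset.mem_singleton.1 he]
      exact ⟨f.one_le_step i, f.step_le_steps i⟩
    · exact absurd he (Multiset.notMem_zero _)
  · intro k
    refine Multiset.forall_mem_finsetSum fun i _ x hx => ?_
    rcases e : copartner p i with _ | j <;> rw [e] at hx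
    · exact absurd hx (Multiset.notMem_zero _)
    · rw [Option.elim_some] at hx
      split_ifs at hx with hlt
      · rw [Multiset.mem_singleton.1 hx]
        exact ⟨f.one_le_step i, hlt, f.step_le_steps j⟩
      · exact absurd hx (Multiset.notMem_zero _)
  · intro k hk
    refine Finset.sum_eq_zero fun i hi => ?_
    rcases e : copartner p i with _ | j
    · rfl
    · have h1 := (h.partner j i ((copartner_eq_some h.partner_inj).1 e)).2.2.2.1
      rw [(Finset.mem_filter.1 hi).2] at h1
      exact absurd h1 (hk j)
  · intro _
    rw [hsing, if_pos rfl]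
  · intro hX
    exact (hX.false r).elim
  · intro k
    rw [hsing, if_neg (Nat.succ_ne_zero k)]
  · intro k
    rw [← hcompl]
    exact h.isDiagram_forward_eq k
  · intro k
    convert h.isDiagram_fb_eq hr k using 1
    rw [fbBars, Multiset.map_add, Multiset.map_add, Multiset.map_map, ← add_assoc, ← add_assoc]
    congr 1
    -- Vertices have no partners, so in dimension zero nothing is born in the contraction.
    cases k with
    | zero =>
      refine (Finset.sum_eq_zero fun i hi => ?_).symm
      rw [h.partner_eq_none (Finset.mem_filter.1 hi).2]
      rfl
    | succ k =>
      rw [sum_copartner h.partner_inj (G := Finset.univ.filter (fun i => X.dim i = k))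
        (g := fun j i => if f.step j < f.step i then
          ({(f.steps + f.step j, ((f.steps + f.step i : ℕ) : ℕ∞))} : Multiset (ℕ × ℕ∞)) else 0)]
      · rw [shiftBars, finiteBars, Multiset.map_finsetSum, Multiset.map_finsetSum]
        refine Finset.sum_congr rfl fun i _ => ?_
        rcases copartner p i with _ | j
        · rfl
        · rw [Option.elim_some, Option.elim_some]
          split_ifs <;> simp
      · intro i hi j e
        have h1 := (h.partner i j e).2.2.2.1
        rw [(Finset.mem_filter.1 hi).2] at h1
        exact Finset.mem_filter.2 ⟨Finset.mem_univ _, by omega⟩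
      · intro j hj i e
        have h1 := (h.partner i j e).2.2.2.1
        rw [(Finset.mem_filter.1 hj).2] at h1
        exact Finset.mem_filter.2 ⟨Finset.mem_univ _, h1⟩

end OfBasis

/-- The empty complex has no root and is treated separately: all its homology vanishes. -/
theorem exists_isBarcode (f : Filtration X) : ∃ root E P, f.IsBarcode root E P := by
  have := X.finite_cell
  have := Fintype.ofFinite X.Cell
  rcases isEmpty_or_nonempty X.Cell with hX | ⟨⟨c⟩⟩
  · have h1 : ∀ t, IsEmpty (X.sub (f.level t)).Cell := fun t =>
      inferInstanceAs (IsEmpty (f.level t).carrier)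
    have h2 : ∀ t, IsEmpty (fbStage f f t).Cell := fun t =>
      ⟨fun x => Quotient.inductionOn x fun c => (h1 t).false c⟩
    have hF : ∀ k, (f.forward k).IsDiagram 0 := fun k =>
      PersistenceModule.isDiagram_zero fun t => (X.sub (f.level t)).subsingleton_homology k
    have hB : ∀ k, (fb f f k).IsDiagram 0 := fun k =>
      PersistenceModule.isDiagram_zero fun t => (fbStage f f t).subsingleton_homology k
    refine ⟨fun _ => 0, fun _ => 0, fun _ => 0, by simp, by simp, by simp,
      fun c => (hX.false c).elim, by simp, by simp, by simpa using hF, fun k => ?_⟩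
    convert hB k using 1
    cases k <;> simp [fbBars, shiftBars]
  · obtain ⟨a, p, h⟩ := f.exists_isReducedBasis
    obtain ⟨a', r, h', hr⟩ := h.exists_root c
    exact ⟨_, _, _, h'.isBarcode hr⟩

end Filtration

/-! ### Recovering the forward intervals from the FB intervals -/

section Combinatorics

open Filtration

variable {n m : ℕ} {E F : ℕ → Multiset ℕ} {P Q : ℕ → Multiset (ℕ × ℕ)}

theorem mem_fbBars {k : ℕ} {x : ℕ × ℕ} : x ∈ fbBars n E P k ↔
    (∃ e ∈ E k, (e, n + e) = x) ∨ x ∈ P k ∨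
      ∃ l, k = l + 1 ∧ ∃ y ∈ P l, (n + y.1, n + y.2) = x := by
  cases k <;> simp [fbBars, shiftBars, or_assoc]

/-- Intervals of FB persistence with different numbers of steps agree only if there are none. -/
theorem fbBars_eq_zero_of_lt (hnm : n < m) (hE : ∀ k, ∀ e ∈ E k, 1 ≤ e ∧ e ≤ n)
    (hP : ∀ k, ∀ x ∈ P k, 1 ≤ x.1 ∧ x.1 < x.2 ∧ x.2 ≤ n)
    (h : ∀ k, fbBars n E P k = fbBars m F Q k) :
    ∀ k, E k = 0 ∧ F k = 0 ∧ P k = 0 ∧ Q k = 0 := by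
  intro k
  induction k using Nat.strong_induction_on with
  | _ k ih =>
  have hmem : ∀ x k, x ∈ fbBars n E P k ↔ x ∈ fbBars m F Q k := fun x k => by rw [h k]
  have hprev : ∀ l, k = l + 1 → P l = 0 ∧ Q l = 0 := fun l hl => (ih l (by omega)).2.2
  -- a finite interval of the second barcode leads to one with a later birth of the first one
  have hshift : ∀ x ∈ Q k, ∃ y ∈ P k, n + y.1 = m + x.1 ∧ n + y.2 = m + x.2 := by
    intro x hx
    have h1 := (hmem (m + x.1, m + x.2) (k + 1)).2
      (mem_fbBars.2 (Or.inr (Or.inr ⟨k, rfl, x, hx, rfl⟩)))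
    rcases mem_fbBars.1 h1 with ⟨e, he, e1⟩ | hx' | ⟨l, hl, y, hy, e1⟩
    · have := (hE _ e he).2
      rw [Prod.mk.injEq] at e1
      omega
    · have := hP _ _ hx'
      simp only at this
      omega
    · obtain rfl : k = l := by omega
      rw [Prod.mk.injEq] at e1
      exact ⟨y, hy, e1⟩
  -- An interval `(e, n + e)` has the wrong length to come from `F k`. If it were in `Q k`, then
  -- `hshift` would give an interval in `P k` that dies at `m + e > n`.
  have hE0 : E k = 0 := by
    refine Multiset.eq_zero_of_forall_notMem fun e he => ?_
    have h1 := (hmem (e, n + e) k).1 (mem_fbBars.2 (Or.inl ⟨e, he, rfl⟩))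
    rcases mem_fbBars.1 h1 with ⟨e', -, e1⟩ | hx' | ⟨l, hl, y, hy, -⟩
    · rw [Prod.mk.injEq] at e1
      omega
    · obtain ⟨y, hy, h2, h3⟩ := hshift _ hx'
      have := hP k y hy
      have := hE k e he
      simp only at h2 h3
      omega
    · rw [(hprev l hl).2] at hy
      exact Multiset.notMem_zero _ hy
  have hF0 : F k = 0 := by
    refine Multiset.eq_zero_of_forall_notMem fun e he => ?_
    have h1 := (hmem (e, m + e) k).2 (mem_fbBars.2 (Or.inl ⟨e, he, rfl⟩))
    rcases mem_fbBars.1 h1 with ⟨e', he', -⟩ | hx' | ⟨l, hl, y, hy, -⟩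
    · rw [hE0] at he'
      exact Multiset.notMem_zero _ he'
    · have := (hP _ _ hx').2.2
      simp only at this
      omega
    · rw [(hprev l hl).1] at hy
      exact Multiset.notMem_zero _ hy
  have hPQ : P k = Q k := by
    have h1 := h k
    unfold fbBars at h1
    rw [hE0, hF0, Multiset.map_zero, Multiset.map_zero, zero_add, zero_add] at h1
    cases k with
    | zero => simpa [shiftBars] using h1
    | succ l => simpa [shiftBars, (hprev l rfl).1, (hprev l rfl).2] using h1
  -- By `hshift` each interval leads to one with birth larger by `m - n`, in the same multiset since
  -- `P k = Q k`; a maximal birth is contradictory.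
  have hQ0 : Q k = 0 := by
    by_contra hne
    obtain ⟨x, hx, hmax⟩ := (Q k).toFinset.exists_max_image Prod.fst
      (Multiset.toFinset_nonempty.2 hne)
    obtain ⟨y, hy, h2, -⟩ := hshift x (Multiset.mem_toFinset.1 hx)
    rw [hPQ] at hy
    have := hmax y (Multiset.mem_toFinset.2 hy)
    omega
  exact ⟨hE0, hF0, hPQ.trans hQ0, hQ0⟩

/-- Once `n` is known the three types separate: finite forward intervals end by `n`, those of `E k`
straddle `n`, and the shifted ones are born after `n` because forward births are at least 1. -/
theorem finite_bars_eq_filter (hE : ∀ k, ∀ e ∈ E k, 1 ≤ e ∧ e ≤ n)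
    (hP : ∀ k, ∀ x ∈ P k, 1 ≤ x.1 ∧ x.1 < x.2 ∧ x.2 ≤ n) (k : ℕ) :
    (fbBars n E P k).filter (fun x => x.2 ≤ n) = P k ∧
      (fbBars n E P k).filter (fun x => x.1 ≤ n ∧ n < x.2) = (E k).map (fun e => (e, n + e)) := by
  have h1 : ∀ l, ∀ x ∈ (P l).map (fun x => (n + x.1, n + x.2)), n < x.1 ∧ n < x.2 := by
    intro l x hx
    obtain ⟨y, hy, rfl⟩ := Multiset.mem_map.1 hx
    have := hP l y hy
    constructor <;> simp only <;> omega
  have h2 : ∀ x ∈ (E k).map (fun e => (e, n + e)), x.1 ≤ n ∧ n < x.2 := by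
    intro x hx
    obtain ⟨e, he, rfl⟩ := Multiset.mem_map.1 hx
    have := hE k e he
    constructor <;> simp only <;> omega
  have h3 : ∀ x ∈ shiftBars n P k, n < x.1 ∧ n < x.2 := by
    cases k with
    | zero => simp [shiftBars]
    | succ l => exact h1 l
  constructor
  · rw [fbBars, Multiset.filter_add, Multiset.filter_add,
      Multiset.filter_eq_nil.2 fun x hx => not_le.2 (h2 x hx).2,
      Multiset.filter_eq_nil.2 fun x hx => not_le.2 (h3 x hx).2,
      Multiset.filter_eq_self.2 fun x hx => (hP k x hx).2.2, zero_add, add_zero]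
  · rw [fbBars, Multiset.filter_add, Multiset.filter_add,
      Multiset.filter_eq_self.2 h2,
      Multiset.filter_eq_nil.2 fun x hx hx' => absurd hx'.1 (not_le.2 (h3 x hx).1),
      Multiset.filter_eq_nil.2 fun x hx hx' => absurd hx'.2 (not_lt.2 (hP k x hx).2.2),
      add_zero, add_zero]

/-- The intervals of FB persistence determine those of forward persistence. -/
theorem fbBars_injective (hE : ∀ k, ∀ e ∈ E k, 1 ≤ e ∧ e ≤ n)
    (hP : ∀ k, ∀ x ∈ P k, 1 ≤ x.1 ∧ x.1 < x.2 ∧ x.2 ≤ n)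
    (hF : ∀ k, ∀ e ∈ F k, 1 ≤ e ∧ e ≤ m)
    (hQ : ∀ k, ∀ x ∈ Q k, 1 ≤ x.1 ∧ x.1 < x.2 ∧ x.2 ≤ m)
    (h : ∀ k, fbBars n E P k = fbBars m F Q k) (k : ℕ) : E k = F k ∧ P k = Q k := by
  rcases lt_trichotomy n m with hlt | rfl | hlt
  · obtain ⟨h1, h2, h3, h4⟩ := fbBars_eq_zero_of_lt hlt hE hP h k
    exact ⟨h1.trans h2.symm, h3.trans h4.symm⟩
  · obtain ⟨h1, h2⟩ := finite_bars_eq_filter hE hP k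
    obtain ⟨h3, h4⟩ := finite_bars_eq_filter hF hQ k
    rw [h k] at h1 h2
    refine ⟨?_, h1.symm.trans h3⟩
    have hinj : Function.Injective (fun e : ℕ => (e, n + e)) := fun a b hab =>
      congrArg Prod.fst hab
    exact Multiset.map_injective hinj (h2.symm.trans h4)
  · obtain ⟨h1, h2, h3, h4⟩ := fbBars_eq_zero_of_lt hlt hF hQ (fun k => (h k).symm) k
    exact ⟨h2.trans h1.symm, h4.trans h3.symm⟩

theorem infinite_finite_injective {A B : Multiset ℕ} {C D : Multiset (ℕ × ℕ)}
    (h : A.map (fun e => (e, (⊤ : ℕ∞))) + C.map (fun x => (x.1, (x.2 : ℕ∞))) =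
      B.map (fun e => (e, (⊤ : ℕ∞))) + D.map (fun x => (x.1, (x.2 : ℕ∞)))) : A = B ∧ C = D := by
  classical
  have hinj : Function.Injective (fun e : ℕ => (e, (⊤ : ℕ∞))) := fun a b hab =>
    congrArg Prod.fst hab
  have hinj' : Function.Injective (fun x : ℕ × ℕ => (x.1, (x.2 : ℕ∞))) := by
    rintro ⟨a, b⟩ ⟨c, d⟩ hab
    simp only [Prod.mk.injEq, Nat.cast_inj] at hab
    rw [hab.1, hab.2]
  have hA : ∀ A : Multiset ℕ, (A.map (fun e => (e, (⊤ : ℕ∞)))).filter (fun x => x.2 = ⊤) =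
      A.map (fun e => (e, (⊤ : ℕ∞))) := by
    intro A
    refine Multiset.filter_eq_self.2 fun x hx => ?_
    obtain ⟨e, -, rfl⟩ := Multiset.mem_map.1 hx
    rfl
  have hC : ∀ C : Multiset (ℕ × ℕ),
      (C.map (fun x => (x.1, (x.2 : ℕ∞)))).filter (fun x => x.2 = ⊤) = 0 := by
    intro C
    refine Multiset.filter_eq_nil.2 fun x hx => ?_
    obtain ⟨e, -, rfl⟩ := Multiset.mem_map.1 hx
    exact ENat.natCast_ne_top _
  have h1 := congrArg (Multiset.filter (fun x => x.2 = ⊤)) h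
  rw [Multiset.filter_add, Multiset.filter_add, hA, hA, hC, hC, add_zero, add_zero] at h1
  rw [h1, add_right_inj] at h
  exact ⟨Multiset.map_injective hinj h1, Multiset.map_injective hinj' h⟩

end Combinatorics

/-! ### Equal expressive power of forward and FB persistence -/

namespace Filtration

variable {X : CellComplex.{u}} {Y : CellComplex.{v}} (f : Filtration X) (g : Filtration Y)

theorem forward_diagram_eq_of_fb
    (h : ∀ k, (fb f f k).diagram = (fb g g k).diagram) (k : ℕ) :
    (f.forward k).diagram = (g.forward k).diagram := by
  obtain ⟨r, E, P, hf⟩ := f.exists_isBarcode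
  obtain ⟨s, F, Q, hg⟩ := g.exists_isBarcode
  have h1 : ∀ k, r k = s k ∧ fbBars f.steps E P k = fbBars g.steps F Q k := by
    intro k
    have := h k
    rw [(hf.fb k).diagram_eq, (hg.fb k).diagram_eq] at this
    exact infinite_finite_injective this
  obtain ⟨h2, h3⟩ := fbBars_injective hf.mem_E hf.mem_P hg.mem_E hg.mem_P (fun k => (h1 k).2) k
  rw [(hf.forward k).diagram_eq, (hg.forward k).diagram_eq, (h1 k).1, h2, h3]

theorem fb_diagram_eq_of_forward (hn : f.steps = g.steps)
    (h : ∀ k, (f.forward k).diagram = (g.forward k).diagram) (k : ℕ) :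
    (fb f f k).diagram = (fb g g k).diagram := by
  obtain ⟨r, E, P, hf⟩ := f.exists_isBarcode
  obtain ⟨s, F, Q, hg⟩ := g.exists_isBarcode
  have h1 : ∀ k, r k + E k = s k + F k ∧ P k = Q k := by
    intro k
    have := h k
    rw [(hf.forward k).diagram_eq, (hg.forward k).diagram_eq] at this
    exact infinite_finite_injective this
  -- The forward diagram does not distinguish the root class from the other infinite ones. The root
  -- is absent only for the empty complex, that is, for `n = 0`, so equal numbers of steps settle
  -- this.
  have h2 : ∀ k, r k = s k := by
    rintro (_ | k)
    · rcases isEmpty_or_nonempty X.Cell with hX | ⟨⟨c⟩⟩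
      · have hn0 : f.steps = 0 := by
          rw [steps, Set.range_eq_empty, Set.ncard_empty]
        have hY : IsEmpty Y.Cell := ⟨fun c => by have := g.one_le_steps c; omega⟩
        rw [hf.root_of_isEmpty hX, hg.root_of_isEmpty hY]
      · rcases isEmpty_or_nonempty Y.Cell with hY | ⟨⟨c'⟩⟩
        · have hn0 : g.steps = 0 := by
            rw [steps, Set.range_eq_empty, Set.ncard_empty]
          have := f.one_le_steps c
          omega
        · rw [hf.root_zero c, hg.root_zero c']
    · rw [hf.root_succ, hg.root_succ]
  have hE : E = F := funext fun k => by
    have := (h1 k).1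
    rwa [h2 k, add_right_inj] at this
  have hP : P = Q := funext fun k => (h1 k).2
  rw [(hf.fb k).diagram_eq, (hg.fb k).diagram_eq, h2 k, hE, hP, hn]

end Filtration

/-! ### Graphs: vertex representatives as matrix reduction -/

namespace Graph

variable {α : Type u} {β : Type v} {G : Graph α β} [Finite G.vertexSet] [Finite G.edgeSet]

/-- The ends chosen in the definition are determined up to order, and the sum is symmetric. -/
theorem bdry_of_isLink {e : G.edgeSet} {x y : G.vertexSet} (h : G.IsLink e x y) :
    G.toCellComplex.bdry (Sum.inr e) =
      Finsupp.single (Sum.inl x) 1 + Finsupp.single (Sum.inl y) 1 := by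
  have hs := G.exists_isLink_of_mem_edgeSet e.2
  obtain ⟨x, hx⟩ := x
  obtain ⟨y, hy⟩ := y
  have key := hs.choose_spec.choose_spec.eq_and_eq_or_eq_and_eq h
  have aux : ∀ a b (ha : a ∈ G.vertexSet) (hb : b ∈ G.vertexSet),
      a = x ∧ b = y ∨ a = y ∧ b = x →
      (Finsupp.single (Sum.inl (⟨a, ha⟩ : G.vertexSet)) 1 + Finsupp.single (Sum.inl ⟨b, hb⟩) 1 :
        G.toCellComplex.Cell →₀ ZMod 2) =
      Finsupp.single (Sum.inl ⟨x, hx⟩) 1 + Finsupp.single (Sum.inl ⟨y, hy⟩) 1 := by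
    rintro a b ha hb (⟨rfl, rfl⟩ | ⟨rfl, rfl⟩)
    · rfl
    · exact add_comm _ _
  exact aux _ _ _ _ key

omit [Finite G.vertexSet] [Finite G.edgeSet] in
theorem exists_isLink_subtype (e : G.edgeSet) : ∃ x y : G.vertexSet, G.IsLink e x y := by
  obtain ⟨x, y, h⟩ := G.exists_isLink_of_mem_edgeSet e.2
  exact ⟨⟨x, h.left_mem⟩, ⟨y, h.right_mem⟩, h⟩

theorem birth_le_spawnTime (f : Filtration G.toCellComplex) {e : G.edgeSet} {x y : G.vertexSet}
    (h : G.IsLink e x y) : birth f x ≤ spawnTime f e :=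
  f.step_mono ⟨x, e, h.inc_left, rfl, rfl⟩

theorem dim_ne_two (c : G.toCellComplex.Cell) (k : ℕ) : G.toCellComplex.dim c ≠ k + 2 := by
  rcases c with x | e
  · exact (Nat.succ_ne_zero (k + 1)).symm
  · intro h
    change 1 = k + 2 at h
    omega

section Runs

/-- No vertex is born before the supernode, so a strictly younger representative is never the
supernode, and in a tie the other one can be chosen to die. -/
theorem exists_spawnEdge (f : Filtration G.toCellComplex) {star : G.vertexSet}
    (hstar : birth f star = 1) (e : G.edgeSet) (s : RepState G) : ∃ s', SpawnEdge f star e s s' := by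
  obtain ⟨x, y, h⟩ := exists_isLink_subtype e
  have h1 : ∀ v, 1 ≤ birth f v := fun v => f.one_le_step _
  by_cases he : s.rep x = s.rep y
  · exact ⟨s, .cycle s x y h he⟩
  · rcases lt_trichotomy (birth f (s.rep x)) (birth f (s.rep y)) with hlt | heq | hlt
    · refine ⟨_, .merge s y x h.symm (Ne.symm he) hlt.le ?_⟩
      intro e'
      rw [e', hstar] at hlt
      exact absurd (h1 _) (not_le.2 hlt)
    · by_cases hx : s.rep x = star
      · exact ⟨_, .merge s y x h.symm (Ne.symm he) heq.le (fun hy => he (hx.trans hy.symm))⟩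
      · exact ⟨_, .merge s x y h he heq.ge hx⟩
    · refine ⟨_, .merge s x y h he hlt.le ?_⟩
      intro e'
      rw [e', hstar] at hlt
      exact absurd (h1 _) (not_le.2 hlt)

theorem exists_filtrationRun (f : Filtration G.toCellComplex) {star : G.vertexSet}
    (hstar : birth f star = 1) : ∃ s, FiltrationRun f star s := by
  classical
  have := Fintype.ofFinite G.edgeSet
  let le : G.edgeSet → G.edgeSet → Bool := fun e e' => decide (spawnTime f e ≤ spawnTime f e')
  let l := (Finset.univ : Finset G.edgeSet).toList.mergeSort le
  have hperm : l.Perm (Finset.univ : Finset G.edgeSet).toList := List.mergeSort_perm _ _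
  have hrun : ∀ (l : List G.edgeSet) (s : RepState G), ∃ s', SpawnEdges f star l s s' := by
    intro l
    induction l with
    | nil => exact fun s => ⟨s, .nil s⟩
    | cons e l ih =>
      intro s
      obtain ⟨s', h⟩ := exists_spawnEdge f hstar e s
      obtain ⟨s'', h'⟩ := ih s'
      exact ⟨s'', .cons e l s s' s'' h h'⟩
  obtain ⟨s, hs⟩ := hrun l ⟨id, fun _ => ⊤⟩
  refine ⟨s, l, hperm.nodup_iff.2 (Finset.nodup_toList _), fun e => ?_, ?_, hs⟩
  · exact hperm.mem_iff.2 (Finset.mem_toList.2 (Finset.mem_univ e))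
  · have := List.pairwise_mergeSort (le := le) (fun a b c h1 h2 => by
      simp only [le, decide_eq_true_eq] at *
      omega) (fun a b => by
      simp only [le, Bool.or_eq_true, decide_eq_true_eq]
      omega) (Finset.univ : Finset G.edgeSet).toList
    exact this.imp fun h => by simpa [le] using h

/-- The cells treated once the edges in `T` have been spawned. -/
def spawned (T : Set G.edgeSet) : Set G.toCellComplex.Cell :=
  {c | Sum.elim (fun _ => True) (fun e => e ∈ T) c}

theorem insert_spawned (T : Set G.edgeSet) (e : G.edgeSet) :
    insert (Sum.inr e) (spawned T) = spawned (insert e T) := by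
  ext c
  rcases c with x | e'
  · exact ⟨fun _ => trivial, fun _ => Or.inr trivial⟩
  · simp only [spawned, Set.mem_insert_iff, Set.mem_ofPred_eq, Sum.elim_inr, Sum.inr.injEq]

/-- The state `s` of the bookkeeping after the edges in `T` have been spawned corresponds to a
basis that is compatible with the boundaries of these edges. -/
structure IsRunBasis (f : Filtration G.toCellComplex) (star : G.vertexSet) (T : Set G.edgeSet)
    (s : RepState G) (a : G.toCellComplex.Cell → G.toCellComplex.Cell →₀ ZMod 2)
    (p : G.toCellComplex.Cell → Option G.toCellComplex.Cell) : Prop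
    extends f.IsReducedBasis (spawned T) a p where
  basis_edge : ∀ e, e ∉ T → a (Sum.inr e) = Finsupp.single (Sum.inr e) 1
  basis_rep : ∀ v, s.rep v = v → a (Sum.inl v) = Finsupp.single (Sum.inl v) 1
  partner_rep : ∀ v, s.rep v = v → ∀ c, p c ≠ some (Sum.inl v)
  death_rep : ∀ v, s.rep v = v → s.death v = ⊤
  killed : ∀ v, s.rep v ≠ v → ∃ e, p (Sum.inr e) = some (Sum.inl v) ∧ s.death v = spawnTime f e
  rep_rep : ∀ v, s.rep (s.rep v) = s.rep v
  birth_rep : ∀ v, birth f (s.rep v) ≤ birth f v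
  rep_star : s.rep star = star
  -- A chain of spawned edges that joins `v` to its representative.
  homologous : ∀ v, ∃ z ∈ Submodule.span (ZMod 2) (a '' (Sum.inr '' T)),
    G.toCellComplex.boundary z =
      Finsupp.single (Sum.inl v) 1 + Finsupp.single (Sum.inl (s.rep v)) 1

theorem isRunBasis_empty (f : Filtration G.toCellComplex) (star : G.vertexSet) :
    IsRunBasis f star ∅ ⟨id, fun _ => ⊤⟩ (fun σ => Finsupp.single σ 1) (fun _ => none) where
  toIsFilteredBasis := f.isFilteredBasis_single
  boundary_eq := by
    rintro (x | e) h
    · exact (CellData.boundary_single _ _).trans (CellComplex.bdry_eq_zero rfl)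
    · exact h.elim
  partner := by simp
  partner_inj := by simp
  basis_edge _ _ := rfl
  basis_rep _ _ := rfl
  partner_rep := by simp
  death_rep _ _ := rfl
  killed v h := absurd rfl h
  rep_rep _ := rfl
  birth_rep _ := le_rfl
  rep_star := rfl
  homologous v := ⟨0, Submodule.zero_mem _, by
    rw [map_zero]
    exact (ZModModule.add_self _).symm⟩

variable {f : Filtration G.toCellComplex} {star : G.vertexSet} {T : Set G.edgeSet}
  {s s' : RepState G} {a : G.toCellComplex.Cell → G.toCellComplex.Cell →₀ ZMod 2}
  {p : G.toCellComplex.Cell → Option G.toCellComplex.Cell}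

/-- Adding to the new edge the chains that join its ends to their representatives gives a chain with
boundary the sum of the two representatives. If they agree, the edge closes a cycle. Otherwise the
dying representative is the pivot: it is paired with the edge, and its basis chain becomes the sum
of the two. -/
theorem IsRunBasis.insert (h : IsRunBasis f star T s a p) {e : G.edgeSet} (he : e ∉ T)
    (hT : ∀ e' ∈ T, spawnTime f e' ≤ spawnTime f e) (hs : SpawnEdge f star e s s') :
    ∃ a' p', IsRunBasis f star (insert e T) s' a' p' := by
  classical
  have hσ : (Sum.inr e : G.toCellComplex.Cell) ∉ spawned T := he
  have hspan : ∀ z ∈ Submodule.span (ZMod 2) (a '' (Sum.inr '' T)),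
      z ∈ Submodule.span (ZMod 2) (a '' {ρ | ρ ∈ spawned T ∧
        G.toCellComplex.dim ρ = G.toCellComplex.dim (Sum.inr e) ∧
        f.step ρ ≤ f.step (Sum.inr e)}) := by
    refine fun z hz => Submodule.span_mono ?_ hz
    rintro _ ⟨_, ⟨e', he', rfl⟩, rfl⟩
    exact ⟨Sum.inr e', ⟨he', rfl, hT e' he'⟩, rfl⟩
  have hbd : ∀ x y : G.vertexSet, G.IsLink e x y → ∃ z ∈ Submodule.span (ZMod 2)
      (a '' (Sum.inr '' T)), G.toCellComplex.boundary (a (Sum.inr e) + z) =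
        Finsupp.single (Sum.inl (s.rep x)) 1 + Finsupp.single (Sum.inl (s.rep y)) 1 := by
    intro x y hxy
    obtain ⟨z₁, hz₁, e₁⟩ := h.homologous x
    obtain ⟨z₂, hz₂, e₂⟩ := h.homologous y
    refine ⟨z₁ + z₂, Submodule.add_mem _ hz₁ hz₂, ?_⟩
    rw [map_add, map_add, e₁, e₂, h.basis_edge e he, CellData.boundary_single, bdry_of_isLink hxy]
    generalize Finsupp.single (Sum.inl x) (1 : ZMod 2) = A
    generalize Finsupp.single (Sum.inl y) (1 : ZMod 2) = B
    generalize Finsupp.single (Sum.inl (s.rep x)) (1 : ZMod 2) = C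
    generalize Finsupp.single (Sum.inl (s.rep y)) (1 : ZMod 2) = D
    have e : A + B + (A + C + (B + D)) = (A + A) + (B + B) + (C + D) := by abel
    rw [e, ZModModule.add_self, ZModModule.add_self, zero_add, zero_add]
  cases hs with
  | cycle x y hxy heq =>
    obtain ⟨z, hz, hb⟩ := hbd x y hxy
    rw [heq, ZModModule.add_self] at hb
    let a' := Function.update a (Sum.inr e : G.toCellComplex.Cell) (a (Sum.inr e) + z)
    have hne : ∀ c, c ≠ Sum.inr e → a' c = a c := fun c hc => Function.update_of_ne hc _ _
    refine ⟨a', p, ⟨?_, ?_, ?_, h.partner_rep, h.death_rep, h.killed, h.rep_rep, h.birth_rep,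
      h.rep_star, ?_⟩⟩
    · rw [← insert_spawned]
      exact h.insert_cycle hσ (hspan z hz) hb
    · intro e' he'
      rw [Set.mem_insert_iff, not_or] at he'
      rw [hne _ (fun h => he'.1 (Sum.inr_injective h))]
      exact h.basis_edge e' he'.2
    · intro v hv
      rw [hne _ (fun h => by cases h)]
      exact h.basis_rep v hv
    · intro v
      obtain ⟨w, hw, e'⟩ := h.homologous v
      refine ⟨w, Submodule.span_mono ?_ hw, e'⟩
      rintro _ ⟨_, ⟨e', he', rfl⟩, rfl⟩
      refine ⟨_, ⟨e', Set.mem_insert_of_mem _ he', rfl⟩, hne _ fun h => ?_⟩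
      rw [Sum.inr_injective h] at he'
      exact he he'
  | merge x y hxy hxy' hbirth hstar =>
    obtain ⟨z, hz, hb⟩ := hbd x y hxy
    have hrx := h.rep_rep x
    have hry := h.rep_rep y
    rw [← h.basis_rep _ hrx] at hb
    let a' := Function.update
      (Function.update a (Sum.inr e : G.toCellComplex.Cell) (a (Sum.inr e) + z))
      (Sum.inl (s.rep x)) (a (Sum.inl (s.rep x)) + Finsupp.single (Sum.inl (s.rep y)) 1)
    let p' := Function.update p (Sum.inr e : G.toCellComplex.Cell) (some (Sum.inl (s.rep x)))
    have hvert : ∀ v, (Sum.inl v : G.toCellComplex.Cell) ∈ spawned T := fun _ => trivial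
    have hred : f.IsReducedBasis (insert (Sum.inr e) (spawned T)) a' p' := by
      refine h.insert_pair hσ (hspan z hz) (hvert _) ?_ (h.partner_rep _ hrx) rfl ?_ ?_ hb
      · rcases ep : p (Sum.inl (s.rep x)) with _ | c
        · rfl
        · have := (h.partner _ _ ep).2.2.2.1
          cases this
      · exact (h.birth_rep x).trans (birth_le_spawnTime f hxy)
      -- The surviving representative is unpaired, its basis chain is the bare vertex, and it is
      -- born no later. Hence the rule that the later one dies makes this an admissible column
      -- addition.
      · rw [← h.basis_rep _ hry]
        refine Submodule.subset_span ⟨Sum.inl (s.rep y), ⟨hvert _, ?_, ?_, rfl, hbirth⟩, rfl⟩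
        · rcases ep : p (Sum.inl (s.rep y)) with _ | c
          · rfl
          · have := (h.partner _ _ ep).2.2.2.1
            cases this
        · exact fun h => hxy' (Sum.inl_injective h).symm
    have hae : ∀ e', e' ≠ e → a' (Sum.inr e') = a (Sum.inr e') := fun e' he' =>
      (Function.update_of_ne (fun h => by cases h) _ _).trans
        (Function.update_of_ne (fun h => he' (Sum.inr_injective h)) _ _)
    have hav : ∀ v, v ≠ s.rep x → a' (Sum.inl v) = a (Sum.inl v) := fun v hv =>
      (Function.update_of_ne (fun h => hv (Sum.inl_injective h)) _ _).trans
        (Function.update_of_ne (fun h => by cases h) _ _)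
    have hpe : ∀ c, c ≠ Sum.inr e → p' c = p c := fun c hc => Function.update_of_ne hc _ _
    have hpe' : p' (Sum.inr e) = some (Sum.inl (s.rep x)) := Function.update_self _ _ _
    have hrep : ∀ v, (s.kill (s.rep x) (s.rep y) (spawnTime f e)).rep v =
        if s.rep v = s.rep x then s.rep y else s.rep v := fun v => rfl
    have hdeath : ∀ v, (s.kill (s.rep x) (s.rep y) (spawnTime f e)).death v =
        if v = s.rep x then (spawnTime f e : ℕ∞) else s.death v := fun v => rfl
    have hfix : ∀ v, (s.kill (s.rep x) (s.rep y) (spawnTime f e)).rep v = v ↔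
        s.rep v = v ∧ v ≠ s.rep x := by
      intro v
      rw [hrep]
      split_ifs with hv
      · constructor
        · rintro rfl
          rw [hry] at hv
          exact absurd hv.symm hxy'
        · rintro ⟨h1, h2⟩
          exact absurd (h1.symm.trans hv) h2
      · constructor
        · intro h1
          exact ⟨h1, fun h2 => hv (h1.trans h2)⟩
        · exact fun h1 => h1.1
    refine ⟨a', p', ⟨?_, ?_, ?_, ?_, ?_, ?_, ?_, ?_, ?_, ?_⟩⟩
    · rw [← insert_spawned]
      exact hred
    · intro e' he'
      rw [Set.mem_insert_iff, not_or] at he'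
      rw [hae e' he'.1]
      exact h.basis_edge e' he'.2
    · intro v hv
      rw [hfix] at hv
      rw [hav v hv.2]
      exact h.basis_rep v hv.1
    · intro v hv c hc
      rw [hfix] at hv
      by_cases hce : c = Sum.inr e
      · rw [hce, hpe', Option.some.injEq] at hc
        exact hv.2 (Sum.inl_injective hc).symm
      · rw [hpe c hce] at hc
        exact h.partner_rep v hv.1 c hc
    · intro v hv
      rw [hfix] at hv
      rw [hdeath, if_neg hv.2]
      exact h.death_rep v hv.1
    · intro v hv
      rw [hdeath]
      by_cases hvx : v = s.rep x
      · exact ⟨e, by rw [hpe', hvx], if_pos hvx⟩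
      · rw [if_neg hvx]
        obtain ⟨e', h1, h2⟩ := h.killed v fun h1 => hv ((hfix v).2 ⟨h1, hvx⟩)
        refine ⟨e', ?_, h2⟩
        rw [hpe _ fun h3 => ?_, h1]
        rw [h3] at h1
        exact hσ (h.partner _ _ h1).1
    · intro v
      rw [hrep v]
      split_ifs with hv
      · rw [hrep, hry, if_neg (Ne.symm hxy')]
      · rw [hrep, h.rep_rep, if_neg hv]
    · intro v
      rw [hrep]
      split_ifs with hv
      · exact hbirth.trans (hv ▸ h.birth_rep v)
      · exact h.birth_rep v
    · rw [hrep, h.rep_star, if_neg (Ne.symm hstar)]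
    · intro v
      obtain ⟨w, hw, e'⟩ := h.homologous v
      have hw' : w ∈ Submodule.span (ZMod 2) (a' '' (Sum.inr '' insert e T)) := by
        refine Submodule.span_mono ?_ hw
        rintro _ ⟨_, ⟨e', he', rfl⟩, rfl⟩
        refine ⟨_, ⟨e', Set.mem_insert_of_mem _ he', rfl⟩, hae _ ?_⟩
        rintro rfl
        exact he he'
      rw [hrep]
      split_ifs with hv
      -- In the absorbed component, the chain to the old representative is prolonged by the new
      -- basis chain of `e`, which joins the two representatives.
      · refine ⟨w + a' (Sum.inr e), Submodule.add_mem _ hw' (Submodule.subset_span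
          ⟨_, ⟨e, Set.mem_insert _ _, rfl⟩, rfl⟩), ?_⟩
        have hae' : a' (Sum.inr e) = a (Sum.inr e) + z :=
          (Function.update_of_ne (fun h => by cases h) _ _).trans (Function.update_self _ _ _)
        rw [map_add, e', hae', hb, h.basis_rep _ hrx, hv]
        generalize Finsupp.single (Sum.inl (s.rep x)) (1 : ZMod 2) = A
        rw [add_assoc, ← add_assoc A, ZModModule.add_self, zero_add]
      · exact ⟨w, hw', e'⟩

theorem IsRunBasis.of_spawnEdges {l : List G.edgeSet} (hrun : SpawnEdges f star l s s') :
    l.Nodup → l.Pairwise (fun e e' => spawnTime f e ≤ spawnTime f e') →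
    ∀ (T : Set G.edgeSet) (a : G.toCellComplex.Cell → G.toCellComplex.Cell →₀ ZMod 2)
      (p : G.toCellComplex.Cell → Option G.toCellComplex.Cell), IsRunBasis f star T s a p →
    (∀ e ∈ l, e ∉ T ∧ ∀ e' ∈ T, spawnTime f e' ≤ spawnTime f e) →
    ∃ a' p', IsRunBasis f star (T ∪ {e | e ∈ l}) s' a' p' := by
  induction hrun with
  | nil s =>
    intro _ _ T a p h _
    refine ⟨a, p, ?_⟩
    simpa using h
  | cons e l s s' s'' he _ ih =>
    intro hnd hpw T a p h hl
    obtain ⟨a', p', h'⟩ := h.insert (hl e List.mem_cons_self).1 (hl e List.mem_cons_self).2 he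
    rw [List.nodup_cons] at hnd
    rw [List.pairwise_cons] at hpw
    obtain ⟨a'', p'', h''⟩ := ih hnd.2 hpw.2 _ a' p' h' (fun e₁ he₁ => by
      have h1 := hl e₁ (List.mem_cons_of_mem _ he₁)
      refine ⟨?_, ?_⟩
      · rintro (rfl | h2)
        · exact hnd.1 he₁
        · exact h1.1 h2
      · rintro e₂ (rfl | h2)
        · exact hpw.1 e₁ he₁
        · exact h1.2 e₂ h2)
    refine ⟨a'', p'', ?_⟩
    convert h'' using 1
    ext e'
    simp only [Set.mem_union, Set.mem_ofPred_eq, List.mem_cons, Set.mem_insert_iff]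
    tauto

theorem FiltrationRun.exists_isRunBasis (hrun : FiltrationRun f star s) :
    ∃ a p, IsRunBasis f star Set.univ s a p := by
  obtain ⟨l, hnd, hall, hpw, hl⟩ := hrun
  obtain ⟨a, p, h⟩ := IsRunBasis.of_spawnEdges hl hnd hpw ∅ _ _ (isRunBasis_empty f star)
    (fun e _ => ⟨fun h => h, fun _ h => h.elim⟩)
  refine ⟨a, p, ?_⟩
  convert h using 1
  ext e
  simp [hall e]

end Runs

end Graph

/-! ### Graphs: components in the filtration and in the contraction -/

namespace Graph

variable {α : Type u} {β : Type v} {G : Graph α β} [Finite G.vertexSet] [Finite G.edgeSet]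
  {f : Filtration G.toCellComplex} {star : G.vertexSet} {s : RepState G}
  {a : G.toCellComplex.Cell → G.toCellComplex.Cell →₀ ZMod 2}
  {p : G.toCellComplex.Cell → Option G.toCellComplex.Cell}

theorem spawned_univ : spawned (Set.univ : Set G.edgeSet) = Set.univ := by
  refine Set.eq_univ_of_forall fun c => ?_
  rcases c with x | e <;> trivial

theorem IsRunBasis.death_eq_top_iff (h : IsRunBasis f star Set.univ s a p) (v : G.vertexSet) :
    s.death v = ⊤ ↔ s.rep v = v := by
  refine ⟨fun hv => ?_, h.death_rep v⟩
  by_contra hne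
  obtain ⟨e, -, he⟩ := h.killed v hne
  exact ENat.natCast_ne_top _ (he.symm.trans hv)

open Classical in
theorem RepState.pairs_eq [Fintype G.vertexSet] (s : RepState G) : s.pairs f =
    (Finset.univ.filter (fun x => (birth f x : ℕ∞) < s.death x)).val.map
      (fun x => (birth f x, s.death x)) := by
  unfold pairs
  congr!

/-- The recorded death of a vertex is the step of the edge paired with it, or `⊤` if it is unpaired,
so the pairs are the 0-dimensional intervals of a reduced basis. -/
theorem IsRunBasis.isDiagram_pairs (h : IsRunBasis f star Set.univ s a p) :
    (f.forward 0).IsDiagram (s.pairs f) := by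
  classical
  have := Fintype.ofFinite G.toCellComplex.Cell
  have := Fintype.ofFinite G.vertexSet
  have hred : f.IsReducedBasis Set.univ a p := spawned_univ (G := G) ▸ h.toIsReducedBasis
  have hnone : ∀ v, p (Sum.inl v) = none := by
    intro v
    rcases ep : p (Sum.inl v) with _ | c
    · rfl
    · have := (hred.partner _ _ ep).2.2.2.1
      cases this
  -- Edges receive the end time `⊤` because no cell has an edge as its partner; they do not
  -- contribute in dimension zero.
  have hD := hred.isDiagram_forward 0 (fun c => if p c = none then (f.step c : ℕ∞) else ⊤)
    (Sum.elim s.death (fun _ => ⊤)) (fun i t => ?_) ?_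
  · rw [s.pairs_eq]
    convert hD using 1
    have hset : Finset.univ.filter (fun i : G.toCellComplex.Cell => G.toCellComplex.dim i = 0 ∧
        (if p i = none then (f.step i : ℕ∞) else ⊤) < Sum.elim s.death (fun _ => ⊤) i) =
        (Finset.univ.filter (fun x => (birth f x : ℕ∞) < s.death x)).map Function.Embedding.inl := by
      ext c
      rcases c with x | e
      · simp only [hnone, Finset.mem_filter_univ, if_true, Sum.elim_inl, Finset.mem_map,
          Function.Embedding.inl_apply, Sum.inl.injEq, exists_eq_right]
        exact and_iff_right trivial
      · simp
    rw [hset, Finset.map_val, Multiset.map_map]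
    refine (Multiset.map_congr rfl fun x _ => ?_).symm
    simp [hnone, birth]
  · by_cases hp : p i = none
    · simp [hp]
    · simp [hp]
  · rintro (v | e) t
    · by_cases hv : s.rep v = v
      · simp only [Sum.elim_inl, h.death_rep v hv, ENat.natCast_lt_top, true_iff]
        exact fun j hj => absurd hj (h.partner_rep v hv j)
      · obtain ⟨e, he, hd⟩ := h.killed v hv
        simp only [Sum.elim_inl, hd, Nat.cast_lt]
        refine ⟨fun ht j hj => ?_, fun ht => ht _ he⟩
        rw [hred.partner_inj _ _ _ hj he]
        exact ht
    · simp only [Sum.elim_inr, ENat.natCast_lt_top, true_iff]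
      intro j hj
      have := (hred.partner _ _ hj).2.2.2.1
      rcases j with x | e' <;> cases this

theorem birth_le_of_mem_IC {i : ℕ} {y : G.vertexSet} (h : Sum.inl y ∈ f.IC i) : birth f y ≤ i := by
  obtain ⟨σ, rfl, rfl | h⟩ := h
  · exact le_rfl
  · exact f.step_mono h

theorem mem_IC_birth (v : G.vertexSet) : Sum.inl v ∈ f.IC (birth f v) := ⟨_, rfl, Or.inl rfl⟩

section Contraction

variable (hstar : birth f star = 1) (hrep : ∀ v, s.rep (s.rep v) = s.rep v)
  (hbirth : ∀ v, birth f (s.rep v) ≤ birth f v)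
include hstar hbirth

-- A representative is born no later than any vertex it represents. So no vertex of its component
-- lies in an earlier `IC_j`, and at its own birth step the representative itself does: components
-- are absorbed exactly then.
open Classical in
include hrep in
theorem contractSteps_rep (i : ℕ) (x : G.vertexSet) :
    (contractSteps f star s i).rep x = if birth f (s.rep x) ≤ i then star else s.rep x := by
  induction i generalizing x with
  | zero => exact (if_neg (not_le.2 (f.one_le_step _))).symm
  | succ i ih =>
    change (if ∃ y : G.vertexSet, Sum.inl y ∈ f.IC (i + 1) ∧ (contractSteps f star s i).rep y =
      (contractSteps f star s i).rep x then star else (contractSteps f star s i).rep x) = _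
    rw [ih x]
    by_cases h1 : birth f (s.rep x) ≤ i
    · rw [if_pos h1, ite_self, if_pos (by omega)]
    rw [if_neg h1]
    by_cases h2 : birth f (s.rep x) = i + 1
    · rw [if_pos h2.le, if_pos]
      refine ⟨s.rep x, h2 ▸ mem_IC_birth _, ?_⟩
      rw [ih, hrep, if_neg h1]
    · have h3 : ¬ birth f (s.rep x) ≤ i + 1 := by omega
      rw [if_neg h3, if_neg]
      rintro ⟨y, hy, e⟩
      have hy' := birth_le_of_mem_IC hy
      have := hbirth y
      rw [ih] at e
      split_ifs at e with h3
      · rw [← e] at h1 h2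
        omega
      · rw [← e] at h1 h2
        omega

open Classical in
theorem contractSteps_death (hrep : ∀ v, s.rep (s.rep v) = s.rep v)
    (hdeath : ∀ v, s.death v = ⊤ → s.rep v = v) (i : ℕ) (v : G.vertexSet) :
    (contractSteps f star s i).death v =
      if s.death v = ⊤ ∧ v ≠ star ∧ birth f v ≤ i then ((f.steps + birth f v : ℕ) : ℕ∞)
      else s.death v := by
  induction i with
  | zero =>
    have := f.one_le_step (Sum.inl v)
    refine (if_neg fun h => ?_).symm
    exact absurd h.2.2 (not_le.2 this)
  | succ i ih =>
    change (if (contractSteps f star s i).death v = ⊤ ∧ v ≠ star ∧ ∃ y : G.vertexSet,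
      Sum.inl y ∈ f.IC (i + 1) ∧ (contractSteps f star s i).rep y = v then
      ((f.steps + (i + 1) : ℕ) : ℕ∞) else (contractSteps f star s i).death v) = _
    rw [ih]
    by_cases h1 : s.death v = ⊤ ∧ v ≠ star
    · obtain ⟨h1, h2⟩ := h1
      have hv := hdeath v h1
      simp only [h1, h2, ne_eq, not_false_eq_true, true_and]
      by_cases h3 : birth f v ≤ i
      · have h4 : birth f v ≤ i + 1 := by omega
        rw [if_pos h3, if_pos h4, if_neg]
        -- The vertex is already dead, and a finite death time is never overwritten.
        exact fun h => ENat.natCast_ne_top _ h.1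
      rw [if_neg h3]
      by_cases h4 : birth f v = i + 1
      · have hv' : (contractSteps f star s i).rep v = v := by
          rw [contractSteps_rep hstar hrep hbirth, hv, if_neg h3]
        rw [if_pos h4.le, if_pos ⟨rfl, v, h4 ▸ mem_IC_birth v, hv'⟩, h4]
      · have h5 : ¬ birth f v ≤ i + 1 := by omega
        rw [if_neg h5, if_neg]
        rintro ⟨-, y, hy, e⟩
        have hy' := birth_le_of_mem_IC hy
        have := hbirth y
        rw [contractSteps_rep hstar hrep hbirth] at e
        split_ifs at e with h5
        · exact h2 e.symm
        · rw [e] at this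
          omega
    · have h2 : ∀ P : Prop, ¬ (s.death v = ⊤ ∧ v ≠ star ∧ P) := fun P h => h1 ⟨h.1, h.2.1⟩
      rw [if_neg (h2 _), if_neg (h2 _), if_neg (h2 _)]

end Contraction

open Classical in
theorem RepState.pairs_eq_cons [Fintype G.vertexSet] (s : RepState G) (hstar : birth f star = 1)
    (h : s.death star = ⊤) : s.pairs f = (1, ⊤) ::ₘ
      (Finset.univ.filter
        (fun x => x ≠ star ∧ (birth f x : ℕ∞) < s.death x)).val.map
          (fun x => (birth f x, s.death x)) := by
  have hset : Finset.univ.filter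
      (fun x => (birth f x : ℕ∞) < s.death x) =
      insert star (Finset.univ.filter
        (fun x => x ≠ star ∧ (birth f x : ℕ∞) < s.death x)) := by
    ext x
    by_cases hx : x = star <;> simp [hx, h]
  rw [pairs_eq, hset, Finset.insert_val_of_notMem (by simp), Multiset.map_cons, hstar, h]

/-- The effect of the contraction steps on the pairs of the representatives. -/
theorem RepState.pairs_contractSteps (hstar : birth f star = 1)
    (hrep : ∀ v, s.rep (s.rep v) = s.rep v) (hbirth : ∀ v, birth f (s.rep v) ≤ birth f v)
    (hdeath : ∀ v, s.death v = ⊤ → s.rep v = v) (htop : s.death star = ⊤) :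
    ∃ R : Multiset (ℕ × ℕ∞), s.pairs f = (1, ⊤) ::ₘ R ∧
      (contractSteps f star s f.steps).pairs f = (1, ⊤) ::ₘ R.map
        (fun q => if q.2 = ⊤ then (q.1, ((f.steps + q.1 : ℕ) : ℕ∞)) else q) := by
  classical
  have := Fintype.ofFinite G.vertexSet
  have hd : ∀ v, (contractSteps f star s f.steps).death v =
      if s.death v = ⊤ ∧ v ≠ star then ((f.steps + birth f v : ℕ) : ℕ∞) else s.death v := by
    intro v
    have hv : birth f v ≤ f.steps := f.step_le_steps _
    rw [contractSteps_death hstar hbirth hrep hdeath]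
    simp [hv]
  refine ⟨_, s.pairs_eq_cons hstar htop, ?_⟩
  rw [pairs_eq_cons _ hstar (by rw [hd, if_neg (fun h => h.2 rfl), htop]), Multiset.map_map]
  congr 1
  have hn : 1 ≤ f.steps := f.one_le_steps (Sum.inl star)
  -- No pair becomes trivial or nontrivial: a changed death time is `n` plus the birth, and `n ≥ 1`.
  have hset : ∀ x, (x ≠ star ∧ (birth f x : ℕ∞) < (contractSteps f star s f.steps).death x) ↔
      (x ≠ star ∧ (birth f x : ℕ∞) < s.death x) := by
    intro x
    refine and_congr_right fun hx => ?_
    rw [hd]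
    split_ifs with h
    · rw [h.1]
      simp only [ENat.natCast_lt_top, iff_true, Nat.cast_lt]
      omega
    · rfl
  simp only [hset]
  refine Multiset.map_congr rfl fun x hx => ?_
  have hx' : x ≠ star := (Finset.mem_filter.1 hx).2.1
  simp only [Function.comp_apply, hd, hx', ne_eq, not_false_eq_true, and_true]
  split_ifs <;> rfl

/-- The diagrams of the components of a graph, from vertex representatives. -/
theorem FiltrationRun.isDiagram_pairs (hstar : birth f star = 1) (hs : FiltrationRun f star s) :
    (f.forward 0).IsDiagram (s.pairs f) ∧
      (Filtration.fb f f 0).IsDiagram ((contractSteps f star s f.steps).pairs f) := by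
  obtain ⟨a, p, h⟩ := hs.exists_isRunBasis
  have h0 := h.isDiagram_pairs
  refine ⟨h0, ?_⟩
  obtain ⟨R, hR, hR'⟩ := RepState.pairs_contractSteps hstar h.rep_rep h.birth_rep
    (fun v => (h.death_eq_top_iff v).1) (h.death_rep star h.rep_star)
  -- The basis attached to the run need not have even chains, so the FB diagram is not read off from
  -- it. Instead, uniqueness of the forward diagram identifies `R` with the intervals other than
  -- that of the root. In dimension zero FB persistence only replaces `∞` by `n` plus the birth in
  -- these.
  obtain ⟨root, E, P, hb⟩ := f.exists_isBarcode
  have hroot := hb.root_zero (Sum.inl star)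
  have e := h0.unique (hb.forward 0)
  rw [hR, hroot, Multiset.map_add, Multiset.map_singleton, add_assoc, Multiset.singleton_add,
    Multiset.cons_inj_right] at e
  have hfb := hb.fb 0
  rw [hroot] at hfb
  convert hfb using 1
  rw [hR', e, Multiset.map_singleton, Multiset.singleton_add]
  simp [Filtration.fbBars, Filtration.shiftBars]

end Graph

/-! ### Dimension one, and the final assembly -/

namespace Filtration

variable {X : CellComplex.{u}} {f : Filtration X}

/-- For a complex of dimension at most one, the diagram of FB persistence in dimension one. -/
theorem isDiagram_fb_one (f : Filtration X) (hX : ∀ c, X.dim c ≠ 2) :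
    (fb f f 1).IsDiagram ((f.forward 1).diagram.map (fun p => (p.1, ((f.steps + p.1 : ℕ) : ℕ∞))) +
      (finitePairs (f.forward 0).diagram).map
        (fun p => (f.steps + p.1, (f.steps : ℕ∞) + p.2))) := by
  classical
  obtain ⟨root, E, P, hb⟩ := f.exists_isBarcode
  -- Without 2-cells every 1-class of the filtration lives until the contraction; the remaining FB
  -- intervals in dimension one are the shifted 0-dimensional ones.
  have hP := hb.P_eq_zero 1 hX
  have hfb := hb.fb 1
  rw [(hb.forward 0).diagram_eq, (hb.forward 1).diagram_eq]
  convert hfb using 1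
  have hfin : finitePairs ((root 0 + E 0).map (fun e => (e, (⊤ : ℕ∞))) +
      (P 0).map (fun x => (x.1, (x.2 : ℕ∞)))) = (P 0).map (fun x => (x.1, (x.2 : ℕ∞))) := by
    rw [finitePairs, Multiset.filter_add, Multiset.filter_eq_nil.2, zero_add,
      Multiset.filter_eq_self]
    · intro q hq
      obtain ⟨x, -, rfl⟩ := Multiset.mem_map.1 hq
      exact ENat.natCast_ne_top _
    · intro q hq
      obtain ⟨x, -, rfl⟩ := Multiset.mem_map.1 hq
      exact not_not.2 rfl
  rw [hfin, hb.root_succ 0, hP]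
  simp [Filtration.fbBars, Filtration.shiftBars, hP]

/-- Every cycle of a complex of dimension at most one that is born at `i` in the filtration dies at
`n + i`. -/
theorem diesAt_fb_one (f : Filtration X) (hX : ∀ c, X.dim c ≠ 2) {i : ℕ} (hi : 1 ≤ i)
    (hin : i ≤ f.steps) {z : (fb f f 1).V i} (hz : (fb f f 1).BornAt i z) :
    (fb f f 1).DiesAt i z (f.steps + i) := by
  obtain ⟨root, E, P, hb⟩ := f.exists_isBarcode
  have hP := hb.P_eq_zero 1 hX
  refine (hb.fb 1).diesAt (fun q hq hqi _ => ?_) hi hz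
  rw [hb.root_succ 0, Multiset.map_zero, zero_add] at hq
  obtain ⟨x, hx, rfl⟩ := Multiset.mem_map.1 hq
  rcases mem_fbBars.1 hx with ⟨e, -, rfl⟩ | hx | ⟨l, hl, y, hy, rfl⟩
  · rfl
  · rw [hP] at hx
    exact absurd hx (Multiset.notMem_zero _)
  -- Shifted intervals are born after time `n`, so none is present at `i ≤ n`.
  · have := (hb.mem_P l y hy).1
    simp only at hqi
    omega

theorem existsUnique_isDiagram (f : Filtration X) (k : ℕ) :
    (∃! D, (f.forward k).IsDiagram D) ∧ (∃! D, (fb f f k).IsDiagram D) := by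
  obtain ⟨root, E, P, hb⟩ := f.exists_isBarcode
  exact ⟨⟨_, hb.forward k, fun _ h => h.unique (hb.forward k)⟩,
    ⟨_, hb.fb k, fun _ h => h.unique (hb.fb k)⟩⟩

end Filtration

theorem mainTheorem6 :
    -- the diagrams are well defined
    (∀ (X : CellComplex.{u}) (f : Filtration X) (k : ℕ),
      (∃! D, (f.forward k).IsDiagram D) ∧ (∃! D, (Filtration.fb f f k).IsDiagram D)) ∧
    -- `(f,f)`-FB persistence has the same expressive power as forward persistence
    (∀ (X : CellComplex.{u}) (Y : CellComplex.{v}) (f : Filtration X) (g : Filtration Y),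
      ((∀ k, (Filtration.fb f f k).diagram = (Filtration.fb g g k).diagram) →
        ∀ k, (f.forward k).diagram = (g.forward k).diagram) ∧
      (f.steps = g.steps → (∀ k, (f.forward k).diagram = (g.forward k).diagram) →
        ∀ k, (Filtration.fb f f k).diagram = (Filtration.fb g g k).diagram)) ∧
    -- the explicit description for graphs
    (∀ (α : Type u') (β : Type v') (G : Graph α β) [Finite G.vertexSet] [Finite G.edgeSet]
      (f : Filtration G.toCellComplex),
      -- a cycle born in the filtration at `i` dies at `n + i`
      (∀ i, 1 ≤ i → i ≤ f.steps → ∀ z : (Filtration.fb f f 1).V i,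
        (Filtration.fb f f 1).BornAt i z → (Filtration.fb f f 1).DiesAt i z (f.steps + i)) ∧
      -- all pairs for cycles: those born in the filtration, and those born in the contraction
      (Filtration.fb f f 1).diagram =
        (f.forward 1).diagram.map (fun p => (p.1, ((f.steps + p.1 : ℕ) : ℕ∞))) +
        (finitePairs (f.forward 0).diagram).map
          (fun p => (f.steps + p.1, (f.steps : ℕ∞) + p.2)) ∧
      -- the pairs for components, and the merging of components, from vertex representatives
      (∀ star : G.vertexSet, Graph.birth f star = 1 →
        (∃ s, Graph.FiltrationRun f star s) ∧
        ∀ s, Graph.FiltrationRun f star s →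
          (f.forward 0).diagram = s.pairs f ∧
          (Filtration.fb f f 0).diagram = (Graph.contractSteps f star s f.steps).pairs f ∧
          (Filtration.fb f f 1).diagram =
            (f.forward 1).diagram.map (fun p => (p.1, ((f.steps + p.1 : ℕ) : ℕ∞))) +
            (finitePairs (s.pairs f)).map
              (fun p => (f.steps + p.1, (f.steps : ℕ∞) + p.2)))) := by
  refine ⟨fun X f k => f.existsUnique_isDiagram k, fun X Y f g =>
    ⟨fun h k => Filtration.forward_diagram_eq_of_fb f g h k,
      fun hn h k => Filtration.fb_diagram_eq_of_forward f g hn h k⟩, ?_⟩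
  intro α β G _ _ f
  have hX : ∀ c, G.toCellComplex.dim c ≠ 2 := fun c => Graph.dim_ne_two c 0
  have h1 := (f.isDiagram_fb_one hX).diagram_eq
  refine ⟨fun i hi hin z hz => f.diesAt_fb_one hX hi hin hz, h1, fun star hstar =>
    ⟨Graph.exists_filtrationRun f hstar, fun s hs => ?_⟩⟩
  obtain ⟨h2, h3⟩ := hs.isDiagram_pairs hstar
  refine ⟨h2.diagram_eq, h3.diagram_eq, ?_⟩
  rw [← h2.diagram_eq]
  exact h1
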